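/- Conventions. $\log$ is base 2, $[w]=\{1,\dots,w\}$, $U_n$ is uniform on $\{0,1\}^n$, and families are indexed by positive integers $w$; $s,m,a',\epsilon$ are functions of $w$. A $(w,1)$-automaton is a function $Q:[w]\times\{0,1\}\to[w]$; for $q\in[w]$ and $x\in\{0,1\}^m$, $Q^m(q;x)$ is the state reached from $q$ after reading the bits of $x$ in order. $\mathbf Q_{w,1}^m$ is the set of functions $x\mapsto Q^m(q;x)$, each presented by a pair $(Q,q)$; sets $\mathbf A_w\subseteq\mathbf Q_{w,1}^m$ below are given as sets of such pairs. Space is the work-tape space of a deterministic Turing machine with read-only input and write-only output; automata are written as transition tables, and numbers given as inputs are in binary. A sequence $((Q_1,q_1),(Q_2,q_2),\dots)$, with $Q_w$ a $(w,1)$-automaton and $q_w\in[w]$, is uniform if some deterministic algorithm, given $w$, outputs $(Q_w,q_w)$ in space $O(\log w)$. A family $\{\mathbf A_w\}$ covers the uniform setting if for every uniform sequence, $(Q_w,q_w)\in\mathbf A_w$ for all sufficiently large $w$. A family $\mathsf{Gen}_w:\mathbf A_w\times\{0,1\}^{s}\to\{0,1\}^{m}$ is a targeted $\epsilon$-pseudorandom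 generator against $\mathbf Q_{w,1}^m$ in the uniform setting if $\{\mathbf A_w\}$ covers the uniform setting and, for every $w$ and every $(Q,q)\in\mathbf A_w$, the distributions of $Q^m(q;\mathsf{Gen}_w(Q,q,U_s))$ and $Q^m(q;U_m)$ are at total variation distance at most $\epsilon$. A family $\mathsf{Gen}'_w:\{0,1\}^{s}\to\{0,1\}^{a'}$ is an $\epsilon$-simulation advice generator for $\mathbf Q_{w,1}^m$ in the uniform setting if there are a family $\{\mathbf A'_w\}$ covering the uniform setting and a single deterministic algorithm $\mathsf S$, using space logarithmic in its input length, such that for every $w$ and every $(Q,q)\in\mathbf A'_w$ the distributions of $\mathsf S(Q,q,\mathsf{Gen}'_w(U_s))$ and $Q^m(q;U_m)$ are at total variation distance at most $\epsilon$. Either kind of family is efficiently computable if $s$ is space constructible ($s(w)$ is computable from $1^w$ in space $O(s(w))$) and, given $w$ and an argument of the $w$-th generator, its value is computable in deterministic space $O(s(w))$. Proposition. Let $\mu\in[0,1]$ and $\sigma>\eta>0$ be constants. Suppose $\{\mathsf{Gen}_w\}$ is an efficiently computable targeted $\epsilon$-pseudorandom generator against $\mathbf Q_{w,1}^m$ in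 the uniform setting with seed length $s$, where $$s\le O(\log^{1+\sigma}w),\qquad \log(1/\epsilon)=\log^{1+\eta}w,\qquad \log m\ge\log^{\mu}w\quad(w\ge 2).$$ Then there is an efficiently computable $\epsilon$-simulation advice generator $\{\mathsf{Gen}'_w\}$ for $\mathbf Q_{w,1}^m$ in the uniform setting with the same seed length $s$ and output length $a'\le\mathrm{poly}(w)$. -/

import Mathlib

open Filter Asymptotics

namespace SpaceDerand

/-! ### Deterministic space-bounded computation -/

/-- A head movement. -/
inductive Move where
  | left
  | stay
  | right

/-- What a machine with `t` input tapes and `k` work tapes does in one step. -/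
structure Action (t k : ℕ) (State : Type) where
  next : State
  inMove : Fin t → Move
  write : Fin k → Option Bool
  workMove : Fin k → Move
  /-- the bit appended to the write-only output tape, if any -/
  emit : Option Bool

/-- A deterministic offline Turing machine with `t` read-only two-way input tapes, `k` two-way
infinite read-write work tapes over the alphabet `{0, 1, blank}` (the blank is `none`), a
write-only one-way output tape and finitely many control states. The machine halts when the
transition function returns `none`. -/
structure OfflineTM (t : ℕ) where
  k : ℕ
  State : Type
  [fin : Fintype State]
  start : State
  δ : State → (Fin t → Option Bool) → (Fin k → Option Bool) → Option (Action t k State)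

namespace OfflineTM

variable {t : ℕ}

/-- Configurations. Cell `j + 1` of an input tape holds the `j`-th input bit; input heads live on
the cells `0, …, n + 1`, where `n` is the length of the input, and cells `0` and `n + 1` look
blank. -/
structure Cfg (M : OfflineTM t) where
  state : M.State
  inPos : Fin t → ℕ
  tape : Fin M.k → ℤ → Option Bool
  pos : Fin M.k → ℤ
  out : List Bool

/-- The symbol seen at cell `p` of an input tape holding `l`. -/
def readInput (l : List Bool) : ℕ → Option Bool
  | 0 => none
  | p + 1 => l[p]?

/-- Movement of an input head, confined to the cells `0, …, n + 1`. -/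
def moveInput (n : ℕ) : Move → ℕ → ℕ
  | .left, p => p - 1
  | .stay, p => p
  | .right, p => min (p + 1) (n + 1)

/-- Movement of a work head. -/
def moveWork : Move → ℤ → ℤ
  | .left, p => p - 1
  | .stay, p => p
  | .right, p => p + 1

/-- The initial configuration: all work tapes blank, all heads at cell `0`, no output. -/
def init (M : OfflineTM t) : M.Cfg where
  state := M.start
  inPos := fun _ => 0
  tape := fun _ _ => none
  pos := fun _ => 0
  out := []

/-- One step of the machine on the input `inp`; `none` if the machine has halted. -/
def step (M : OfflineTM t) (inp : Fin t → List Bool) (c : M.Cfg) : Option M.Cfg :=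
  (M.δ c.state (fun i => readInput (inp i) (c.inPos i)) (fun i => c.tape i (c.pos i))).map
    fun A =>
      { state := A.next
        inPos := fun i => moveInput (inp i).length (A.inMove i) (c.inPos i)
        tape := fun i => Function.update (c.tape i) (c.pos i) (A.write i)
        pos := fun i => moveWork (A.workMove i) (c.pos i)
        out := c.out ++ A.emit.toList }

/-- On the input `inp` the machine halts with output `o`, and at all times every work head is
within distance `L` of its initial cell. -/
def OutputsInSpace (M : OfflineTM t) (inp : Fin t → List Bool) (o : List Bool) (L : ℕ) : Prop :=
  (∃ c ∈ StateTransition.eval (M.step inp) M.init, c.out = o) ∧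
    ∀ c, StateTransition.Reaches (M.step inp) M.init c → ∀ i, |c.pos i| ≤ (L : ℤ)

end OfflineTM

/-- A single deterministic machine maps the input `inp i` to the output `out i` in space
`O(b i)`, for all `i`. (The `+ 1` only matters where `b i = 0`.) -/
def ComputableInSpace {ι : Type} {t : ℕ} (inp : ι → Fin t → List Bool) (out : ι → List Bool)
    (b : ι → ℕ) : Prop :=
  ∃ (M : OfflineTM t) (C : ℕ), ∀ i, M.OutputsInSpace (inp i) (out i) (C * (b i + 1))

/-! ### Bit strings, automata and their encodings -/

/-- `{0, 1} ^ n`. -/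
abbrev Bits (n : ℕ) : Type := Fin n → Bool

/-- A `(w, 1)`-automaton, with state set `Fin w`. -/
abbrev Automaton (w : ℕ) : Type := Fin w → Bool → Fin w

/-- A pair `(Q, q)` of an automaton and a start state. -/
abbrev Pointed (w : ℕ) : Type := Automaton w × Fin w

/-- The function `x ↦ Q ^ m (q; x)` specified by the pair `(Q, q)`: the state reached from `q`
after reading the bits of `x` in order. -/
def Pointed.fn {w : ℕ} (m : ℕ) (p : Pointed w) (x : Bits m) : Fin w :=
  (List.ofFn x).foldl p.1 p.2

/-- A state of a `w`-state automaton in binary, least significant bit first, in the fixed width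
`Nat.size w`. -/
def encState {w : ℕ} (q : Fin w) : List Bool :=
  List.ofFn fun j : Fin (Nat.size w) => Nat.testBit q j

/-- The transition table of an automaton. -/
def encAutomaton {w : ℕ} (Q : Automaton w) : List Bool :=
  (List.finRange w).flatMap fun i => encState (Q i false) ++ encState (Q i true)

/-! ### Simulators and generators -/

/-- The distribution of `f (U_n)`. -/
noncomputable def law {n : ℕ} {α : Type} (f : Bits n → α) : PMF α :=
  (PMF.uniformOfFintype (Bits n)).map f

/-- The total variation distance between `P` and `P'` is at most `ε`. -/
def TVClose {α : Type} (ε : ℝ) (P P' : PMF α) : Prop :=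
  ∀ E : Set α, |(P.toOuterMeasure E).toReal - (P'.toOuterMeasure E).toReal| ≤ ε

/-- `Sim` is an `ε`-simulator for the functions `{0, 1} ^ m → [w]` specified by the pairs
in `A`. -/
def IsSimulator {w s : ℕ} (ε : ℝ) (m : ℕ) (A : Set (Pointed w)) (Sim : A → Bits s → Fin w) :
    Prop :=
  ∀ f : A, TVClose ε (law (Sim f)) (law (f.1.fn m))

/-- `Gen` is a targeted `ε`-pseudorandom generator against the functions specified by the pairs
in `A`. -/
def IsTargetedPRG {w s m : ℕ} (ε : ℝ) (A : Set (Pointed w)) (Gen : A → Bits s → Bits m) : Prop :=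
  IsSimulator ε m A fun f x => f.1.fn m (Gen f x)

/-- A deterministic logspace algorithm that gets a number of states `w`, an automaton, a start
state and an advice string, and outputs a state: its space is logarithmic in the total length of
its input. -/
def IsLogspaceAlgorithm (S : (w : ℕ+) → Pointed w → List Bool → Fin w) : Prop :=
  ComputableInSpace (ι := (w : ℕ+) × Pointed w × List Bool)
    (fun ⟨w, p, y⟩ => ![Nat.bits w, encAutomaton p.1, encState p.2, y])
    (fun ⟨w, p, y⟩ => encState (S w p y))
    (fun ⟨w, p, y⟩ => Nat.log 2 ((Nat.bits w).length + (encAutomaton p.1).length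
      + (encState p.2).length + y.length))

/-- The family `Gen` is an `ε`-simulation advice generator for the functions specified by the
pairs in `A w`. -/
def IsSimulationAdviceGenerator {s a : ℕ+ → ℕ} (ε : ℕ+ → ℝ) (m : ℕ+ → ℕ)
    (A : (w : ℕ+) → Set (Pointed w)) (Gen : (w : ℕ+) → Bits (s w) → Bits (a w)) : Prop :=
  ∃ S : (w : ℕ+) → Pointed w → List Bool → Fin w, IsLogspaceAlgorithm S ∧
    ∀ w, IsSimulator (ε w) (m w) (A w) fun f x => S w f.1 (List.ofFn (Gen w x))

/-- `s` is space constructible: from `w` in unary, `s w` is computed in binary in space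
`O(s w)`. -/
def SpaceConstructible (s : ℕ+ → ℕ) : Prop :=
  ComputableInSpace (fun w : ℕ+ => ![List.replicate w true]) (fun w => Nat.bits (s w)) s

/-- Efficient computability of a family of targeted generators with seed length `s`, where the
`w`-th generator is defined on `A w`. -/
def EfficientTargeted {s m : ℕ+ → ℕ} (A : (w : ℕ+) → Set (Pointed w))
    (Gen : (w : ℕ+) → A w → Bits (s w) → Bits (m w)) : Prop :=
  SpaceConstructible s ∧
    ComputableInSpace (ι := (w : ℕ+) × A w × Bits (s w))
      (fun ⟨w, p, x⟩ => ![Nat.bits w, encAutomaton p.1.1, encState p.1.2, List.ofFn x])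
      (fun ⟨w, p, x⟩ => List.ofFn (Gen w p x))
      (fun ⟨w, _, _⟩ => s w)

/-- Efficient computability of a family of advice generators with seed length `s`. -/
def EfficientAdvice {s a : ℕ+ → ℕ} (Gen : (w : ℕ+) → Bits (s w) → Bits (a w)) : Prop :=
  SpaceConstructible s ∧
    ComputableInSpace (ι := (w : ℕ+) × Bits (s w))
      (fun ⟨w, x⟩ => ![Nat.bits w, List.ofFn x])
      (fun ⟨w, x⟩ => List.ofFn (Gen w x))
      (fun ⟨w, _⟩ => s w)

/-! ### The uniform setting -/

/-- The sequence `(Q_w, q_w)` is produced from `w` in space `O(log w)`. -/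
def IsUniformSequence (p : (w : ℕ+) → Pointed w) : Prop :=
  ComputableInSpace (fun w : ℕ+ => ![Nat.bits w])
    (fun w => encAutomaton (p w).1 ++ encState (p w).2) (fun w => Nat.log 2 w)

/-- Every uniform sequence is eventually in `A`. -/
def CoversUniform (A : (w : ℕ+) → Set (Pointed w)) : Prop :=
  ∀ p : (w : ℕ+) → Pointed w, IsUniformSequence p → ∀ᶠ w in atTop, p w ∈ A w

end SpaceDerand

/-!
The advice must answer for every automaton of a uniform sequence, whereas the targeted generator
answers for one automaton that it is given. If `s` is below the size of `w`, the space `s` is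
logarithmic in the length of the input of the simulator, which can therefore run the generator on
the seed by itself. Otherwise let `G` be the size of the size of `w`. A uniform automaton is the
output, in space `O(log w)`, of a fixed machine, which is eventually among the `G ^ 3` machines
whose transition table, base and number of work tapes are below `G`. The advice lists, for each of
these machines run in space `s / G`, its output followed by the state to which the generator takes
the automaton encoded by that output; the simulator looks up the automaton it is given.

The lookup needs the space `O(log w)` of the uniform sequence to be below `s / G`, so it needs a
lower bound on `s`. The automaton that counts the ones at the end of its input provides it: on
uniform bits it reaches `s + 1` with probability `2 ^ (-(s + 1))`, which is no multiple of
`2 ^ (-s)`, so that a generator that stretches its seed has error at least `2 ^ (-(s + 1))`; with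
the hypothesis on `ε` this gives `log ^ (1 + η) w ≤ s + 1`. A generator that does not stretch its
seed may be replaced by a prefix of the seed, and the advice generator detects this case by running
the given generator on that same automaton.

For the space bounds no machine needs to be written down: structured programs whose registers are
stacks of bits can be compiled to machines, and the functions that they compute in bounded space,
with values in `2 ^ O(space)`, are closed under composition, conditionals and iteration. In
particular they include the simulation of a machine whose transition table is given as a number.
-/

namespace SpaceDerand

section StackMachines

/-! ### Structured programs over stacks -/

/-- Structured programs for a machine with `t` input tapes whose work tapes are stacks of bits.
Since the stacks are named by natural numbers, a program does not fix their number. -/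
inductive Prog (t : ℕ) where
  | skip
  | push (r : ℕ) (b : Bool)
  | pop (r : ℕ)
  | move (j : Fin t) (d : Move)
  | emit (b : Bool)
  | seq (p q : Prog t)
  | branch (r : ℕ) (p : Option Bool → Prog t)
  | branchIn (j : Fin t) (p : Option Bool → Prog t)
  | loop (r : ℕ) (c : Option Bool → Bool) (p : Prog t)

/-- The memory of a stack program: its registers, each holding a stack with the top first, the
positions of the input heads and the output written so far. -/
@[ext]
structure Store (t : ℕ) where
  reg : ℕ → List Bool
  head : Fin t → ℕ
  out : List Bool

variable {t K : ℕ} {inp : Fin t → List Bool} {B : ℕ}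

namespace Store

/-- The memory in which a program is started. -/
def initial : Store t := ⟨fun _ => [], fun _ => 0, []⟩

/-- Replace the contents of a register. -/
def set (s : Store t) (r : ℕ) (l : List Bool) : Store t :=
  { s with reg := Function.update s.reg r l }

@[simp] theorem set_reg (s : Store t) (r : ℕ) (l : List Bool) (r' : ℕ) :
    (s.set r l).reg r' = if r' = r then l else s.reg r' := by
  simp [set, Function.update_apply]

@[simp] theorem set_head (s : Store t) (r : ℕ) (l : List Bool) : (s.set r l).head = s.head := rfl

@[simp] theorem set_out (s : Store t) (r : ℕ) (l : List Bool) : (s.set r l).out = s.out := rfl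

theorem ext_reg {s s' : Store t} (hreg : ∀ r, s.reg r = s'.reg r) (hhead : s.head = s'.head)
    (hout : s.out = s'.out) : s = s' := Store.ext (funext hreg) hhead hout

theorem set_eq_self {s : Store t} {r : ℕ} {l : List Bool} (h : s.reg r = l) : s.set r l = s := by
  subst h
  simp [set]

@[simp] theorem set_set (s : Store t) (r : ℕ) (l l' : List Bool) :
    (s.set r l).set r l' = s.set r l' := by
  simp [set]

theorem set_comm (s : Store t) {r r' : ℕ} (h : r ≠ r') (l l' : List Bool) :
    (s.set r l).set r' l' = (s.set r' l').set r l := by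
  simp only [set, Function.update_comm h]

/-- All stacks have height at most `B`. -/
def Bounded (B : ℕ) (s : Store t) : Prop := ∀ r, (s.reg r).length ≤ B

theorem Bounded.set {s : Store t} (h : s.Bounded B) {r : ℕ} {l : List Bool} (hl : l.length ≤ B) :
    (s.set r l).Bounded B := by
  intro r'
  rw [set_reg]
  split_ifs
  exacts [hl, h r']

end Store

/-- Big-step semantics: `p` leads from `s` to `s'`, and no push makes a stack higher than `B`. -/
inductive Runs (inp : Fin t → List Bool) (B : ℕ) : Prog t → Store t → Store t → Prop
  | skip (s) : Runs inp B .skip s s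
  | push (r b s) (h : (s.reg r).length + 1 ≤ B) :
      Runs inp B (.push r b) s (s.set r (b :: s.reg r))
  | pop (r s) : Runs inp B (.pop r) s (s.set r (s.reg r).tail)
  | move (j d s) : Runs inp B (.move j d) s
      { s with head := Function.update s.head j
                (OfflineTM.moveInput (inp j).length d (s.head j)) }
  | emit (b s) : Runs inp B (.emit b) s { s with out := s.out ++ [b] }
  | seq {p q s s' s''} (hp : Runs inp B p s s') (hq : Runs inp B q s' s'') :
      Runs inp B (.seq p q) s s''
  | branch {r p s s'} (h : Runs inp B (p (s.reg r).head?) s s') : Runs inp B (.branch r p) s s'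
  | branchIn {j p s s'} (h : Runs inp B (p (OfflineTM.readInput (inp j) (s.head j))) s s') :
      Runs inp B (.branchIn j p) s s'
  | loopDone {r c p s} (h : c (s.reg r).head? = false) : Runs inp B (.loop r c p) s s
  | loopStep {r c p s s' s''} (h : c (s.reg r).head? = true) (hp : Runs inp B p s s')
      (hl : Runs inp B (.loop r c p) s' s'') : Runs inp B (.loop r c p) s s''

namespace Runs

variable {p : Prog t} {s s' s'' : Store t}

theorem mono {B' : ℕ} (hB : B ≤ B') (h : Runs inp B p s s') : Runs inp B' p s s' := by
  induction h with
  | skip s => exact .skip s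
  | push r b s h => exact .push r b s (h.trans hB)
  | pop r s => exact .pop r s
  | move j d s => exact .move j d s
  | emit b s => exact .emit b s
  | seq _ _ ihp ihq => exact .seq ihp ihq
  | branch _ ih => exact .branch ih
  | branchIn _ ih => exact .branchIn ih
  | loopDone h => exact .loopDone h
  | loopStep h _ _ ihp ihl => exact .loopStep h ihp ihl

theorem cast (h : Runs inp B p s s') (e : s' = s'') : Runs inp B p s s'' := e ▸ h

theorem push_eq {r : ℕ} {b : Bool} (h : (s.reg r).length + 1 ≤ B)
    (hs : s' = s.set r (b :: s.reg r)) : Runs inp B (.push r b) s s' :=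
  hs ▸ push r b s h

theorem pop_eq {r : ℕ} (hs : s' = s.set r (s.reg r).tail) : Runs inp B (.pop r) s s' :=
  hs ▸ pop r s

theorem bounded (h : Runs inp B p s s') (hs : s.Bounded B) : s'.Bounded B := by
  induction h with
  | skip | move | emit | loopDone => exact hs
  | push r b s h => exact hs.set h
  | pop r s => exact hs.set (by have := hs r; rw [List.length_tail]; omega)
  | seq _ _ ihp ihq => exact ihq (ihp hs)
  | branch _ ih | branchIn _ ih => exact ih hs
  | loopStep _ _ _ ihp ihl => exact ihl (ihp hs)

end Runs

namespace Prog

/-- All registers mentioned by the program are smaller than `K`, so that a machine with `K` work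
tapes can run it. -/
def RegsLt (K : ℕ) : Prog t → Prop
  | .skip => True
  | .push r _ => r < K
  | .pop r => r < K
  | .move _ _ => True
  | .emit _ => True
  | .seq p q => p.RegsLt K ∧ q.RegsLt K
  | .branch r p => r < K ∧ ∀ o, (p o).RegsLt K
  | .branchIn _ p => ∀ o, (p o).RegsLt K
  | .loop r _ p => r < K ∧ p.RegsLt K

theorem RegsLt.mono {K' : ℕ} (h : K ≤ K') : ∀ {p : Prog t}, p.RegsLt K → p.RegsLt K'
  | .skip, _ => trivial
  | .push _ _, hp => lt_of_lt_of_le hp h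
  | .pop _, hp => lt_of_lt_of_le hp h
  | .move _ _, _ => trivial
  | .emit _, _ => trivial
  | .seq _ _, hp => ⟨hp.1.mono h, hp.2.mono h⟩
  | .branch _ _, hp => ⟨lt_of_lt_of_le hp.1 h, fun o => (hp.2 o).mono h⟩
  | .branchIn _ _, hp => fun o => (hp o).mono h
  | .loop _ _ _, hp => ⟨lt_of_lt_of_le hp.1 h, hp.2.mono h⟩

theorem exists_forall_regsLt (p : Option Bool → Prog t) (h : ∀ o, ∃ K, (p o).RegsLt K) :
    ∃ K, ∀ o, (p o).RegsLt K := by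
  choose K hK using h
  exact ⟨Finset.univ.sup K, fun o => (hK o).mono (Finset.le_sup (Finset.mem_univ o))⟩

theorem exists_regsLt : ∀ p : Prog t, ∃ K, p.RegsLt K
  | .skip => ⟨0, trivial⟩
  | .push r _ => ⟨r + 1, Nat.lt_succ_self r⟩
  | .pop r => ⟨r + 1, Nat.lt_succ_self r⟩
  | .move _ _ => ⟨0, trivial⟩
  | .emit _ => ⟨0, trivial⟩
  | .seq p q => by
      obtain ⟨K, hK⟩ := p.exists_regsLt
      obtain ⟨K', hK'⟩ := q.exists_regsLt
      exact ⟨max K K', hK.mono (le_max_left _ _), hK'.mono (le_max_right _ _)⟩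
  | .branch r p => by
      obtain ⟨K, hK⟩ := exists_forall_regsLt p fun o => (p o).exists_regsLt
      exact ⟨max (r + 1) K, by simp, fun o => (hK o).mono (le_max_right _ _)⟩
  | .branchIn _ p => exists_forall_regsLt p fun o => (p o).exists_regsLt
  | .loop r _ p => by
      obtain ⟨K, hK⟩ := p.exists_regsLt
      exact ⟨max (r + 1) K, by simp, hK.mono (le_max_right _ _)⟩

end Prog

/-! ### Compilation of programs to machines -/

/-- The tapes of a machine with `K` work tapes, without its control state. -/
@[ext]
structure Tapes (t K : ℕ) where
  inPos : Fin t → ℕ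
  tape : Fin K → ℤ → Option Bool
  pos : Fin K → ℤ
  out : List Bool

namespace Tapes

/-- The effect of an action on the tapes. -/
def act {S : Type} (inp : Fin t → List Bool) (m : Tapes t K) (A : Action t K S) : Tapes t K where
  inPos := fun i => OfflineTM.moveInput (inp i).length (A.inMove i) (m.inPos i)
  tape := fun i => Function.update (m.tape i) (m.pos i) (A.write i)
  pos := fun i => OfflineTM.moveWork (A.workMove i) (m.pos i)
  out := m.out ++ A.emit.toList

/-- All work heads are within distance `B` of cell `0`. -/
def Bounded (B : ℕ) (m : Tapes t K) : Prop := ∀ i, |m.pos i| ≤ (B : ℤ)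

end Tapes

/-- The action that changes nothing but the control state, on scanned work symbols `y`. -/
def idle {S : Type} (next : S) (y : Fin K → Option Bool) : Action t K S :=
  ⟨next, fun _ => .stay, y, fun _ => .stay, none⟩

theorem Tapes.act_idle {S : Type} (m : Tapes t K) (q : S) :
    m.act inp (idle q fun i => m.tape i (m.pos i)) = m := by
  ext <;> simp [act, idle, OfflineTM.moveInput, OfflineTM.moveWork]

/-- Change the successor state of an action. -/
def Action.mapNext {S S' : Type} (f : S → S') (A : Action t K S) : Action t K S' :=
  { A with next := f A.next }

/-- A finite control with one entry and one exit, the latter written `none`, so that controls can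
be composed. -/
structure Control (t K : ℕ) where
  State : Type
  fin : Fintype State
  start : State
  δ : State → (Fin t → Option Bool) → (Fin K → Option Bool) → Action t K (Option State)

namespace Control

/-- One step of a finite control. -/
def step (M : Control t K) (inp : Fin t → List Bool) :
    Option M.State × Tapes t K → Option (Option M.State × Tapes t K)
  | (none, _) => none
  | (some q, m) =>
    let A := M.δ q (fun i => OfflineTM.readInput (inp i) (m.inPos i)) (fun i => m.tape i (m.pos i))
    some (A.next, m.act inp A)

/-- A run of a finite control, all of whose configurations but the first are bounded. -/
def Path (M : Control t K) (inp : Fin t → List Bool) (B : ℕ) :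
    Option M.State × Tapes t K → Option M.State × Tapes t K → Prop :=
  Relation.ReflTransGen fun x y => M.step inp x = some y ∧ y.2.Bounded B

/-- A bounded run from the entry of a finite control to its exit. -/
def Executes (M : Control t K) (inp : Fin t → List Bool) (B : ℕ) (m m' : Tapes t K) : Prop :=
  M.Path inp B (some M.start, m) (none, m')

/-- The map on control states that embeds a control into another one and redirects its exit. -/
def embedState {S S' : Type} (f : S → S') (e : Option S') : Option S → Option S'
  | some q => some (f q)
  | none => e

/-- Sequential composition of controls. -/
def seq (M N : Control t K) : Control t K where
  State := M.State ⊕ N.State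
  fin := @instFintypeSum _ _ M.fin N.fin
  start := .inl M.start
  δ := fun
    | .inl a, x, y => (M.δ a x y).mapNext (embedState Sum.inl (some (.inr N.start)))
    | .inr a, x, y => (N.δ a x y).mapNext (embedState Sum.inr none)

/-- Branching on a symbol `f x y` that depends on the scanned symbols. -/
def branch (f : (Fin t → Option Bool) → (Fin K → Option Bool) → Option Bool)
    (M : Option Bool → Control t K) : Control t K where
  State := Option (Σ o, (M o).State)
  fin := letI := fun o => (M o).fin; inferInstance
  start := none
  δ := fun
    | none, x, y => idle (some (some ⟨f x y, (M (f x y)).start⟩)) y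
    | some ⟨o, a⟩, x, y => ((M o).δ a x y).mapNext (embedState (fun a => some ⟨o, a⟩) none)

/-- Repetition as long as the scanned work symbols satisfy `f`. -/
def loop (f : (Fin K → Option Bool) → Bool) (M : Control t K) : Control t K where
  State := Option M.State
  fin := @instFintypeOption _ M.fin
  start := none
  δ := fun
    | none, _, y => idle (if f y then some (some M.start) else none) y
    | some a, x, y => (M.δ a x y).mapNext (embedState some (some none))

variable {M N : Control t K} {m m' m'' : Tapes t K}

theorem Path.embed (f : M.State → N.State) (e : Option N.State)
    (hδ : ∀ q x y, N.δ (f q) x y = (M.δ q x y).mapNext (embedState f e))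
    {x y : Option M.State × Tapes t K} (h : M.Path inp B x y) :
    N.Path inp B (embedState f e x.1, x.2) (embedState f e y.1, y.2) := by
  refine Relation.ReflTransGen.lift
    (fun x : Option M.State × Tapes t K => (embedState f e x.1, x.2)) ?_ _ _ h
  rintro ⟨_ | q, m⟩ ⟨q', m'⟩ ⟨hstep, hbounded⟩
  · simp [step] at hstep
  · simp only [step, Option.some.injEq, Prod.mk.injEq] at hstep
    refine ⟨?_, hbounded⟩
    simp only [embedState, step, hδ, Option.some.injEq, Prod.mk.injEq]
    exact ⟨by rw [← hstep.1]; rfl, by rw [← hstep.2]; rfl⟩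

theorem Path.single {q : M.State} {q' : Option M.State}
    (h : M.step inp (some q, m) = some (q', m')) (hm : m'.Bounded B) :
    M.Path inp B (some q, m) (q', m') :=
  Relation.ReflTransGen.single ⟨h, hm⟩

theorem Executes.seq (h : M.Executes inp B m m') (h' : N.Executes inp B m' m'') :
    (M.seq N).Executes inp B m m'' :=
  Relation.ReflTransGen.trans
    (Path.embed (N := M.seq N) (Sum.inl : _ → M.State ⊕ N.State)
      (some (Sum.inr N.start : M.State ⊕ N.State)) (fun _ _ _ => rfl) h)
    (Path.embed (N := M.seq N) (Sum.inr : _ → M.State ⊕ N.State) none (fun _ _ _ => rfl) h')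

theorem Executes.branch {f : (Fin t → Option Bool) → (Fin K → Option Bool) → Option Bool}
    {M : Option Bool → Control t K} {o : Option Bool}
    (ho : f (fun i => OfflineTM.readInput (inp i) (m.inPos i)) (fun i => m.tape i (m.pos i)) = o)
    (hm : m.Bounded B) (h : (M o).Executes inp B m m') :
    (Control.branch f M).Executes inp B m m' := by
  subst ho
  refine Relation.ReflTransGen.trans (Path.single ?_ hm)
    (Path.embed (N := Control.branch f M) (fun a => (some ⟨_, a⟩ : Option (Σ o, (M o).State))) none
      (fun _ _ _ => rfl) h)
  simp only [step, Control.branch, Tapes.act_idle]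
  rfl

theorem Executes.loop_exit {f : (Fin K → Option Bool) → Bool}
    (hf : f (fun i => m.tape i (m.pos i)) = false) (hm : m.Bounded B) :
    (M.loop f).Executes inp B m m := by
  refine Path.single ?_ hm
  simp only [step, Control.loop, Tapes.act_idle, hf]
  rfl

theorem Executes.loop_step {f : (Fin K → Option Bool) → Bool}
    (hf : f (fun i => m.tape i (m.pos i)) = true) (hm : m.Bounded B)
    (h : M.Executes inp B m m') (h' : (M.loop f).Executes inp B m' m'') :
    (M.loop f).Executes inp B m m'' := by
  refine Relation.ReflTransGen.trans (Path.single ?_ hm)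
    (Relation.ReflTransGen.trans (Path.embed (N := M.loop f)
      (fun a => (some a : Option M.State)) (some (none : Option M.State)) (fun _ _ _ => rfl) h) h')
  simp only [step, Control.loop, Tapes.act_idle, hf]
  rfl

/-- The machine with a given finite control. -/
def toTM (M : Control t K) : OfflineTM t where
  k := K
  State := Option M.State
  fin := @instFintypeOption _ M.fin
  start := some M.start
  δ := fun q x y => q.map fun q => M.δ q x y

/-- A control state and tapes, as a configuration of `M.toTM`. -/
def cfg (M : Control t K) (x : Option M.State × Tapes t K) : M.toTM.Cfg :=
  ⟨x.1, x.2.inPos, x.2.tape, x.2.pos, x.2.out⟩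

theorem step_cfg (M : Control t K) (inp : Fin t → List Bool) (x : Option M.State × Tapes t K) :
    M.toTM.step inp (M.cfg x) = (M.step inp x).map M.cfg := by
  rcases x with ⟨_ | q, m⟩ <;> rfl

theorem Path.reaches_cfg {x y : Option M.State × Tapes t K} (h : M.Path inp B x y) :
    StateTransition.Reaches (M.toTM.step inp) (M.cfg x) (M.cfg y) := by
  refine Relation.ReflTransGen.lift M.cfg (fun x y hxy => ?_) _ _ h
  change M.toTM.step inp (M.cfg x) = some (M.cfg y)
  rw [step_cfg, hxy.1]
  rfl

theorem Path.abs_pos_le {x : Option M.State × Tapes t K} (h : M.Path inp B x (none, m))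
    (hx : x.2.Bounded B) {c : M.toTM.Cfg}
    (hc : StateTransition.Reaches (M.toTM.step inp) (M.cfg x) c) (i : Fin K) :
    |c.pos i| ≤ (B : ℤ) := by
  induction h using Relation.ReflTransGen.head_induction_on with
  | refl =>
    rcases Relation.ReflTransGen.cases_head hc with rfl | ⟨d, hd, -⟩
    · exact hx i
    · rw [step_cfg] at hd
      simp [step] at hd
  | @head x y hxy _ ih =>
    rcases Relation.ReflTransGen.cases_head hc with rfl | ⟨d, hd, hdc⟩
    · exact hx i
    · have hstep : M.toTM.step inp (M.cfg x) = some (M.cfg y) := by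
        rw [step_cfg, hxy.1]
        rfl
      obtain rfl : d = M.cfg y := Option.mem_unique hd hstep
      exact ih hxy.2 hdc

end Control

/-- The tape holding a stack: the top of a stack of height `n` is in cell `n`. -/
def stackTape : List Bool → ℤ → Option Bool
  | [] => fun _ => none
  | b :: l => Function.update (stackTape l) (l.length + 1) (some b)

theorem stackTape_of_lt : ∀ (l : List Bool) (z : ℤ), l.length < z → stackTape l z = none
  | [], _, _ => rfl
  | b :: l, z, h => by
    simp only [List.length_cons, Nat.cast_add, Nat.cast_one] at h
    rw [stackTape, Function.update_of_ne (by omega), stackTape_of_lt l z (by omega)]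

theorem stackTape_length (l : List Bool) : stackTape l l.length = l.head? := by
  cases l <;> simp [stackTape]

theorem update_stackTape_length_none (l : List Bool) :
    Function.update (stackTape l) l.length none = stackTape l.tail := by
  cases l with
  | nil => simp [stackTape]
  | cons b l => simp [stackTape, ← stackTape_of_lt l (l.length + 1) (by omega)]

/-- The symbol scanned on work tape `r`, with a junk value if there is no such tape. -/
def topAt (y : Fin K → Option Bool) (r : ℕ) : Option Bool := if h : r < K then y ⟨r, h⟩ else none

/-- The finite control that executes a program. -/
def Prog.control (K : ℕ) : Prog t → Control t K
  | .skip => ⟨Unit, inferInstance, (), fun _ _ y => idle none y⟩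
  | .push r b => ⟨Bool, inferInstance, false, fun q _ y =>
      if q then { idle none y with write := fun i => if i.val = r then some b else y i }
      else { idle (some true) y with workMove := fun i => if i.val = r then .right else .stay }⟩
  | .pop r => ⟨Unit, inferInstance, (), fun _ _ y =>
      { idle none y with
        write := fun i => if i.val = r then none else y i
        workMove := fun i => if i.val = r ∧ y i ≠ none then .left else .stay }⟩
  | .move j d => ⟨Unit, inferInstance, (), fun _ _ y =>
      ⟨none, fun i => if i = j then d else .stay, y, fun _ => .stay, none⟩⟩
  | .emit b => ⟨Unit, inferInstance, (), fun _ _ y => { idle none y with emit := some b }⟩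
  | .seq p q => (p.control K).seq (q.control K)
  | .branch r p => .branch (fun _ y => topAt y r) fun o => (p o).control K
  | .branchIn j p => .branch (fun x _ => x j) fun o => (p o).control K
  | .loop r c p => .loop (fun y => c (topAt y r)) (p.control K)

/-- The tapes that hold the memory of a stack program. -/
def Store.tapes (K : ℕ) (s : Store t) : Tapes t K where
  inPos := s.head
  tape := fun i => stackTape (s.reg i)
  pos := fun i => (s.reg i).length
  out := s.out

section Execution

variable {s s' : Store t}

theorem Store.Bounded.tapes (h : s.Bounded B) : (s.tapes K).Bounded B := by
  intro i
  simpa only [Store.tapes, Nat.abs_cast, Nat.cast_le] using h i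

theorem topAt_tapes {r : ℕ} (hr : r < K) :
    topAt (fun i => (s.tapes K).tape i ((s.tapes K).pos i)) r = (s.reg r).head? := by
  simp [topAt, hr, Store.tapes, stackTape_length]

theorem Prog.executes_push {r : ℕ} (b : Bool) (hs : s.Bounded B) (hr : (s.reg r).length + 1 ≤ B) :
    ((Prog.push r b).control K).Executes inp B (s.tapes K)
      ((s.set r (b :: s.reg r)).tapes K) := by
  let moved : Tapes t K := { s.tapes K with
    pos := fun i => (s.reg i).length + if i.val = r then 1 else 0 }
  have hmoved : moved.Bounded B := by
    intro i
    have := hs i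
    simp only [moved]
    split_ifs with h
    · rw [h, abs_of_nonneg (by omega)]
      exact_mod_cast hr
    · simpa using this
  have hset : (s.set r (b :: s.reg r)).Bounded B := hs.set (by simpa using hr)
  refine Relation.ReflTransGen.trans
    (Control.Path.single (q' := some true) (m' := moved) ?_ hmoved)
    (Control.Path.single ?_ hset.tapes)
  · simp only [Control.step, Prog.control, Option.some.injEq, Prod.mk.injEq]
    refine ⟨rfl, ?_⟩
    ext i <;> simp [Tapes.act, idle, OfflineTM.moveInput, moved, Store.tapes]
    split_ifs <;> simp [OfflineTM.moveWork]
  · simp only [Control.step, Prog.control, Option.some.injEq, Prod.mk.injEq]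
    refine ⟨rfl, Tapes.ext ?_ (funext fun i => ?_) (funext fun i => ?_) ?_⟩
    · simp [Tapes.act, idle, OfflineTM.moveInput, moved, Store.tapes]
    · by_cases h : i.val = r <;> simp [Tapes.act, moved, Store.tapes, stackTape, h]
    · by_cases h : i.val = r <;> simp [Tapes.act, idle, OfflineTM.moveWork, moved, Store.tapes, h]
    · simp [Tapes.act, idle, moved, Store.tapes]

theorem Prog.executes_pop (r : ℕ) (hs : s.Bounded B) :
    ((Prog.pop r).control K).Executes inp B (s.tapes K)
      ((s.set r (s.reg r).tail).tapes K) := by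
  have hset : (s.set r (s.reg r).tail).Bounded B :=
    hs.set (by have := hs r; rw [List.length_tail]; omega)
  refine Control.Path.single ?_ hset.tapes
  simp only [Control.step, Prog.control, Option.some.injEq, Prod.mk.injEq]
  refine ⟨rfl, Tapes.ext ?_ ?_ ?_ ?_⟩
  · simp [Tapes.act, idle, OfflineTM.moveInput, Store.tapes]
  · ext1 i
    by_cases h : i.val = r
    · simp [Tapes.act, Store.tapes, h, update_stackTape_length_none]
    · simp [Tapes.act, Store.tapes, h]
  · ext1 i
    by_cases h : i.val = r
    · cases hreg : s.reg r <;>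
        simp [Tapes.act, Store.tapes, OfflineTM.moveWork, h, hreg, stackTape]
    · simp [Tapes.act, Store.tapes, OfflineTM.moveWork, h]
  · simp [Tapes.act, idle, Store.tapes]

theorem Prog.executes_move (j : Fin t) (d : Move) (hs : s.Bounded B) :
    ((Prog.move j d).control K).Executes inp B (s.tapes K)
      { s.tapes K with
        inPos := Function.update s.head j (OfflineTM.moveInput (inp j).length d (s.head j)) } := by
  refine Control.Path.single ?_ (Store.Bounded.tapes hs)
  simp only [Control.step, Prog.control, Option.some.injEq, Prod.mk.injEq, true_and]
  refine Tapes.ext (funext fun i => ?_) ?_ ?_ ?_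
  · rcases eq_or_ne i j with rfl | hij
    · simp [Tapes.act, Store.tapes]
    · simp [Tapes.act, Store.tapes, hij, OfflineTM.moveInput]
  all_goals simp [Tapes.act, Store.tapes, OfflineTM.moveWork]

theorem Prog.executes_emit (b : Bool) (hs : s.Bounded B) :
    ((Prog.emit b).control K).Executes inp B (s.tapes K)
      { s.tapes K with out := s.out ++ [b] } := by
  refine Control.Path.single ?_ (Store.Bounded.tapes hs)
  simp only [Control.step, Prog.control, Option.some.injEq, Prod.mk.injEq]
  refine ⟨rfl, ?_⟩
  ext i <;> simp [Tapes.act, idle, Store.tapes, OfflineTM.moveWork, OfflineTM.moveInput]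

theorem Runs.executes {p : Prog t} (h : Runs inp B p s s') (hp : p.RegsLt K) (hs : s.Bounded B) :
    (p.control K).Executes inp B (s.tapes K) (s'.tapes K) := by
  induction h with
  | skip s =>
    exact Control.Path.single (by simp only [Control.step, Prog.control, Tapes.act_idle]; rfl)
      hs.tapes
  | push r b s h => exact Prog.executes_push b hs h
  | pop r s => exact Prog.executes_pop r hs
  | move j d s => exact Prog.executes_move j d hs
  | emit b s => exact Prog.executes_emit b hs
  | seq hrun _ ihp ihq => exact (ihp hp.1 hs).seq (ihq hp.2 (hrun.bounded hs))
  | branch _ ih => exact .branch (topAt_tapes hp.1) hs.tapes (ih (hp.2 _) hs)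
  | branchIn _ ih => exact .branch rfl hs.tapes (ih (hp _) hs)
  | loopDone h => exact .loop_exit (by rw [topAt_tapes hp.1, h]) hs.tapes
  | loopStep h hrun _ ihp ihl =>
    exact .loop_step (by rw [topAt_tapes hp.1, h]) hs.tapes (ihp hp.2 hs)
      (ihl hp (hrun.bounded hs))

end Execution

theorem Store.initial_bounded (B : ℕ) : (initial : Store t).Bounded B := fun _ => Nat.zero_le B

theorem Control.Executes.outputsInSpace {M : Control t K} {m : Tapes t K}
    (h : M.Executes inp B (Store.initial.tapes K) m) : M.toTM.OutputsInSpace inp m.out B :=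
  ⟨⟨M.cfg (none, m), StateTransition.mem_eval.2 ⟨Path.reaches_cfg h, rfl⟩, rfl⟩,
    fun _ hc i => Path.abs_pos_le h (Store.initial_bounded B).tapes hc i⟩

theorem ComputableInSpace.of_runs {ι : Type} {inp : ι → Fin t → List Bool} {out : ι → List Bool}
    {b : ι → ℕ} (p : Prog t) (C : ℕ)
    (h : ∀ i, ∃ s, Runs (inp i) (C * (b i + 1)) p .initial s ∧ s.out = out i) :
    ComputableInSpace inp out b := by
  obtain ⟨K, hK⟩ := p.exists_regsLt
  refine ⟨(p.control K).toTM, C, fun i => ?_⟩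
  obtain ⟨s, hs, ho⟩ := h i
  rw [← ho]
  exact (hs.executes hK (Store.initial_bounded _)).outputsInSpace

end StackMachines

/-! ### Numbers on stacks -/

/-- The successor of a number in bijective base 2, with digits `false = 1` and `true = 2`, least
significant first. Unlike in base 2, all strings are numerals, each of a different number. -/
def numeralSucc : List Bool → List Bool
  | [] => [false]
  | false :: l => true :: l
  | true :: l => false :: numeralSucc l

/-- The predecessor of a number in bijective base 2, with `0` as the predecessor of `0`. -/
def numeralPred : List Bool → List Bool
  | [] => []
  | true :: l => false :: l
  | false :: l => if l = [] then [] else true :: numeralPred l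

/-- The number denoted by a string in bijective base 2. -/
def numeralValue : List Bool → ℕ
  | [] => 0
  | false :: l => 2 * numeralValue l + 1
  | true :: l => 2 * numeralValue l + 2

/-- The numeral of a number in bijective base 2, the format in which programs keep numbers in
their registers. -/
def numeral : ℕ → List Bool
  | 0 => []
  | n + 1 => numeralSucc (numeral n)

theorem numeralSucc_ne_nil (l : List Bool) : numeralSucc l ≠ [] := by
  rcases l with _ | ⟨_ | _, l⟩ <;> simp [numeralSucc]

theorem numeralPred_numeralSucc : ∀ l, numeralPred (numeralSucc l) = l
  | [] => rfl
  | false :: _ => rfl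
  | true :: l => by simp [numeralSucc, numeralPred, numeralSucc_ne_nil, numeralPred_numeralSucc l]

theorem numeralPred_numeral (n : ℕ) : numeralPred (numeral n) = numeral (n - 1) := by
  cases n with
  | zero => rfl
  | succ n => exact numeralPred_numeralSucc _

theorem numeral_eq_nil {n : ℕ} : numeral n = [] ↔ n = 0 := by
  cases n with
  | zero => simp [numeral]
  | succ n => simp [numeral, numeralSucc_ne_nil]

theorem numeralValue_numeralSucc : ∀ l, numeralValue (numeralSucc l) = numeralValue l + 1
  | [] => rfl
  | false :: _ => rfl
  | true :: l => by
    simp only [numeralSucc, numeralValue, numeralValue_numeralSucc l]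
    ring

theorem numeralValue_numeral (n : ℕ) : numeralValue (numeral n) = n := by
  induction n with
  | zero => rfl
  | succ n ih => rw [numeral, numeralValue_numeralSucc, ih]

theorem two_pow_length_le : ∀ l : List Bool, 2 ^ l.length ≤ numeralValue l + 1
  | [] => le_rfl
  | false :: l | true :: l => by
    have := two_pow_length_le l
    simp only [List.length_cons, numeralValue, pow_succ]
    omega

theorem length_numeral_le {n B : ℕ} (h : n ≤ 2 ^ B) : (numeral n).length ≤ B + 1 := by
  have hlt : 2 ^ (numeral n).length < 2 ^ (B + 2) := calc
    2 ^ (numeral n).length ≤ n + 1 := by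
      simpa only [numeralValue_numeral] using two_pow_length_le (numeral n)
    _ < 2 ^ (B + 2) := by
      have := Nat.one_le_two_pow (n := B)
      rw [pow_add]
      omega
  exact Nat.lt_succ_iff.1 ((Nat.pow_lt_pow_iff_right one_lt_two).1 hlt)

theorem exists_replicate_append (b : Bool) (l : List Bool) :
    ∃ n l', l = List.replicate n b ++ l' ∧ (l' = [] ∨ ∃ l'', l' = (!b) :: l'') := by
  induction l with
  | nil => exact ⟨0, [], rfl, .inl rfl⟩
  | cons a l ih =>
    by_cases hab : a = b
    · obtain ⟨n, l', rfl, h⟩ := ih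
      exact ⟨n + 1, l', by rw [hab, List.replicate_succ, List.cons_append], h⟩
    · exact ⟨0, a :: l, rfl, .inr ⟨l, by rw [Bool.eq_not.2 hab]⟩⟩

theorem numeralSucc_replicate_append (n : ℕ) (l : List Bool) :
    numeralSucc (List.replicate n true ++ l) = List.replicate n false ++ numeralSucc l := by
  induction n with
  | zero => rfl
  | succ n ih => simp [List.replicate_succ, numeralSucc, ih]

theorem numeralPred_replicate (n : ℕ) :
    numeralPred (List.replicate n false) = List.replicate (n - 1) true := by
  induction n with
  | zero => rfl
  | succ n ih =>
    cases n with
    | zero => rfl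
    | succ n => simpa [List.replicate_succ, numeralPred] using ih

theorem numeralPred_replicate_append (n : ℕ) (l : List Bool) :
    numeralPred (List.replicate n false ++ true :: l) = List.replicate n true ++ false :: l := by
  induction n with
  | zero => rfl
  | succ n ih => simp [List.replicate_succ, numeralPred, ih]

/-! ### Programs for registers -/

namespace Prog

variable {t : ℕ}

/-- Empty a register. -/
def clear (r : ℕ) : Prog t := .loop r Option.isSome (.pop r)

/-- Push the top of register `a` onto register `b`. -/
def pushTop (a b : ℕ) : Prog t := .branch a fun o => .push b (o.getD false)

/-- Move the contents of register `a` to register `b`, reversing their order. -/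
def pour (a b : ℕ) : Prog t := .loop a Option.isSome (.seq (pushTop a b) (.pop a))

/-- Replace register `b` by register `a` and empty `a`, using the empty register `u`. -/
def transfer (a b u : ℕ) : Prog t := .seq (clear b) (.seq (pour a u) (pour u b))

/-- Move the contents of register `u` to both `a` and `b`, reversing their order. -/
def pour₂ (u a b : ℕ) : Prog t :=
  .loop u Option.isSome (.seq (pushTop u a) (.seq (pushTop u b) (.pop u)))

/-- Replace register `b` by register `a`, using the empty register `u`. -/
def copy (a b u : ℕ) : Prog t := .seq (clear b) (.seq (pour a u) (pour₂ u a b))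

/-- Flip the leading digits `b` of register `r` and move them to register `u`. -/
def carry (b : Bool) (r u : ℕ) : Prog t := .loop r (· == some b) (.seq (.push u !b) (.pop r))

/-- Add one to the number in register `r`, using the empty register `u`. -/
def inc (r u : ℕ) : Prog t :=
  .seq (carry true r u)
    (.seq (.branch r fun o => if o = none then .push r false else .seq (.pop r) (.push r true))
      (pour u r))

/-- Subtract one from the number in register `r`, using the empty register `u`. -/
def dec (r u : ℕ) : Prog t :=
  .seq (carry false r u)
    (.seq (.branch r fun o => if o = none then .pop u else .seq (.pop r) (.push r false))
      (pour u r))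

end Prog

namespace Runs

variable {t B r u a b : ℕ} {inp : Fin t → List Bool} (s : Store t)

theorem clear (r : ℕ) : Runs inp B (.clear r) s (s.set r []) := by
  induction h : s.reg r generalizing s with
  | nil =>
    rw [Store.set_eq_self h]
    exact .loopDone (by simp [h])
  | cons b l ih =>
    refine .loopStep (by simp [h]) (.pop_eq (s' := s.set r l) (by simp [h])) ?_
    exact (ih (s.set r l) (by simp)).cast (Store.set_set s r l [])

theorem pushTop {x : Bool} {l : List Bool} (h : s.reg a = x :: l)
    (hB : (s.reg b).length + 1 ≤ B) :
    Runs inp B (.pushTop a b) s (s.set b (x :: s.reg b)) :=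
  .branch (.push_eq hB (by simp [h]))

theorem pour (hab : a ≠ b) (hB : (s.reg a).length + (s.reg b).length ≤ B) :
    Runs inp B (.pour a b) s ((s.set a []).set b ((s.reg a).reverse ++ s.reg b)) := by
  induction h : s.reg a generalizing s with
  | nil => exact (Runs.loopDone (by simp [h])).cast (by simp [Store.set_eq_self, h])
  | cons x l ih =>
    rw [h, List.length_cons] at hB
    have hstep : Runs inp B (.seq (.pushTop a b) (.pop a)) s
        ((s.set b (x :: s.reg b)).set a l) :=
      .seq (pushTop s h (by omega)) (.pop_eq (by simp [hab, h]))
    refine .loopStep (by simp [h]) hstep ((ih _ ?_ (by simp)).cast ?_)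
    · simp only [Store.set_reg, if_neg hab.symm, if_true, List.length_cons]
      omega
    · simp [hab.symm, Store.set_comm _ hab]

theorem transfer (hab : a ≠ b) (hau : a ≠ u) (hbu : b ≠ u) (hu : s.reg u = [])
    (hB : (s.reg a).length ≤ B) :
    Runs inp B (.transfer a b u) s ((s.set b (s.reg a)).set a []) := by
  refine .seq (clear s b) (.seq (pour _ hau ?_) ((pour _ hbu.symm ?_).cast ?_))
  · simp [hab, hbu.symm, hu, hB]
  · simp [hab, hbu, hbu.symm, hab.symm, hu, hB]
  · refine Store.ext_reg (fun r => ?_) rfl rfl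
    simp only [Store.set_reg, if_neg hab, if_neg hbu.symm, hu, if_neg hbu, if_neg hab.symm]
    split_ifs <;> simp_all

theorem pour₂ (hua : u ≠ a) (hub : u ≠ b) (hab : a ≠ b)
    (hA : (s.reg u).length + (s.reg a).length ≤ B)
    (hB : (s.reg u).length + (s.reg b).length ≤ B) :
    Runs inp B (.pour₂ u a b) s (((s.set u []).set a ((s.reg u).reverse ++ s.reg a)).set b
      ((s.reg u).reverse ++ s.reg b)) := by
  induction h : s.reg u generalizing s with
  | nil => exact (Runs.loopDone (by simp [h])).cast (by simp [Store.set_eq_self, h])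
  | cons x l ih =>
    rw [h, List.length_cons] at hA hB
    have hstep : Runs inp B (.seq (.pushTop u a) (.seq (.pushTop u b) (.pop u))) s
        (((s.set a (x :: s.reg a)).set b (x :: s.reg b)).set u l) := by
      refine .seq (pushTop s h (by omega))
        (.seq (s' := (s.set a (x :: s.reg a)).set b (x :: s.reg b))
          ((pushTop (x := x) (l := l) _ ?_ ?_).cast ?_) (.pop_eq ?_))
      · simp [hua, h]
      · simp only [Store.set_reg, if_neg hab.symm]
        omega
      · simp [hab.symm]
      · simp [hua, hub, h]
    refine .loopStep (by simp [h]) hstep ((ih _ ?_ ?_ (by simp)).cast ?_)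
    · simp only [Store.set_reg, if_neg hua.symm, if_neg hab, if_true, List.length_cons]
      omega
    · simp only [Store.set_reg, if_neg hub.symm, if_true, List.length_cons]
      omega
    · refine Store.ext_reg (fun r => ?_) rfl rfl
      simp only [Store.set_reg, if_neg hua.symm, if_neg hub.symm, if_neg hab]
      split_ifs <;> simp_all

theorem copy (hab : a ≠ b) (hau : a ≠ u) (hbu : b ≠ u) (hu : s.reg u = [])
    (hB : (s.reg a).length ≤ B) : Runs inp B (.copy a b u) s (s.set b (s.reg a)) := by
  refine .seq (clear s b) (.seq (pour _ hau ?_) ((pour₂ _ hau.symm hbu.symm hab ?_ ?_).cast ?_))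
  · simp [hab, hbu.symm, hu, hB]
  · simp [hab, hau, hbu.symm, hu, hB]
  · simp [hab, hbu, hbu.symm, hab.symm, hu, hB]
  · refine Store.ext_reg (fun r => ?_) rfl rfl
    simp only [Store.set_reg, if_neg hab, if_neg hau, if_neg hbu.symm, hu, if_neg hbu,
      if_neg hab.symm]
    split_ifs <;> simp_all

theorem carry {c : Bool} (hru : r ≠ u) {l : List Bool} (hl : l.head? ≠ some c) (n : ℕ) :
    ∀ s : Store t, s.reg r = List.replicate n c ++ l → (s.reg u).length + n ≤ B →
      Runs inp B (.carry c r u) s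
        ((s.set r l).set u (List.replicate n (!c) ++ s.reg u)) := by
  induction n with
  | zero =>
    intro s hr _
    exact (Runs.loopDone (by simp [hr, hl])).cast (by simp [Store.set_eq_self, hr])
  | succ n ih =>
    intro s hr hB
    have hstep : Runs inp B (.seq (.push u !c) (.pop r)) s
        ((s.set u ((!c) :: s.reg u)).set r (List.replicate n c ++ l)) :=
      .seq (.push u _ s (by omega)) (.pop_eq (by simp [hru, hr, List.replicate_succ]))
    refine .loopStep (by simp [hr, List.replicate_succ]) hstep ((ih _ ?_ ?_).cast ?_)
    · simp
    · simp only [Store.set_reg, if_neg hru.symm, if_true, List.length_cons]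
      omega
    · simp [hru.symm, Store.set_comm _ hru, List.replicate_succ']

theorem pour_replicate (hru : r ≠ u) (hu : s.reg u = []) {n : ℕ} {c : Bool} {l : List Bool}
    (hB : n + l.length ≤ B) :
    Runs inp B (.pour u r) ((s.set r l).set u (List.replicate n c))
      (s.set r (List.replicate n c ++ l)) := by
  refine (pour _ hru.symm (by simpa [hru] using hB)).cast ?_
  simp [hru.symm, Store.set_comm _ hru, Store.set_eq_self, hu]

theorem inc (hru : r ≠ u) (hu : s.reg u = []) (hB : (s.reg r).length + 1 ≤ B) :
    Runs inp B (.inc r u) s (s.set r (numeralSucc (s.reg r))) := by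
  obtain ⟨n, l, hr, hl⟩ := exists_replicate_append true (s.reg r)
  rw [hr, List.length_append, List.length_replicate] at hB
  have hcarry : Runs inp B (.carry true r u) s
      ((s.set r l).set u (List.replicate n false)) := by
    have hl' : l.head? ≠ some true := by rcases hl with rfl | ⟨l', rfl⟩ <;> simp
    simpa [hu] using carry hru hl' n s hr (by rw [hu, List.length_nil]; omega)
  rw [hr, numeralSucc_replicate_append]
  rcases hl with rfl | ⟨l', rfl⟩
  · refine .seq hcarry (.seq (.branch ?_) (pour_replicate s hru hu hB))
    simp only [Store.set_reg, if_neg hru, if_true, List.head?_nil]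
    exact .push_eq (by simp [hru]; omega) (by simp [numeralSucc, Store.set_comm _ hru])
  · refine .seq hcarry (.seq (.branch ?_) (pour_replicate s hru hu ((Nat.le_succ _).trans hB)))
    simp only [Store.set_reg, if_neg hru, if_true, List.head?_cons, reduceCtorEq, if_false]
    exact .seq (.pop r _)
      (.push_eq (by simp [hru] at hB ⊢; omega) (by simp [numeralSucc, Store.set_comm _ hru]))

theorem dec (hru : r ≠ u) (hu : s.reg u = []) (hB : (s.reg r).length ≤ B) :
    Runs inp B (.dec r u) s (s.set r (numeralPred (s.reg r))) := by
  obtain ⟨n, l, hr, hl⟩ := exists_replicate_append false (s.reg r)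
  rw [hr, List.length_append, List.length_replicate] at hB
  have hcarry : Runs inp B (.carry false r u) s
      ((s.set r l).set u (List.replicate n true)) := by
    have hl' : l.head? ≠ some false := by rcases hl with rfl | ⟨l', rfl⟩ <;> simp
    simpa [hu] using carry hru hl' n s hr (by rw [hu, List.length_nil]; omega)
  rw [hr]
  rcases hl with rfl | ⟨l', rfl⟩
  · rw [List.append_nil, numeralPred_replicate]
    have hpour := pour_replicate (inp := inp) (B := B) s hru hu (n := n - 1) (c := true) (l := [])
      (by rw [List.length_nil] at hB ⊢; omega)
    refine .seq hcarry (.seq (.branch ?_) (by simpa only [List.append_nil] using hpour))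
    simp only [Store.set_reg, if_neg hru, if_true, List.head?_nil]
    exact .pop_eq (by simp)
  · rw [Bool.not_false, numeralPred_replicate_append]
    refine .seq hcarry (.seq (.branch ?_) (pour_replicate s hru hu hB))
    simp only [Store.set_reg, if_neg hru, if_true, List.head?_cons, reduceCtorEq, if_false]
    exact .seq (.pop r _)
      (.push_eq (by simp [hru] at hB ⊢; omega) (by simp [Store.set_comm _ hru]))

end Runs

/-! ### Functions computable in bounded space -/

section Calculus

variable {t : ℕ} {Γ Γ' Γ'' : Type}

/-- A family of computational situations indexed by `Γ`: the inputs on the tapes, the amount of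
work space (up to a constant factor), and a set of functions whose values are held in registers. -/
structure Ctx (t : ℕ) (Γ : Type) where
  inp : Γ → Fin t → List Bool
  space : Γ → ℕ
  known : Set (Γ → ℕ)

/-- `f` is at most `2 ^ O(space)`, so that its numeral fits into the work space. -/
def Bdd (c : Ctx t Γ) (f : Γ → ℕ) : Prop := ∃ C, ∀ γ, f γ ≤ 2 ^ (C * (c.space γ + 1))

/-- The functions `F · 0, …, F · (τ ·)` are at most `2 ^ O(space)`, uniformly. -/
def BddUpTo (c : Ctx t Γ) (τ : Γ → ℕ) (F : Γ → ℕ → ℕ) : Prop :=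
  ∃ C, ∀ γ, ∀ k ≤ τ γ, F γ k ≤ 2 ^ (C * (c.space γ + 1))

namespace Ctx

/-- The store `s` represents the situation `γ`: the value of each known function `g` is in the
register `a g`, the registers from `N` on are empty, and all input heads are at the start. -/
structure Ready (c : Ctx t Γ) (a : (Γ → ℕ) → ℕ) (N : ℕ) (γ : Γ) (s : Store t) : Prop where
  known_reg : ∀ g ∈ c.known, s.reg (a g) = numeral (g γ)
  empty : ∀ r, N ≤ r → s.reg r = []
  head : s.head = fun _ => 0

/-- The situation `x` of `c'` is the situation `π x` of `c` with possibly more known functions. -/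
structure Extends (c' : Ctx t Γ') (c : Ctx t Γ) (π : Γ' → Γ) : Prop where
  inp : ∀ x, c'.inp x = c.inp (π x)
  space : ∀ x, c'.space x = c.space (π x)
  known : ∀ g ∈ c.known, (fun x => g (π x)) ∈ c'.known

/-- The context obtained by reindexing along `π` and adding the known functions `K`. -/
def pull (c : Ctx t Γ) (π : Γ' → Γ) (K : Set (Γ' → ℕ)) : Ctx t Γ' where
  inp := fun x => c.inp (π x)
  space := fun x => c.space (π x)
  known := (fun g x => g (π x)) '' c.known ∪ K

/-- The context of the situations that satisfy `P`. -/
def restrict (c : Ctx t Γ) (P : Γ → Prop) : Ctx t {γ // P γ} := c.pull (·.1) ∅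

end Ctx

/-- `f` can be computed in space `O(space)`: however the known functions are assigned to registers,
some program writes `f γ` into a given register `o` and leaves the rest of the store unchanged. -/
def Impl (c : Ctx t Γ) (f : Γ → ℕ) : Prop :=
  Bdd c f ∧ ∀ (a : (Γ → ℕ) → ℕ) (N o : ℕ), (∀ g ∈ c.known, a g < N) → o < N →
    ∃ (p : Prog t) (C : ℕ), ∀ γ s, c.Ready a N γ s →
      Runs (c.inp γ) (C * (c.space γ + 1)) p s (s.set o (numeral (f γ)))

/-- The predicate `p` can be decided in space `O(space)`. -/
def ImplPred (c : Ctx t Γ) (p : Γ → Prop) : Prop := ∃ f, Impl c f ∧ ∀ γ, f γ ≠ 0 ↔ p γ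

namespace Ctx

variable {c : Ctx t Γ} {c' : Ctx t Γ'} {c'' : Ctx t Γ''} {π : Γ' → Γ} {π' : Γ'' → Γ'}

theorem Extends.trans (h' : c''.Extends c' π') (h : c'.Extends c π) :
    c''.Extends c fun x => π (π' x) :=
  ⟨fun x => (h'.inp x).trans (h.inp _), fun x => (h'.space x).trans (h.space _),
    fun g hg => h'.known _ (h.known g hg)⟩

theorem pull_extends (c : Ctx t Γ) (π : Γ' → Γ) (K : Set (Γ' → ℕ)) :
    (c.pull π K).Extends c π :=
  ⟨fun _ => rfl, fun _ => rfl, fun g hg => .inl ⟨g, hg, rfl⟩⟩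

theorem restrict_extends (c : Ctx t Γ) (P : Γ → Prop) : (c.restrict P).Extends c (·.1) :=
  c.pull_extends _ _

theorem Ready.mono {a : (Γ → ℕ) → ℕ} {N N' : ℕ} {γ : Γ} {s : Store t} (h : c.Ready a N γ s)
    (hN : N ≤ N') : c.Ready a N' γ s :=
  ⟨h.known_reg, fun r hr => h.empty r (hN.trans hr), h.head⟩

theorem exists_ready_pull {K : Set (Γ' → ℕ)} {a : (Γ → ℕ) → ℕ} {N : ℕ}
    (ha : ∀ g ∈ c.known, a g < N) {S : Γ' → Store t → Prop}
    (hS : ∀ x s, S x s → c.Ready a N (π x) s)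
    (hK : ∀ g ∈ K, ∃ r < N, ∀ x s, S x s → s.reg r = numeral (g x)) :
    ∃ a', (∀ g ∈ (c.pull π K).known, a' g < N) ∧
      ∀ x s, S x s → (c.pull π K).Ready a' N x s := by
  have hreg : ∀ g ∈ (c.pull π K).known, ∃ r < N, ∀ x s, S x s → s.reg r = numeral (g x) := by
    rintro _ (⟨g, hg, rfl⟩ | hg)
    · exact ⟨a g, ha g hg, fun x s hs => (hS x s hs).known_reg g hg⟩
    · exact hK _ hg
  choose! a' ha' hreg using hreg
  exact ⟨a', ha', fun x s hs =>
    ⟨fun g hg => hreg g hg x s hs, (hS x s hs).empty, (hS x s hs).head⟩⟩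

end Ctx

section Bounds

variable {c : Ctx t Γ} {f g : Γ → ℕ}

namespace Bdd

theorem comp (h : Bdd c f) {c' : Ctx t Γ'} {π : Γ' → Γ} (e : c'.Extends c π) :
    Bdd c' fun x => f (π x) := by
  obtain ⟨C, hC⟩ := h
  exact ⟨C, fun x => by rw [e.space]; exact hC _⟩

theorem mono (h : Bdd c f) (hg : ∀ γ, g γ ≤ f γ) : Bdd c g :=
  h.imp fun _ hC γ => (hg γ).trans (hC γ)

theorem upTo (h : Bdd c f) {τ : Γ → ℕ} {F : Γ → ℕ → ℕ} (hF : ∀ γ, ∀ k ≤ τ γ, F γ k ≤ f γ) :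
    BddUpTo c τ F :=
  h.imp fun _ hC γ k hk => (hF γ k hk).trans (hC γ)

theorem const (n : ℕ) : Bdd c fun _ => n :=
  ⟨n, fun _ => n.lt_two_pow_self.le.trans
    (Nat.pow_le_pow_right two_pos (Nat.le_mul_of_pos_right _ (Nat.succ_pos _)))⟩

theorem mul (hf : Bdd c f) (hg : Bdd c g) : Bdd c fun γ => f γ * g γ := by
  obtain ⟨C, hC⟩ := hf
  obtain ⟨D, hD⟩ := hg
  refine ⟨C + D, fun γ => ?_⟩
  rw [add_mul, pow_add]
  exact Nat.mul_le_mul (hC γ) (hD γ)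

protected theorem max (hf : Bdd c f) (hg : Bdd c g) : Bdd c fun γ => max (f γ) (g γ) := by
  obtain ⟨C, hC⟩ := hf
  obtain ⟨D, hD⟩ := hg
  refine ⟨C + D, fun γ => max_le ((hC γ).trans ?_) ((hD γ).trans ?_)⟩ <;>
    exact Nat.pow_le_pow_right two_pos (Nat.mul_le_mul_right _ (by omega))

theorem add (hf : Bdd c f) (hg : Bdd c g) : Bdd c fun γ => f γ + g γ :=
  ((const 2).mul (hf.max hg)).mono fun γ => by omega

theorem ite {P : Γ → Prop} [DecidablePred P] (hf : Bdd (c.restrict P) fun x => f x.1)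
    (hg : Bdd (c.restrict fun γ => ¬ P γ) fun x => g x.1) :
    Bdd c fun γ => if P γ then f γ else g γ := by
  obtain ⟨C, hC⟩ := hf
  obtain ⟨D, hD⟩ := hg
  refine ⟨C + D, fun γ => ?_⟩
  beta_reduce
  split_ifs with h
  · exact (hC ⟨γ, h⟩).trans (Nat.pow_le_pow_right two_pos (Nat.mul_le_mul_right _ (by omega)))
  · exact (hD ⟨γ, h⟩).trans (Nat.pow_le_pow_right two_pos (Nat.mul_le_mul_right _ (by omega)))

theorem length_numeral (h : Bdd c f) :
    ∃ C, ∀ γ, (numeral (f γ)).length + 1 ≤ C * (c.space γ + 1) := by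
  obtain ⟨C, hC⟩ := h
  refine ⟨C + 2, fun γ => ?_⟩
  have := length_numeral_le (hC γ)
  nlinarith

end Bdd

end Bounds

section Blocks

variable {inp : Fin t → List Bool} {B : ℕ} {c : Ctx t Γ} {a : (Γ → ℕ) → ℕ}

namespace Store

/-- Replace the contents of the registers `M, …, M + n - 1`. -/
def setMany (s : Store t) (M n : ℕ) (v : ℕ → List Bool) : Store t :=
  { s with reg := fun r => if M ≤ r ∧ r < M + n then v (r - M) else s.reg r }

variable (s : Store t) (M n : ℕ) (v : ℕ → List Bool)

theorem setMany_reg (r : ℕ) :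
    (s.setMany M n v).reg r = if M ≤ r ∧ r < M + n then v (r - M) else s.reg r := rfl

@[simp] theorem setMany_head : (s.setMany M n v).head = s.head := rfl

@[simp] theorem setMany_zero : s.setMany M 0 v = s :=
  ext_reg (fun r => by rw [setMany_reg, if_neg (by omega)]) rfl rfl

theorem setMany_succ : s.setMany M (n + 1) v = (s.setMany M n v).set (M + n) (v n) :=
  ext_reg (fun r => by simp only [setMany_reg, set_reg]; grind) rfl rfl

variable {s M n v}

theorem setMany_reg_add {j : ℕ} (hj : j < n) : (s.setMany M n v).reg (M + j) = v j := by
  rw [setMany_reg, if_pos (by omega), Nat.add_sub_cancel_left]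

theorem setMany_reg_of_lt {r : ℕ} (h : r < M) : (s.setMany M n v).reg r = s.reg r :=
  if_neg (by omega)

theorem setMany_reg_of_le {r : ℕ} (h : M + n ≤ r) : (s.setMany M n v).reg r = s.reg r :=
  if_neg (by omega)

end Store

theorem Ctx.Ready.setMany {N M n : ℕ} {γ : Γ} {s : Store t} (h : c.Ready a N γ s)
    (ha : ∀ g ∈ c.known, a g < M) (hN : M + n ≤ N) (v : ℕ → List Bool) :
    c.Ready a N γ (s.setMany M n v) where
  known_reg g hg := (Store.setMany_reg_of_lt (ha g hg)).trans (h.known_reg g hg)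
  empty r hr := (Store.setMany_reg_of_le (hN.trans hr)).trans (h.empty r hr)
  head := h.head

namespace Prog

/-- Transfer the registers `L, …, L + n - 1` to `M, …, M + n - 1`, with scratch register `u`. -/
def transferMany (M L u : ℕ) : ℕ → Prog t
  | 0 => .skip
  | n + 1 => .seq (transferMany M L u n) (.transfer (L + n) (M + n) u)

/-- Empty the registers `M, …, M + n - 1`. -/
def clearMany (M : ℕ) : ℕ → Prog t
  | 0 => .skip
  | n + 1 => .seq (clearMany M n) (.clear (M + n))

end Prog

theorem Runs.transferMany (s : Store t) {M L n u : ℕ} (hL : M + n ≤ L) (hu : L + n ≤ u)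
    (hs : s.reg u = []) (hB : ∀ j < n, (s.reg (L + j)).length ≤ B) :
    Runs inp B (.transferMany M L u n) s
      ((s.setMany M n fun j => s.reg (L + j)).setMany L n fun _ => []) := by
  induction n with
  | zero => exact (Runs.skip s).cast (by simp)
  | succ n ih =>
    refine .seq (ih (by omega) (by omega) fun j hj => hB j (by omega))
      ((Runs.transfer _ (by omega) (by omega) (by omega) ?_ ?_).cast ?_)
    · rw [Store.setMany_reg_of_le (by omega), Store.setMany_reg_of_le (by omega), hs]
    · rw [Store.setMany_reg_of_le le_rfl, Store.setMany_reg_of_le (by omega)]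
      exact hB n (by omega)
    · refine Store.ext_reg (fun r => ?_) rfl rfl
      simp only [Store.setMany_reg, Store.set_reg]
      grind

theorem Runs.clearMany (s : Store t) (M n : ℕ) :
    Runs inp B (.clearMany M n) s (s.setMany M n fun _ => []) := by
  induction n with
  | zero => exact (Runs.skip s).cast (by simp)
  | succ n ih => exact .seq ih ((Runs.clear _ _).cast (Store.setMany_succ ..).symm)

theorem exists_tuple_program {F : ℕ → Γ → ℕ} {n : ℕ} (hF : ∀ j < n, Impl c (F j)) {M N : ℕ}
    (ha : ∀ g ∈ c.known, a g < M) (hN : M + n ≤ N) :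
    ∃ (p : Prog t) (C : ℕ), ∀ γ s, c.Ready a N γ s →
      Runs (c.inp γ) (C * (c.space γ + 1)) p s (s.setMany M n fun j => numeral (F j γ)) := by
  induction n with
  | zero => exact ⟨.skip, 0, fun γ s _ => by simpa using Runs.skip s⟩
  | succ n ih =>
    obtain ⟨p, C, hp⟩ := ih (fun j hj => hF j (by omega)) (by omega)
    obtain ⟨q, D, hq⟩ := (hF n (by omega)).2 a N (M + n) (fun g hg => by have := ha g hg; omega)
      (by omega)
    refine ⟨.seq p q, C + D, fun γ s hs => .seq
      ((hp γ s hs).mono (Nat.mul_le_mul_right _ (by omega)))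
      (((hq γ _ (hs.setMany ha (by omega) _)).mono (Nat.mul_le_mul_right _ (by omega))).cast
        (Store.setMany_succ ..).symm)⟩

end Blocks

namespace Impl

variable {c : Ctx t Γ} {f g : Γ → ℕ}

theorem bdd (h : Impl c f) : Bdd c f := h.1

theorem congr (h : Impl c f) (e : ∀ γ, g γ = f γ) : Impl c g := by
  rwa [funext e]

theorem comp (h : Impl c f) {c' : Ctx t Γ'} {π : Γ' → Γ} (e : c'.Extends c π) :
    Impl c' fun x => f (π x) := by
  refine ⟨h.bdd.comp e, fun a N o ha ho => ?_⟩
  obtain ⟨p, C, hp⟩ := h.2 (fun g => a fun x => g (π x)) N o (fun g hg => ha _ (e.known g hg)) ho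
  refine ⟨p, C, fun x s hs => ?_⟩
  rw [e.inp, e.space]
  exact hp (π x) s ⟨fun g hg => hs.known_reg _ (e.known g hg), hs.empty, hs.head⟩

theorem var (hf : f ∈ c.known) (hb : Bdd c f) : Impl c f := by
  refine ⟨hb, fun a N o ha ho => ?_⟩
  obtain ⟨D, hD⟩ := hb.length_numeral
  have haN := ha f hf
  by_cases h : a f = o
  · exact ⟨.skip, 0,
      fun γ s hs => (Runs.skip s).cast (Store.set_eq_self (h ▸ hs.known_reg f hf)).symm⟩
  · refine ⟨.copy (a f) o N, D, fun γ s hs => ?_⟩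
    rw [← hs.known_reg f hf]
    refine Runs.copy s h haN.ne ho.ne (hs.empty N le_rfl) ?_
    rw [hs.known_reg f hf]
    exact Nat.le_of_succ_le (hD γ)

theorem zero : Impl c fun _ => 0 :=
  ⟨.const 0, fun _ _ o _ _ => ⟨.clear o, 0, fun _ s _ => Runs.clear s o⟩⟩

theorem succ (h : Impl c f) : Impl c fun γ => f γ + 1 := by
  refine ⟨h.bdd.add (.const 1), fun a N o ha ho => ?_⟩
  obtain ⟨p, C, hp⟩ := h.2 a N o ha ho
  obtain ⟨D, hD⟩ := h.bdd.length_numeral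
  refine ⟨.seq p (.inc o N), C + D, fun γ s hs => ?_⟩
  refine .seq ((hp γ s hs).mono (Nat.mul_le_mul_right _ (by omega)))
    ((Runs.inc _ ho.ne ?_ ?_).cast ?_)
  · rw [Store.set_reg, if_neg ho.ne', hs.empty N le_rfl]
  · simpa using (hD γ).trans (Nat.mul_le_mul_right _ (by omega))
  · simp [numeral]

theorem pred (h : Impl c f) : Impl c fun γ => f γ - 1 := by
  refine ⟨h.bdd.mono fun _ => Nat.sub_le _ _, fun a N o ha ho => ?_⟩
  obtain ⟨p, C, hp⟩ := h.2 a N o ha ho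
  obtain ⟨D, hD⟩ := h.bdd.length_numeral
  refine ⟨.seq p (.dec o N), C + D, fun γ s hs => ?_⟩
  refine .seq ((hp γ s hs).mono (Nat.mul_le_mul_right _ (by omega)))
    ((Runs.dec _ ho.ne ?_ ?_).cast ?_)
  · rw [Store.set_reg, if_neg ho.ne', hs.empty N le_rfl]
  · simpa using (Nat.le_of_succ_le (hD γ)).trans (Nat.mul_le_mul_right _ (by omega))
  · simp [numeralPred_numeral]

theorem const (n : ℕ) : Impl c fun _ => n := by
  induction n with
  | zero => exact .zero
  | succ n ih => exact ih.succ

section Conditionals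

variable {P : Γ → Prop}

theorem exists_program_restrict (hf : Impl (c.restrict P) fun x => f x.1) {a : (Γ → ℕ) → ℕ}
    {N o : ℕ} (ha : ∀ g ∈ c.known, a g < N) (ho : o < N) :
    ∃ (p : Prog t) (C : ℕ), ∀ γ s, P γ → c.Ready a N γ s →
      Runs (c.inp γ) (C * (c.space γ + 1)) p s (s.set o (numeral (f γ))) := by
  obtain ⟨a', ha', hready⟩ := c.exists_ready_pull (π := fun x : {γ // P γ} => x.1) (K := ∅) ha
    (fun _ _ => id) (by simp)
  obtain ⟨p, C, hp⟩ := hf.2 a' N o ha' ho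
  exact ⟨p, C, fun γ s hγ hs => hp ⟨γ, hγ⟩ s (hready ⟨γ, hγ⟩ s hs)⟩

theorem ite_of_restrict [DecidablePred P] (hP : ImplPred c P)
    (hf : Impl (c.restrict P) fun x => f x.1)
    (hg : Impl (c.restrict fun γ => ¬ P γ) fun x => g x.1) :
    Impl c fun γ => if P γ then f γ else g γ := by
  obtain ⟨φ, hφ, hφP⟩ := hP
  refine ⟨Bdd.ite hf.bdd hg.bdd, fun a N o ha ho => ?_⟩
  obtain ⟨p, C, hp⟩ := hφ.2 a (N + 1) N (fun g hg => (ha g hg).trans N.lt_succ_self)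
    N.lt_succ_self
  obtain ⟨p₁, C₁, hp₁⟩ := exists_program_restrict hf ha ho
  obtain ⟨p₂, C₂, hp₂⟩ := exists_program_restrict hg ha ho
  refine ⟨.seq p (.branch N fun b => if b = none then p₂ else .seq (.clear N) p₁), C + C₁ + C₂,
    fun γ s hs => .seq ((hp γ s (hs.mono (by omega))).mono (Nat.mul_le_mul_right _ (by omega)))
      (.branch ?_)⟩
  have hN := hs.empty N le_rfl
  by_cases h : P γ
  · have hφ : φ γ ≠ 0 := (hφP γ).2 h
    simp only [Store.set_reg, if_true, List.head?_eq_none_iff, numeral_eq_nil, hφ, if_false, h]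
    exact .seq ((Runs.clear _ N).cast (by simp [Store.set_eq_self hN]))
      ((hp₁ γ s h hs).mono (Nat.mul_le_mul_right _ (by omega)))
  · have hφ : φ γ = 0 := not_not.1 fun h' => h ((hφP γ).1 h')
    simp only [hφ, numeral, Store.set_eq_self hN, hN, List.head?_nil, if_true, h, if_false]
    exact (hp₂ γ s h hs).mono (Nat.mul_le_mul_right _ (by omega))

theorem ite [DecidablePred P] (hP : ImplPred c P) (hf : Impl c f) (hg : Impl c g) :
    Impl c fun γ => if P γ then f γ else g γ :=
  ite_of_restrict hP (hf.comp (c.restrict_extends _)) (hg.comp (c.restrict_extends _))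

end Conditionals

end Impl

section Loops

variable {inp : Fin t → List Bool} {B n : ℕ}

/-- Repeat the program `p` on the `n` registers from `N` on, until register `N` is empty; `p` is to
leave the new contents in the following `n` registers. -/
def Prog.iterate (N n : ℕ) (p : Prog t) : Prog t :=
  .loop N Option.isSome (.seq p (.transferMany N (N + n) (N + n + n) n))

theorem isSome_head?_numeral {k : ℕ} : (numeral k).head?.isSome = true ↔ k ≠ 0 := by
  simp [numeral_eq_nil]

theorem Runs.iterate {s : Store t} {N : ℕ} {p : Prog t} (hs : ∀ r, N + n ≤ r → s.reg r = [])
    (hn : 0 < n) {v : ℕ → ℕ → ℕ} {τ : ℕ}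
    (hp : ∀ k < τ, Runs inp B p (s.setMany N n fun j => numeral (v j k))
      ((s.setMany N n fun j => numeral (v j k)).setMany (N + n) n fun j => numeral (v j (k + 1))))
    (hB : ∀ j < n, ∀ k ≤ τ, (numeral (v j k)).length ≤ B)
    (hlt : ∀ k < τ, v 0 k ≠ 0) (hτ : v 0 τ = 0) {k : ℕ} (hk : k ≤ τ) :
    Runs inp B (.iterate N n p) (s.setMany N n fun j => numeral (v j k))
      (s.setMany N n fun j => numeral (v j τ)) := by
  have hhead (k : ℕ) : (s.setMany N n fun j => numeral (v j k)).reg N = numeral (v 0 k) :=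
    Store.setMany_reg_add (j := 0) hn
  induction hk using Nat.decreasingInduction with
  | self => exact .loopDone (by rw [hhead, hτ]; rfl)
  | of_succ k hk ih =>
    refine .loopStep (by rw [hhead]; exact isSome_head?_numeral.2 (hlt k hk))
      (.seq (hp k hk) ((Runs.transferMany _ le_rfl le_rfl ?_ fun j hj => ?_).cast ?_)) ih
    · rw [Store.setMany_reg_of_le le_rfl, Store.setMany_reg_of_le (by omega), hs _ (by omega)]
    · rw [Store.setMany_reg_add hj]
      exact hB j hj _ hk
    · refine Store.ext_reg (fun r => ?_) rfl rfl
      simp only [Store.setMany_reg]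
      grind

theorem exists_uniform_bound {P : ℕ → ℕ → Prop} (hP : ∀ j, Monotone (P j))
    (h : ∀ j < n, ∃ C, P j C) : ∃ C, ∀ j < n, P j C := by
  choose! C hC using h
  exact ⟨(Finset.range n).sup C,
    fun j hj => hP j (Finset.le_sup (Finset.mem_range.2 hj)) (hC j hj)⟩

variable {c : Ctx t Γ} {F : ℕ → Γ → ℕ → ℕ} {τ : Γ → ℕ}

theorem exists_length_numeral_le (hB : ∀ j < n, BddUpTo c τ (F j)) :
    ∃ D, ∀ j < n, ∀ γ, ∀ k ≤ τ γ, (numeral (F j γ k)).length ≤ D * (c.space γ + 1) := by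
  refine exists_uniform_bound (fun j C D hCD h γ k hk =>
    (h γ k hk).trans (Nat.mul_le_mul_right _ hCD)) fun j hj => ?_
  obtain ⟨C, hC⟩ := hB j hj
  refine ⟨C + 1, fun γ k hk => (length_numeral_le (hC γ k hk)).trans ?_⟩
  nlinarith

theorem exists_loop_body
    (hstep : ∀ ⦃Γ' : Type⦄ (c' : Ctx t Γ') (π : Γ' → Γ) (k : Γ' → ℕ), c'.Extends c π →
      (∀ x, k x < τ (π x)) → (∀ j < n, Impl c' fun x => F j (π x) (k x)) →
      ∀ j < n, Impl c' fun x => F j (π x) (k x + 1))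
    (hB : ∀ j < n, BddUpTo c τ (F j)) {a : (Γ → ℕ) → ℕ} {N : ℕ} (ha : ∀ g ∈ c.known, a g < N) :
    ∃ (p : Prog t) (C : ℕ), ∀ γ s, c.Ready a N γ s → ∀ k < τ γ,
      Runs (c.inp γ) (C * (c.space γ + 1)) p (s.setMany N n fun j => numeral (F j γ k))
        ((s.setMany N n fun j => numeral (F j γ k)).setMany (N + n) n
          fun j => numeral (F j γ (k + 1))) := by
  let π : {x : Γ × ℕ // x.2 < τ x.1} → Γ := fun x => x.1.1
  let ν : ℕ → {x : Γ × ℕ // x.2 < τ x.1} → ℕ := fun j x => F j x.1.1 x.1.2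
  obtain ⟨a', ha', hready⟩ := c.exists_ready_pull (π := π) (K := {g | ∃ j < n, ν j = g}) (a := a)
    (N := N + n) (fun g hg => (ha g hg).trans_le (by omega))
    (S := fun x s => ∃ s₀, c.Ready a N x.1.1 s₀ ∧ s = s₀.setMany N n fun j => numeral (ν j x))
    (by rintro x _ ⟨s, hs, rfl⟩; exact (hs.mono (by omega)).setMany ha le_rfl _)
    (by
      rintro _ ⟨j, hj, rfl⟩
      exact ⟨N + j, by omega, by rintro x _ ⟨s, _, rfl⟩; exact Store.setMany_reg_add hj⟩)
  have hvar : ∀ j < n, Impl (c.pull π {g | ∃ j < n, ν j = g}) (ν j) := fun j hj =>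
    .var (.inr ⟨j, hj, rfl⟩) ((hB j hj).imp fun C hC x => hC _ _ x.2.le)
  obtain ⟨p, C, hp⟩ := exists_tuple_program
    (hstep _ π (fun x => x.1.2) (c.pull_extends _ _) (fun x => x.2) hvar) ha' le_rfl
  exact ⟨p, C, fun γ s hγ k hk =>
    hp ⟨(γ, k), hk⟩ _ ((hready ⟨(γ, k), hk⟩ _ ⟨s, hγ, rfl⟩).mono (by omega))⟩

theorem Impl.while (hn : 0 < n) (h0 : ∀ j < n, Impl c fun γ => F j γ 0)
    (hstep : ∀ ⦃Γ' : Type⦄ (c' : Ctx t Γ') (π : Γ' → Γ) (k : Γ' → ℕ), c'.Extends c π →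
      (∀ x, k x < τ (π x)) → (∀ j < n, Impl c' fun x => F j (π x) (k x)) →
      ∀ j < n, Impl c' fun x => F j (π x) (k x + 1))
    (hB : ∀ j < n, BddUpTo c τ (F j)) (hlt : ∀ γ, ∀ k < τ γ, F 0 γ k ≠ 0)
    (hτ : ∀ γ, F 0 γ (τ γ) = 0) :
    ∀ j < n, Impl c fun γ => F j γ (τ γ) := by
  intro j hj
  refine ⟨(hB j hj).imp fun C hC γ => hC γ _ le_rfl, fun a N o ha ho => ?_⟩
  obtain ⟨p₀, C₀, hp₀⟩ := exists_tuple_program h0 ha (N := N + n) le_rfl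
  obtain ⟨p₁, C₁, hp₁⟩ := exists_loop_body hstep hB ha
  obtain ⟨D, hD⟩ := exists_length_numeral_le hB
  refine ⟨.seq p₀ (.seq (.iterate N n p₁) (.seq (.transfer (N + j) o (N + n)) (.clearMany N n))),
    C₀ + C₁ + D, fun γ s hs => ?_⟩
  have hlen : ∀ j < n, ∀ k ≤ τ γ,
      (numeral (F j γ k)).length ≤ (C₀ + C₁ + D) * (c.space γ + 1) := fun j hj k hk =>
    (hD j hj γ k hk).trans (Nat.mul_le_mul_right _ (by omega))
  have hloop := Runs.iterate (fun r hr => hs.empty r (by omega)) hn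
    (fun k hk => (hp₁ γ s hs k hk).mono (Nat.mul_le_mul_right _ (by omega))) hlen (hlt γ) (hτ γ)
    (Nat.zero_le _)
  refine .seq ((hp₀ γ s (hs.mono (by omega))).mono (Nat.mul_le_mul_right _ (by omega)))
    (.seq hloop (.seq (Runs.transfer _ (by omega) (by omega) (by omega) ?_ ?_)
      ((Runs.clearMany _ _ _).cast (Store.ext_reg (fun r => ?_) rfl rfl))))
  · rw [Store.setMany_reg_of_le le_rfl, hs.empty _ (by omega)]
  · rw [Store.setMany_reg_add hj]
    exact hlen j hj _ le_rfl
  · have hempty := hs.empty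
    simp only [Store.setMany_reg, Store.set_reg]
    grind

end Loops

section InputOutput

/-- The number of a tape symbol: the ternary digit that stands for it in the encodings below. -/
def symbolCode : Option Bool → ℕ
  | none => 0
  | some false => 1
  | some true => 2

theorem symbolCode_le_two (x : Option Bool) : symbolCode x ≤ 2 := by
  rcases x with _ | _ | _ <;> simp [symbolCode]

theorem symbolCode_readInput_ne_zero {l : List Bool} {k : ℕ} :
    symbolCode (OfflineTM.readInput l (k + 1)) ≠ 0 ↔ k < l.length := by
  simp only [OfflineTM.readInput]
  by_cases h : k < l.length
  · rw [List.getElem?_eq_getElem h]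
    cases l[k] <;> simp [symbolCode, h]
  · rw [List.getElem?_eq_none (by omega)]
    simp [symbolCode, h]

namespace Prog

/-- Write the numeral of `symbolCode x` into the empty register `o`, with scratch register `u`. -/
def writeSymbol (o u : ℕ) : Option Bool → Prog t
  | none => .skip
  | some false => .inc o u
  | some true => .seq (.inc o u) (.inc o u)

/-- Move an input head as often as the number in register `r` says, and empty that register. -/
def moveBy (j : Fin t) (d : Move) (r u : ℕ) : Prog t :=
  .loop r Option.isSome (.seq (.dec r u) (.move j d))

/-- Write the code of the symbol in a cell of tape `j` into register `o`; the registers `N` and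
`N + 1` both hold the position of the cell, for the way there and for the way back. -/
def readAt (j : Fin t) (N o : ℕ) : Prog t :=
  .seq (.moveBy j .right N (N + 2)) (.seq (.clear o)
    (.seq (.branchIn j fun x => .writeSymbol o (N + 2) x) (.moveBy j .left (N + 1) (N + 2))))

/-- Output the bits computed into register `2` by the rounds of `q`, counting the rounds up in
register `1` and down in register `0`. -/
def emitBits (q : Prog t) : Prog t :=
  .loop 0 Option.isSome (.seq q (.seq (.branch 2 fun b => .emit b.isSome)
    (.seq (.clear 2) (.seq (.inc 1 3) (.dec 0 3)))))

end Prog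

variable {inp : Fin t → List Bool} {B : ℕ}

theorem Runs.writeSymbol (s : Store t) {o u : ℕ} (hou : o ≠ u) (hB : 2 ≤ B) (x : Option Bool)
    (ho : s.reg o = []) (hu : s.reg u = []) :
    Runs inp B (.writeSymbol o u x) s (s.set o (numeral (symbolCode x))) := by
  rcases x with _ | _ | _
  · exact (Runs.skip s).cast (Store.set_eq_self ho).symm
  · exact (Runs.inc s hou hu (by simp [ho]; omega)).cast (by rw [ho]; rfl)
  · refine .seq (Runs.inc s hou hu (by simp [ho]; omega))
      ((Runs.inc _ hou (by simp [hou.symm, hu]) (by simp [ho, numeralSucc]; omega)).cast ?_)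
    simp [ho, numeral, symbolCode]

theorem Runs.moveBy (s : Store t) {r u n : ℕ} (hru : r ≠ u) (j : Fin t) (d : Move)
    (hr : s.reg r = numeral n) (hu : s.reg u = []) (hB : ∀ k ≤ n, (numeral k).length ≤ B) :
    Runs inp B (.moveBy j d r u) s { s.set r [] with
      head := Function.update s.head j
        ((OfflineTM.moveInput (inp j).length d)^[n] (s.head j)) } := by
  induction n generalizing s with
  | zero =>
    refine (Runs.loopDone (by rw [hr]; rfl)).cast ?_
    simp [Store.set_eq_self (l := []) hr]
  | succ n ih =>
    refine .loopStep (by rw [hr]; exact isSome_head?_numeral.2 n.succ_ne_zero)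
      (.seq (Runs.dec s hru hu (by rw [hr]; exact hB _ le_rfl)) (.move j d _))
      ((ih _ ?_ ?_ fun k hk => hB k (by omega)).cast ?_)
    · simp [hr, numeralPred_numeral]
    · simp [hru.symm, hu]
    · refine Store.ext_reg (fun r' => ?_) (by simp) rfl
      simp only [Store.set, Function.update_apply]
      split_ifs <;> rfl

theorem iterate_moveInput_right (n k : ℕ) :
    (OfflineTM.moveInput n .right)^[k] 0 = min k (n + 1) := by
  induction k with
  | zero => simp
  | succ k ih => rw [Function.iterate_succ_apply', ih]; simp only [OfflineTM.moveInput]; omega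

theorem iterate_moveInput_left (n k p : ℕ) : (OfflineTM.moveInput n .left)^[k] p = p - k := by
  induction k with
  | zero => simp
  | succ k ih => rw [Function.iterate_succ_apply', ih]; simp only [OfflineTM.moveInput]; omega

theorem readInput_min (l : List Bool) (k : ℕ) :
    OfflineTM.readInput l (min k (l.length + 1)) = OfflineTM.readInput l k := by
  rcases le_total k (l.length + 1) with h | h
  · rw [min_eq_left h]
  · obtain ⟨k, rfl⟩ : ∃ k', k = k' + 1 := ⟨k - 1, by omega⟩
    simp only [min_eq_right h, OfflineTM.readInput]
    rw [List.getElem?_eq_none le_rfl, List.getElem?_eq_none (by omega)]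

theorem Runs.readAt (s : Store t) {N o n : ℕ} (j : Fin t) (ho : o < N)
    (hs : ∀ r, N ≤ r → s.reg r = []) (hhead : s.head = fun _ => 0) (hB2 : 2 ≤ B)
    (hB : ∀ k ≤ n, (numeral k).length ≤ B) :
    Runs inp B (.readAt j N o) (s.setMany N 2 fun _ => numeral n)
      (s.set o (numeral (symbolCode (OfflineTM.readInput (inp j) n)))) := by
  refine .seq (Runs.moveBy (n := n) _ (by omega) j .right ?_ ?_ hB)
    (.seq (Runs.clear _ o) (.seq (.branchIn (Runs.writeSymbol _ (by omega) hB2 _ ?_ ?_))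
      ((Runs.moveBy (n := n) _ (by omega) j .left ?_ ?_ hB).cast (Store.ext_reg ?_ ?_ rfl))))
  · exact Store.setMany_reg_add (j := 0) two_pos
  · simp [Store.setMany_reg_of_le, hs]
  · simp
  · simp only [Store.set_reg, Store.setMany_reg]; grind
  · simp only [Store.set_reg, Store.setMany_reg]; grind
  · simp only [Store.set_reg, Store.setMany_reg]; grind
  · intro r
    simp only [Store.setMany, Store.set, Function.update_apply, if_true, hhead,
      iterate_moveInput_right, readInput_min]
    grind
  · funext i
    simp only [Store.set_head, Store.setMany_head, Function.update_apply, if_true, hhead,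
      iterate_moveInput_right, iterate_moveInput_left]
    grind

theorem Impl.read {c : Ctx t Γ} {f : Γ → ℕ} (j : Fin t) (h : Impl c f) :
    Impl c fun γ => symbolCode (OfflineTM.readInput (c.inp γ j) (f γ)) := by
  refine ⟨(Bdd.const 2).mono fun γ => symbolCode_le_two _, fun a N o ha ho => ?_⟩
  obtain ⟨p, C, hp⟩ := exists_tuple_program (F := fun _ => f) (n := 2) (fun _ _ => h) ha
    (N := N + 2) le_rfl
  obtain ⟨D, hD⟩ := h.bdd
  refine ⟨.seq p (.readAt j N o), C + D + 2, fun γ s hs => ?_⟩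
  refine .seq ((hp γ s (hs.mono (by omega))).mono (Nat.mul_le_mul_right _ (by omega)))
    (Runs.readAt s j ho hs.empty hs.head (by nlinarith) fun k hk => ?_)
  have := length_numeral_le (hk.trans (hD γ))
  nlinarith

/-- The store after `k` rounds of the program that outputs the `len` bits `bit 0 ≠ 0, …`. -/
def Store.emitting (t : ℕ) (bit : ℕ → ℕ) (len k : ℕ) : Store t where
  reg := fun r => if r = 0 then numeral (len - k) else if r = 1 then numeral k else []
  head := fun _ => 0
  out := (List.range k).map fun i => decide (bit i ≠ 0)

theorem Runs.emitBits {q : Prog t} {bit : ℕ → ℕ} {len : ℕ}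
    (hq : ∀ k < len, Runs inp B q (.emitting t bit len k)
      ((Store.emitting t bit len k).set 2 (numeral (bit k))))
    (hB : ∀ k ≤ len, (numeral k).length + 1 ≤ B) {k : ℕ} (hk : k ≤ len) :
    Runs inp B (.emitBits q) (.emitting t bit len k) (.emitting t bit len len) := by
  induction hk using Nat.decreasingInduction with
  | self => exact .loopDone (by simp [Store.emitting, numeral])
  | of_succ k hk ih =>
    refine .loopStep (s' := .emitting t bit len (k + 1))
      (isSome_head?_numeral.2 (Nat.sub_ne_zero_of_lt hk))
      (.seq (hq k hk) (.seq (.branch (.emit _ _)) (.seq (Runs.clear _ 2)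
        (.seq (Runs.inc _ (by omega) ?_ ?_)
          ((Runs.dec _ (by omega) ?_ ?_).cast (Store.ext_reg (fun r => ?_) rfl ?_)))))) ih
    · simp [Store.emitting]
    · simpa [Store.emitting] using hB k hk.le
    · simp [Store.emitting]
    · simpa [Store.emitting] using Nat.le_of_succ_le (hB (len - k) (Nat.sub_le _ _))
    · simp only [Store.emitting, Store.set_reg, numeral]
      grind [numeralPred_numeral, numeral]
    · have hsome : (numeral (bit k)).head?.isSome = decide (bit k ≠ 0) :=
        Bool.eq_iff_iff.2 (by rw [isSome_head?_numeral, decide_eq_true_iff])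
      simp [Store.emitting, List.range_succ, hsome]

theorem Impl.computable {ι : Type} {inp : ι → Fin t → List Bool} {b : ι → ℕ}
    {out : ι → List Bool} {len : ι → ℕ} {bit : ι → ℕ → ℕ} (hlen : Impl ⟨inp, b, ∅⟩ len)
    (hbit : ∀ ⦃Γ' : Type⦄ (c' : Ctx t Γ') (π : Γ' → ι) (k : Γ' → ℕ), c'.Extends ⟨inp, b, ∅⟩ π →
      Impl c' k → (∀ x, k x < len (π x)) → Impl c' fun x => bit (π x) (k x))
    (hout : ∀ i, out i = (List.range (len i)).map fun k => decide (bit i k ≠ 0)) :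
    ComputableInSpace inp out b := by
  let c₁ : Ctx t {x : ι × ℕ // x.2 < len x.1} :=
    ⟨fun x => inp x.1.1, fun x => b x.1.1, {fun x => x.1.2}⟩
  obtain ⟨D, hD⟩ := hlen.bdd
  have hround : Impl c₁ fun x => x.1.2 := .var rfl ⟨D, fun x => x.2.le.trans (hD x.1.1)⟩
  have hbit₁ := hbit c₁ (fun x => x.1.1) _ ⟨fun _ => rfl, fun _ => rfl, by simp⟩ hround
    fun x => x.2
  obtain ⟨p, C, hp⟩ := hlen.2 (fun _ => 0) 1 0 (by simp) (by simp)
  obtain ⟨q, C', hq⟩ := hbit₁.2 (fun _ => 1) 3 2 (by simp) (by simp)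
  refine .of_runs (.seq p (.emitBits q)) (C + C' + D + 2) fun i =>
    ⟨.emitting t (bit i) (len i) (len i), .seq (s' := .emitting t (bit i) (len i) 0) ?_
      (Runs.emitBits (fun k hk => ?_) (fun k hk => ?_) (Nat.zero_le _)), (hout i).symm⟩
  · refine ((hp i .initial ⟨by simp, fun _ _ => rfl, rfl⟩).mono
      (Nat.mul_le_mul_right _ (by omega))).cast (Store.ext_reg (fun r => ?_) rfl rfl)
    simp only [Store.emitting, Store.set_reg, Store.initial, numeral, Nat.sub_zero]
    split_ifs <;> rfl
  · refine (hq ⟨(i, k), hk⟩ _ ⟨?_, fun r hr => ?_, rfl⟩).mono (Nat.mul_le_mul_right _ (by omega))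
    · rintro g rfl
      simp [Store.emitting]
    · simp only [Store.emitting]
      grind
  · have := length_numeral_le (hk.trans (hD i))
    dsimp only at this
    nlinarith

end InputOutput

end Calculus

section Operations

variable {t : ℕ} {Γ : Type} {c : Ctx t Γ} {f g h : Γ → ℕ} {p q : Γ → Prop}

/-- `F γ k` can be computed from `γ` and `k` in space `O(space)`, for those `k` with `P γ k`: it
can be computed in every extension of `c` in which such a `k` can. -/
def ImplFam (c : Ctx t Γ) (P : Γ → ℕ → Prop) (F : Γ → ℕ → ℕ) : Prop :=
  ∀ ⦃Γ' : Type⦄ (c' : Ctx t Γ') (π : Γ' → Γ) (k : Γ' → ℕ), c'.Extends c π → Impl c' k →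
    (∀ x, P (π x) (k x)) → Impl c' fun x => F (π x) (k x)

section Recursion

variable {τ : Γ → ℕ}

theorem Impl.for {F : ℕ → Γ → ℕ → ℕ} {n : ℕ} (hτ : Impl c τ)
    (h0 : ∀ j < n, Impl c fun γ => F j γ 0)
    (hstep : ∀ ⦃Γ' : Type⦄ (c' : Ctx t Γ') (π : Γ' → Γ) (k : Γ' → ℕ), c'.Extends c π →
      Impl c' k → (∀ x, k x < τ (π x)) → (∀ j < n, Impl c' fun x => F j (π x) (k x)) →
      ∀ j < n, Impl c' fun x => F j (π x) (k x + 1))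
    (hB : ∀ j < n, BddUpTo c τ (F j)) :
    ∀ j < n, Impl c fun γ => F j γ (τ γ) := by
  let G : ℕ → Γ → ℕ → ℕ
    | 0, γ, k => τ γ - k
    | 1, _, k => k
    | j + 2, γ, k => F j γ k
  suffices H : ∀ j < n + 2, Impl c fun γ => G j γ (τ γ) from fun j hj => H (j + 2) (by omega)
  refine Impl.while (by omega) ?_ ?_ ?_ (fun γ k => Nat.sub_ne_zero_of_lt) fun γ => Nat.sub_self _
  · rintro (_ | _ | j) hj
    · exact hτ
    · exact .zero
    · exact h0 j (by omega)
  · intro Γ' c' π k e hk hG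
    rintro (_ | _ | j) hj
    · exact (hG 0 (by omega)).pred
    · exact (hG 1 (by omega)).succ
    · exact hstep c' π k e (hG 1 (by omega)) hk (fun j hj => hG (j + 2) (by omega)) j (by omega)
  · rintro (_ | _ | j) hj
    · exact hτ.bdd.upTo fun _ _ _ => Nat.sub_le _ _
    · exact hτ.bdd.upTo fun _ _ => id
    · exact hB j (by omega)

theorem Impl.rec {F : Γ → ℕ → ℕ} (hτ : Impl c τ) (h0 : Impl c fun γ => F γ 0)
    (hstep : ∀ ⦃Γ' : Type⦄ (c' : Ctx t Γ') (π : Γ' → Γ) (k : Γ' → ℕ), c'.Extends c π →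
      Impl c' k → (∀ x, k x < τ (π x)) → (Impl c' fun x => F (π x) (k x)) →
      Impl c' fun x => F (π x) (k x + 1))
    (hB : BddUpTo c τ F) :
    Impl c fun γ => F γ (τ γ) :=
  Impl.for (F := fun _ => F) (n := 1) hτ (fun _ _ => h0)
    (fun _ c' π k e hk hl hF _ _ => hstep c' π k e hk hl (hF 0 one_pos)) (fun _ _ => hB) 0 one_pos

end Recursion

section Arithmetic

theorem Impl.add (hf : Impl c f) (hg : Impl c g) : Impl c fun γ => f γ + g γ :=
  .rec (F := fun γ k => f γ + k) hg hf (fun _ _ _ _ _ _ _ h => h.succ)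
    ((hf.bdd.add hg.bdd).upTo fun _ _ hk => Nat.add_le_add_left hk _)

theorem Impl.sub (hf : Impl c f) (hg : Impl c g) : Impl c fun γ => f γ - g γ :=
  .rec (F := fun γ k => f γ - k) hg hf (fun _ _ _ _ _ _ _ h => h.pred)
    (hf.bdd.upTo fun _ _ _ => Nat.sub_le _ _)

theorem Impl.mul (hf : Impl c f) (hg : Impl c g) : Impl c fun γ => f γ * g γ :=
  .rec (F := fun γ k => f γ * k) hg .zero (fun _ _ _ _ e _ _ h => h.add (hf.comp e))
    ((hf.bdd.mul hg.bdd).upTo fun _ _ hk => Nat.mul_le_mul_left _ hk)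

theorem ImplPred.congr (hp : ImplPred c p) (h : ∀ γ, q γ ↔ p γ) : ImplPred c q := by
  rwa [funext fun γ => propext (h γ)]

theorem ImplPred.not (hp : ImplPred c p) : ImplPred c fun γ => ¬ p γ := by
  obtain ⟨φ, hφ, hφp⟩ := hp
  refine ⟨_, (Impl.const 1).sub hφ, fun γ => ?_⟩
  beta_reduce
  rw [← hφp γ]
  omega

theorem ImplPred.and (hp : ImplPred c p) (hq : ImplPred c q) : ImplPred c fun γ => p γ ∧ q γ := by
  obtain ⟨φ, hφ, hφp⟩ := hp
  obtain ⟨ψ, hψ, hψq⟩ := hq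
  exact ⟨_, hφ.mul hψ, fun γ => mul_ne_zero_iff.trans (and_congr (hφp γ) (hψq γ))⟩

theorem Impl.lt (hf : Impl c f) (hg : Impl c g) : ImplPred c fun γ => f γ < g γ :=
  ⟨_, hg.sub hf, fun γ => by omega⟩

theorem Impl.le (hf : Impl c f) (hg : Impl c g) : ImplPred c fun γ => f γ ≤ g γ :=
  ⟨_, hg.succ.sub hf, fun γ => by omega⟩

theorem Impl.eq (hf : Impl c f) (hg : Impl c g) : ImplPred c fun γ => f γ = g γ :=
  ((hf.le hg).and (hg.le hf)).congr fun _ => le_antisymm_iff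

theorem Impl.indicator [DecidablePred p] (hp : ImplPred c p) :
    Impl c fun γ => if p γ then 1 else 0 :=
  .ite hp (.const 1) (.const 0)

theorem Impl.min (hf : Impl c f) (hg : Impl c g) : Impl c fun γ => min (f γ) (g γ) :=
  (Impl.ite (hf.le hg) hf hg).congr fun _ => rfl

theorem succ_div_eq_ite (k n : ℕ) :
    (k + 1) / n = if n * (k / n + 1) = k + 1 then k / n + 1 else k / n := by
  have hdvd : n ∣ k + 1 ↔ n * (k / n + 1) = k + 1 := by
    refine ⟨fun h => ?_, Dvd.intro _⟩
    rw [← Nat.succ_div_of_dvd h, Nat.mul_div_cancel' h]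
  rw [Nat.succ_div]
  simp only [hdvd]
  split_ifs <;> rfl

theorem Impl.div (hf : Impl c f) (hg : Impl c g) : Impl c fun γ => f γ / g γ := by
  refine .rec (F := fun γ k => k / g γ) hf (Impl.zero.congr fun γ => Nat.zero_div _)
    (fun _ _ _ _ e hk _ hd => ?_)
    (hf.bdd.upTo fun γ k hk => (Nat.div_le_self _ _).trans hk)
  exact (Impl.ite (((hg.comp e).mul hd.succ).eq hk.succ) hd.succ hd).congr fun x =>
    succ_div_eq_ite _ _

theorem Impl.mod (hf : Impl c f) (hg : Impl c g) : Impl c fun γ => f γ % g γ :=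
  (hf.sub (hg.mul (hf.div hg))).congr fun _ => Nat.mod_eq_sub_mul_div

theorem pow_le_pow_add_one {a k n : ℕ} (h : k ≤ n) : a ^ k ≤ a ^ n + 1 := by
  rcases Nat.eq_zero_or_pos a with rfl | ha
  · exact (zero_pow_le_one k).trans (Nat.le_add_left _ _)
  · exact (Nat.pow_le_pow_right ha h).trans (Nat.le_succ _)

theorem Impl.pow (hf : Impl c f) (hg : Impl c g) (hB : Bdd c fun γ => f γ ^ g γ) :
    Impl c fun γ => f γ ^ g γ :=
  .rec (F := fun γ k => f γ ^ k) hg (.const 1) (fun _ _ _ _ e _ _ h => h.mul (hf.comp e))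
    ((hB.add (.const 1)).upTo fun _ _ => pow_le_pow_add_one)

theorem Impl.sum {n : Γ → ℕ} {F : Γ → ℕ → ℕ} (hn : Impl c n)
    (hF : ImplFam c (fun γ k => k < n γ) F) (hB : Bdd c fun γ => ∑ k ∈ Finset.range (n γ), F γ k) :
    Impl c fun γ => ∑ k ∈ Finset.range (n γ), F γ k :=
  .rec (F := fun γ n => ∑ k ∈ Finset.range n, F γ k) hn .zero
    (fun _ c' π k e hk hl h =>
      (h.add (hF c' π k e hk hl)).congr fun _ => Finset.sum_range_succ _ _)
    (hB.upTo fun _ _ hk => Finset.sum_le_sum_of_subset (Finset.range_subset_range.2 hk))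

theorem ImplPred.ball_lt {n : Γ → ℕ} {P : Γ → ℕ → Prop} (hn : Impl c n)
    (hP : ∀ ⦃Γ' : Type⦄ (c' : Ctx t Γ') (π : Γ' → Γ) (k : Γ' → ℕ), c'.Extends c π → Impl c' k →
      (∀ x, k x < n (π x)) → ImplPred c' fun x => P (π x) (k x)) :
    ImplPred c fun γ => ∀ k < n γ, P γ k := by
  classical
  have hcount : Impl c fun γ => ∑ k ∈ Finset.range (n γ), if ¬ P γ k then 1 else 0 := by
    refine Impl.sum hn (fun _ c' π k e hk hl => Impl.indicator (hP c' π k e hk hl).not)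
      (hn.bdd.mono fun γ => ?_)
    rw [Finset.sum_boole]
    exact (Finset.card_filter_le _ _).trans (Finset.card_range _).le
  refine ImplPred.congr (ImplPred.not ⟨_, hcount, fun _ => Iff.rfl⟩) fun γ => ?_
  simp [Finset.sum_eq_zero_iff]

end Arithmetic

section Digits

/-- The digit of `n` at place `y` in base `B`. -/
def digit (B n y : ℕ) : ℕ := n / B ^ y % B

/-- The number with the `n` base-`B` digits `g 0, …, g (n - 1)`, least significant first. -/
def ofDigits (B n : ℕ) (g : ℕ → ℕ) : ℕ := ∑ x ∈ Finset.range n, g x * B ^ x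

theorem digit_le (B n y : ℕ) : digit B n y ≤ n := (Nat.mod_le _ _).trans (Nat.div_le_self _ _)

theorem ofDigits_succ (B n : ℕ) (g : ℕ → ℕ) :
    ofDigits B (n + 1) g = g 0 + B * ofDigits B n fun x => g (x + 1) := by
  rw [ofDigits, Finset.sum_range_succ', ofDigits, Finset.mul_sum, add_comm, pow_zero, mul_one]
  exact congrArg _ (Finset.sum_congr rfl fun x _ => by ring)

theorem ofDigits_lt {B n : ℕ} {g : ℕ → ℕ} (hg : ∀ x < n, g x < B) : ofDigits B n g < B ^ n := by
  induction n generalizing g with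
  | zero => simp [ofDigits]
  | succ n ih =>
    have htail := ih fun x hx => hg (x + 1) (by omega)
    have hhead := hg 0 n.succ_pos
    rw [ofDigits_succ, pow_succ']
    nlinarith [Nat.mul_le_mul_left B htail]

theorem digit_ofDigits {B n : ℕ} {g : ℕ → ℕ} (hg : ∀ x < n, g x < B) {y : ℕ} (hy : y < n) :
    digit B (ofDigits B n g) y = g y := by
  induction n generalizing g y with
  | zero => omega
  | succ n ih =>
    have h0 := hg 0 n.succ_pos
    rw [digit, ofDigits_succ]
    rcases y with _ | y
    · rw [pow_zero, Nat.div_one, Nat.add_mul_mod_self_left, Nat.mod_eq_of_lt h0]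
    · rw [pow_succ', ← Nat.div_div_eq_div_mul, Nat.add_mul_div_left _ _ (Nat.zero_lt_of_lt h0),
        Nat.div_eq_of_lt h0, Nat.zero_add]
      exact ih (fun x hx => hg (x + 1) (by omega)) (by omega)

theorem Impl.digit (hf : Impl c f) (hg : Impl c g) (hh : Impl c h) :
    Impl c fun γ => digit (f γ) (g γ) (h γ) := by
  refine Impl.mod (.rec (F := fun γ k => g γ / f γ ^ k) hh (hg.congr fun γ => by simp)
    (fun _ _ _ _ e _ _ h => (h.div (hf.comp e)).congr fun x => ?_)
    (hg.bdd.upTo fun _ _ _ => Nat.div_le_self _ _)) hf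
  rw [Nat.div_div_eq_div_mul, pow_succ]

theorem Impl.ofDigits {n : Γ → ℕ} {F : Γ → ℕ → ℕ} (hf : Impl c f) (hn : Impl c n)
    (hF : ImplFam c (fun γ k => k < n γ) F) (hlt : ∀ γ, ∀ k < n γ, F γ k < f γ)
    (hB : Bdd c fun γ => f γ ^ n γ) : Impl c fun γ => ofDigits (f γ) (n γ) (F γ) := by
  refine Impl.sum hn (fun _ c' π k e hk hl => (hF c' π k e hk hl).mul
    ((hf.comp e).pow hk ?_)) (hB.mono fun γ => (ofDigits_lt (hlt γ)).le)
  exact ((hB.add (.const 1)).comp e).mono fun x => pow_le_pow_add_one (hl x).le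

end Digits

theorem Impl.inputLength (j : Fin t) (hB : Bdd c fun γ => (c.inp γ j).length) :
    Impl c fun γ => (c.inp γ j).length := by
  let F : ℕ → Γ → ℕ → ℕ
    | 0, γ, k => symbolCode (OfflineTM.readInput (c.inp γ j) (k + 1))
    | _, _, k => k
  refine Impl.while (F := F) (n := 2) (τ := fun γ => (c.inp γ j).length) two_pos ?_ ?_ ?_
    (fun γ k => symbolCode_readInput_ne_zero.2)
    (fun γ => not_not.1 fun h => lt_irrefl _ (symbolCode_readInput_ne_zero.1 h)) 1 one_lt_two
  · rintro (_ | i) _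
    · exact Impl.read j (.const 1)
    · exact .zero
  · intro Γ' c' π k e _ hF
    have hk : Impl c' k := hF 1 one_lt_two
    rintro (_ | i) _
    · exact (hk.succ.succ.read j).congr fun x => by simp only [F, e.inp]
    · exact hk.succ
  · rintro (_ | i) _
    · exact (Bdd.const 2).upTo fun γ k _ => symbolCode_le_two _
    · exact hB.upTo fun _ _ => id

end Operations

/-! ### Simulation of machines given by numbers -/

/-- A Turing machine given by numbers, run on numerical configurations: the number `k` of work
tapes, a transition table given by the digits of `table` in base `base`, the number `width` of
represented cells of each work tape, a bound `range` for the head positions, and the code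
`read j p` of the symbol at cell `p` of the `j`-th input tape. -/
structure NumMachine where
  k : ℕ
  base : ℕ
  table : ℕ
  width : ℕ
  range : ℕ
  read : ℕ → ℕ → ℕ

/-- A configuration of a `NumMachine`: the state, the symbols in the represented cells of the work
tapes as base-3 digits, and the positions of the heads as digits in base `range`. -/
@[ext]
structure NumCfg where
  state : ℕ
  tapes : ℕ
  heads : ℕ

/-- The position to which the movement with code `m` takes a head from position `p`, where a head
that is stuck cannot move to the right. -/
def moveHead (m p : ℕ) (stuck : Prop) [Decidable stuck] : ℕ :=
  if m = 1 then p - 1 else if m = 2 then (if stuck then p else p + 1) else p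

namespace NumMachine

variable (S : NumMachine) (t : ℕ) (x : NumCfg)

/-- The position of head `h`. The heads `h < t` are those of the input tapes. -/
def headPos (h : ℕ) : ℕ := digit S.range x.heads h

/-- The code of the symbol scanned by head `h`. -/
def scanned (h : ℕ) : ℕ :=
  if h < t then S.read h (S.headPos x h) else digit 3 x.tapes ((h - t) * S.width + S.headPos x h)

/-- The number of the row of the transition table that applies. -/
def row : ℕ := x.state * 3 ^ (t + S.k) + ofDigits 3 (t + S.k) (S.scanned t x)

/-- Entry `e` of the row that applies: entry `0` is `0` to halt and otherwise one more than the
next state, entry `1` is the emitted symbol, and the entries `2 * h + 2` and `2 * h + 3` are the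
movement of head `h` and the symbol written by it. Digit `0` of the table is the initial state, so
that the rows start at digit `1`. -/
def entry (e : ℕ) : ℕ := digit S.base S.table (S.row t x * (2 * (t + S.k) + 2) + e + 1)

/-- The position of head `h` after a step. An input head that sees a blank in a cell other than
cell `0` has reached the end of the input. -/
def newPos (h : ℕ) : ℕ :=
  min (moveHead (S.entry t x (2 * h + 2)) (S.headPos x h)
    (h < t ∧ 0 < S.headPos x h ∧ S.read h (S.headPos x h) = 0)) (S.range - 1)

/-- The symbol in the work cell `z` after a step, where the `i`-th work tape consists of the cells
from `i * width` on. -/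
def newCell (z : ℕ) : ℕ :=
  if z % S.width = S.headPos x (t + z / S.width) then
    min (S.entry t x (2 * (t + z / S.width) + 3)) 2
  else digit 3 x.tapes z

/-- The configuration after a step that does not halt. -/
def succ : NumCfg where
  state := S.entry t x 0 - 1
  tapes := ofDigits 3 (S.k * S.width) (S.newCell t x)
  heads := ofDigits S.range (t + S.k) (S.newPos t x)

/-- The initial configuration. -/
def start : NumCfg where
  state := digit S.base S.table 0
  tapes := 0
  heads := ofDigits S.range (t + S.k) fun h => if h < t then 0 else S.width / 2

/-- The configuration after `n` steps, and the value of a fold over the output so far. -/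
def run (g : ℕ → ℕ → ℕ) (a₀ : ℕ) : ℕ → NumCfg × ℕ
  | 0 => (S.start t, a₀)
  | n + 1 =>
    let y := run g a₀ n
    if S.entry t y.1 0 = 0 then y
    else (S.succ t y.1, if S.entry t y.1 1 = 0 then y.2 else g y.2 (S.entry t y.1 1 - 1))

/-- The number of configurations, after which a halting run has halted. -/
def steps : ℕ := S.base * 3 ^ (S.k * S.width) * S.range ^ (t + S.k)

/-- The value of a fold over the output. -/
def fold (g : ℕ → ℕ → ℕ) (a₀ : ℕ) : ℕ := (S.run t g a₀ (S.steps t)).2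

end NumMachine

section Codes

/-- The symbol with a given code. -/
def symbolOfCode : ℕ → Option Bool
  | 0 => none
  | 1 => some false
  | _ => some true

theorem symbolOfCode_symbolCode (x : Option Bool) : symbolOfCode (symbolCode x) = x := by
  rcases x with _ | _ | _ <;> rfl

theorem ite_symbolCode_eq_foldl (g : ℕ → ℕ → ℕ) (a : ℕ) (x : Option Bool) :
    (if symbolCode x = 0 then a else g a (symbolCode x - 1)) =
      x.toList.foldl (fun a b => g a b.toNat) a := by
  rcases x with _ | _ | _ <;> rfl

theorem symbolCode_lt_three (x : Option Bool) : symbolCode x < 3 :=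
  Nat.lt_succ_of_le (symbolCode_le_two x)

/-- The code of a movement. -/
def moveCode : Move → ℕ
  | .stay => 0
  | .left => 1
  | .right => 2

theorem moveCode_le_two (m : Move) : moveCode m ≤ 2 := by cases m <;> simp [moveCode]

theorem moveHead_moveCode_input {l : List Bool} {p : ℕ} (hp : p ≤ l.length + 1) (m : Move)
    {stuck : Prop} [Decidable stuck] (hstuck : stuck ↔ l.length < p) :
    moveHead (moveCode m) p stuck = OfflineTM.moveInput l.length m p := by
  cases m
  · rfl
  · rfl
  · simp only [moveHead, moveCode, OfflineTM.moveInput, hstuck]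
    split_ifs <;> omega

theorem moveHead_moveCode_work {z L : ℤ} (hz : -L ≤ z) (m : Move)
    (hz' : -L ≤ OfflineTM.moveWork m z) {stuck : Prop} [Decidable stuck] (hstuck : ¬ stuck) :
    moveHead (moveCode m) (z + L).toNat stuck = (OfflineTM.moveWork m z + L).toNat := by
  cases m <;> simp [moveHead, moveCode, OfflineTM.moveWork, hstuck] at hz' ⊢ <;> omega

theorem length_lt_iff_readInput {l : List Bool} {p : ℕ} :
    0 < p ∧ symbolCode (OfflineTM.readInput l p) = 0 ↔ l.length < p := by
  rcases p with _ | p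
  · simp
  · rw [and_iff_right p.succ_pos, ← not_iff_not, not_lt, Nat.succ_le_iff]
    exact symbolCode_readInput_ne_zero

/-- A function on the `t` input heads and a function on the `k` work heads as one function on the
numbers of the heads, with the value `d` beyond the last head. -/
def joinHeads {α : Type} {t k : ℕ} (d : α) (x : Fin t → α) (y : Fin k → α) (h : ℕ) : α :=
  if ht : h < t then x ⟨h, ht⟩ else if hk : h - t < k then y ⟨h - t, hk⟩ else d

theorem joinHeads_left {α : Type} {t k : ℕ} {d : α} {x : Fin t → α} {y : Fin k → α} {h : ℕ}
    (ht : h < t) : joinHeads d x y h = x ⟨h, ht⟩ := by simp [joinHeads, ht]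

theorem joinHeads_right {α : Type} {t k : ℕ} {d : α} {x : Fin t → α} {y : Fin k → α} {h : ℕ}
    (hk : h < k) : joinHeads d x y (t + h) = y ⟨h, hk⟩ := by simp [joinHeads, hk]

variable {t k : ℕ} {Q : Type} (e : Q → ℕ)

/-- The row of the transition table for an action, where `e` numbers the states. -/
def actionEntry : Option (Action t k Q) → ℕ → ℕ
  | none, _ => 0
  | some A, 0 => e A.next + 1
  | some A, 1 => symbolCode A.emit
  | some A, j + 2 =>
    if j % 2 = 0 then moveCode (joinHeads .stay A.inMove A.workMove (j / 2))
    else symbolCode (joinHeads none (fun _ : Fin t => none) A.write (j / 2))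

theorem actionEntry_move (A : Action t k Q) (h : ℕ) :
    actionEntry e (some A) (2 * h + 2) = moveCode (joinHeads .stay A.inMove A.workMove h) := by
  simp [actionEntry]

theorem actionEntry_write (A : Action t k Q) {i : ℕ} (hi : i < k) :
    actionEntry e (some A) (2 * (t + i) + 3) = symbolCode (A.write ⟨i, hi⟩) := by
  have hdiv : (2 * (t + i) + 1) / 2 = t + i := by omega
  rw [actionEntry, if_neg (by omega), hdiv, joinHeads_right hi]

theorem actionEntry_lt {n : ℕ} (he : ∀ q, e q < n) (A : Option (Action t k Q)) (j : ℕ) :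
    actionEntry e A j < n + 3 := by
  rcases A, j with ⟨_ | A, _ | _ | j⟩ <;> simp only [actionEntry]
  · omega
  · omega
  · omega
  · have := he A.next
    omega
  · exact (symbolCode_lt_three _).trans_le (Nat.le_add_left _ _)
  · split_ifs
    · exact (Nat.lt_succ_of_le (moveCode_le_two _)).trans_le (Nat.le_add_left _ _)
    · exact (symbolCode_lt_three _).trans_le (Nat.le_add_left _ _)

end Codes

theorem mul_add_div_of_lt {q r n : ℕ} (hr : r < n) : (q * n + r) / n = q := by
  rw [mul_comm, Nat.mul_add_div (Nat.zero_lt_of_lt hr), Nat.div_eq_of_lt hr, add_zero]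

theorem mul_add_mod_of_lt {q r n : ℕ} (hr : r < n) : (q * n + r) % n = r := by
  rw [mul_comm, Nat.mul_add_mod, Nat.mod_eq_of_lt hr]

theorem mul_add_lt_mul {q r m n : ℕ} (hq : q < m) (hr : r < n) : q * n + r < m * n := by
  nlinarith [Nat.mul_le_mul_right n hq]

theorem ofDigits_congr {B n : ℕ} {f g : ℕ → ℕ} (h : ∀ x < n, f x = g x) :
    ofDigits B n f = ofDigits B n g :=
  Finset.sum_congr rfl fun x hx => by rw [h x (Finset.mem_range.1 hx)]

namespace OfflineTM

section Table

variable {t : ℕ} (M : OfflineTM t)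

/-- A numbering of the states. -/
noncomputable def stateCode (q : M.State) : ℕ :=
  letI := M.fin
  (Fintype.equivFin M.State q).val

/-- The number of states. -/
def numStates : ℕ :=
  letI := M.fin
  Fintype.card M.State

theorem stateCode_lt (q : M.State) : M.stateCode q < M.numStates := Fin.is_lt _

theorem stateCode_injective : Function.Injective M.stateCode := by
  let := M.fin
  exact Fin.val_injective.comp (Fintype.equivFin M.State).injective

/-- The state with a given number, and some state if there is none. -/
noncomputable def stateOfCode (n : ℕ) : M.State :=
  haveI : Nonempty M.State := ⟨M.start⟩
  Function.invFun M.stateCode n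

theorem stateOfCode_stateCode (q : M.State) : M.stateOfCode (M.stateCode q) = q :=
  haveI : Nonempty M.State := ⟨M.start⟩
  Function.leftInverse_invFun M.stateCode_injective q

/-- The transition table, in the layout described at `NumMachine.entry`. -/
noncomputable def tableEntry : ℕ → ℕ
  | 0 => M.stateCode M.start
  | j + 1 =>
    let r := j / (2 * (t + M.k) + 2)
    let scanned := fun h => symbolOfCode (digit 3 (r % 3 ^ (t + M.k)) h)
    actionEntry M.stateCode (M.δ (M.stateOfCode (r / 3 ^ (t + M.k))) (fun h => scanned h)
      (fun h => scanned (t + h))) (j % (2 * (t + M.k) + 2))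

/-- The length of the transition table. -/
def tableLength : ℕ := M.numStates * 3 ^ (t + M.k) * (2 * (t + M.k) + 2) + 1

/-- The transition table as a number. -/
noncomputable def tableCode : ℕ := ofDigits (M.numStates + 3) M.tableLength M.tableEntry

theorem digit_tableCode {j : ℕ} (hj : j < M.tableLength) :
    digit (M.numStates + 3) M.tableCode j = M.tableEntry j := by
  refine digit_ofDigits (fun j _ => ?_) hj
  rcases j with _ | j
  · exact (M.stateCode_lt _).trans_le (Nat.le_add_right _ _)
  · exact actionEntry_lt _ M.stateCode_lt _ _

theorem digit_tableCode_row (q : M.State) (x : Fin t → Option Bool) (y : Fin M.k → Option Bool)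
    {e : ℕ} (he : e < 2 * (t + M.k) + 2) :
    digit (M.numStates + 3) M.tableCode ((M.stateCode q * 3 ^ (t + M.k) +
      ofDigits 3 (t + M.k) fun h => symbolCode (joinHeads none x y h)) *
        (2 * (t + M.k) + 2) + e + 1) = actionEntry M.stateCode (M.δ q x y) e := by
  have hlt : ∀ h < t + M.k, symbolCode (joinHeads none x y h) < 3 := fun h _ =>
    symbolCode_lt_three _
  have hrow := ofDigits_lt hlt
  have hdigit : ∀ h < t + M.k, symbolOfCode (digit 3 (ofDigits 3 (t + M.k) fun h =>
      symbolCode (joinHeads none x y h)) h) = joinHeads none x y h := fun h hh => by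
    rw [digit_ofDigits hlt hh, symbolOfCode_symbolCode]
  rw [digit_tableCode]
  · simp only [tableEntry]
    rw [mul_add_div_of_lt he, mul_add_mod_of_lt he, mul_add_div_of_lt hrow,
      mul_add_mod_of_lt hrow, stateOfCode_stateCode]
    congr 2
    · exact funext fun h => by rw [hdigit _ (by omega), joinHeads_left h.2]
    · exact funext fun h => by rw [hdigit _ (by omega), joinHeads_right h.2]
  · exact Nat.succ_lt_succ (mul_add_lt_mul (mul_add_lt_mul (M.stateCode_lt q) hrow) he)

end Table

section Configurations

variable {t : ℕ} {M : OfflineTM t} {inp : Fin t → List Bool} {L : ℕ} {c c' : M.Cfg}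

/-- The action taken in a configuration, if the machine does not halt. -/
def action (M : OfflineTM t) (inp : Fin t → List Bool) (c : M.Cfg) :
    Option (Action t M.k M.State) :=
  M.δ c.state (fun i => readInput (inp i) (c.inPos i)) fun i => c.tape i (c.pos i)

/-- The code of the symbol in the represented work cell `z`: each work tape is represented by its
`2 * L + 1` cells from `-L` to `L`. -/
def cellCode (M : OfflineTM t) (L : ℕ) (c : M.Cfg) (z : ℕ) : ℕ :=
  if h : z / (2 * L + 1) < M.k then
    symbolCode (c.tape ⟨z / (2 * L + 1), h⟩ ((z % (2 * L + 1) : ℕ) - (L : ℤ)))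
  else 0

/-- The position of head `h` as a natural number, counted from cell `-L` on work tapes. -/
def posCode (M : OfflineTM t) (L : ℕ) (c : M.Cfg) (h : ℕ) : ℕ :=
  joinHeads 0 c.inPos (fun i => (c.pos i + L).toNat) h

/-- The numerical configuration that represents a configuration. -/
noncomputable def toNumCfg (M : OfflineTM t) (L range : ℕ) (c : M.Cfg) : NumCfg where
  state := M.stateCode c.state
  tapes := ofDigits 3 (M.k * (2 * L + 1)) (M.cellCode L c)
  heads := ofDigits range (t + M.k) (M.posCode L c)

/-- The heads are within the represented parts of the tapes. -/
structure Within (M : OfflineTM t) (inp : Fin t → List Bool) (L : ℕ) (c : M.Cfg) : Prop where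
  inPos_le : ∀ j, c.inPos j ≤ (inp j).length + 1
  abs_pos_le : ∀ i, |c.pos i| ≤ (L : ℤ)

theorem Within.step (hc : M.Within inp L c) (h : M.step inp c = some c')
    (hpos : ∀ i, |c'.pos i| ≤ (L : ℤ)) : M.Within inp L c' := by
  refine ⟨fun j => ?_, hpos⟩
  obtain ⟨A, -, rfl⟩ := Option.map_eq_some_iff.1 h
  have := hc.inPos_le j
  simp only
  cases A.inMove j <;> simp only [moveInput] <;> omega

theorem cellCode_lt_three (c : M.Cfg) (z : ℕ) : M.cellCode L c z < 3 := by
  rw [cellCode]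
  split_ifs
  · exact symbolCode_lt_three _
  · norm_num

theorem cellCode_mul_add {i p : ℕ} (hi : i < M.k) (hp : p < 2 * L + 1) :
    M.cellCode L c (i * (2 * L + 1) + p) = symbolCode (c.tape ⟨i, hi⟩ (p - L)) := by
  simp only [cellCode, mul_add_div_of_lt hp, mul_add_mod_of_lt hp, hi, dif_pos]

theorem digit_tapes_toNumCfg {range z : ℕ} (hz : z < M.k * (2 * L + 1)) :
    digit 3 (M.toNumCfg L range c).tapes z = M.cellCode L c z :=
  digit_ofDigits (fun z _ => cellCode_lt_three c z) hz

end Configurations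

section Step

variable {t : ℕ} {M : OfflineTM t} {inp : Fin t → List Bool} {L : ℕ} {c c' : M.Cfg}
  {S : NumMachine}

/-- The numerical machine `S` represents the machine `M` on the input `inp` in space `L`. -/
structure RepresentedBy (M : OfflineTM t) (inp : Fin t → List Bool) (L : ℕ) (S : NumMachine) :
    Prop where
  k_eq : S.k = M.k
  base_eq : S.base = M.numStates + 3
  table_eq : S.table = M.tableCode
  width_eq : S.width = 2 * L + 1
  input_lt : ∀ j, (inp j).length + 1 < S.range
  work_lt : 2 * L < S.range
  read_eq : ∀ (j : Fin t) p, S.read j p = symbolCode (readInput (inp j) p)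

variable (hS : M.RepresentedBy inp L S)

include hS

theorem posCode_lt (hc : M.Within inp L c) (h : ℕ) : M.posCode L c h < S.range := by
  have := hS.work_lt
  rw [posCode, joinHeads]
  split_ifs with ht hk
  · exact (hc.inPos_le _).trans_lt (hS.input_lt _)
  · have := abs_le.1 (hc.abs_pos_le ⟨h - t, hk⟩)
    omega
  · omega

theorem headPos_toNumCfg (hc : M.Within inp L c) {h : ℕ} (hh : h < t + M.k) :
    S.headPos (M.toNumCfg L S.range c) h = M.posCode L c h :=
  digit_ofDigits (fun h _ => posCode_lt hS hc h) hh

theorem scanned_toNumCfg (hc : M.Within inp L c) {h : ℕ} (hh : h < t + M.k) :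
    S.scanned t (M.toNumCfg L S.range c) h = symbolCode (joinHeads none
      (fun i => readInput (inp i) (c.inPos i)) (fun i => c.tape i (c.pos i)) h) := by
  rw [NumMachine.scanned, headPos_toNumCfg hS hc hh]
  split_ifs with ht
  · rw [joinHeads_left ht, posCode, joinHeads_left ht]
    exact hS.read_eq ⟨h, ht⟩ _
  · obtain ⟨i, rfl⟩ := Nat.exists_eq_add_of_le (not_lt.1 ht)
    have hi : i < M.k := by omega
    have hpos := abs_le.1 (hc.abs_pos_le ⟨i, hi⟩)
    obtain ⟨p, hp⟩ := Int.eq_ofNat_of_zero_le (a := c.pos ⟨i, hi⟩ + L) (by omega)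
    have hp' : p < 2 * L + 1 := by omega
    rw [joinHeads_right hi, posCode, joinHeads_right hi, hp, Int.toNat_natCast,
      Nat.add_sub_cancel_left, hS.width_eq, digit_tapes_toNumCfg (mul_add_lt_mul hi hp'),
      cellCode_mul_add hi hp', ← hp, add_sub_cancel_right]

theorem entry_toNumCfg (hc : M.Within inp L c) {e : ℕ} (he : e < 2 * (t + M.k) + 2) :
    S.entry t (M.toNumCfg L S.range c) e = actionEntry M.stateCode (M.action inp c) e := by
  rw [NumMachine.entry, NumMachine.row, hS.k_eq, hS.base_eq, hS.table_eq,
    ofDigits_congr fun h hh => scanned_toNumCfg hS hc hh]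
  exact M.digit_tableCode_row _ _ _ he

theorem entry_zero_toNumCfg (hc : M.Within inp L c) :
    S.entry t (M.toNumCfg L S.range c) 0 = 0 ↔ M.step inp c = none := by
  rw [entry_toNumCfg hS hc (by omega), step, Option.map_eq_none_iff, ← action]
  rcases M.action inp c with _ | A <;> simp [actionEntry]

theorem newPos_toNumCfg (hc : M.Within inp L c) (h : M.step inp c = some c')
    (hc' : M.Within inp L c') {a : ℕ} (ha : a < t + M.k) :
    S.newPos t (M.toNumCfg L S.range c) a = M.posCode L c' a := by
  have hlt := posCode_lt hS hc' a
  obtain ⟨A, hA, rfl⟩ := Option.map_eq_some_iff.1 h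
  rw [NumMachine.newPos, entry_toNumCfg hS hc (by omega), headPos_toNumCfg hS hc ha, action, hA,
    actionEntry_move]
  refine Eq.trans (congrArg (min · _) ?_) (min_eq_left (Nat.le_sub_one_of_lt hlt))
  rcases lt_or_ge a t with hat | hta
  · simp only [posCode, joinHeads_left hat]
    refine moveHead_moveCode_input (hc.inPos_le ⟨a, hat⟩) _ ?_
    rw [show S.read a _ = _ from hS.read_eq ⟨a, hat⟩ _, length_lt_iff_readInput, and_iff_right hat]
  · obtain ⟨i, rfl⟩ := Nat.exists_eq_add_of_le hta
    have hi : i < M.k := by omega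
    simp only [posCode, joinHeads_right hi]
    exact moveHead_moveCode_work (abs_le.1 (hc.abs_pos_le ⟨i, hi⟩)).1 _
      (abs_le.1 (hc'.abs_pos_le ⟨i, hi⟩)).1 (by omega)

theorem newCell_toNumCfg (hc : M.Within inp L c) (h : M.step inp c = some c') {z : ℕ}
    (hz : z < M.k * (2 * L + 1)) :
    S.newCell t (M.toNumCfg L S.range c) z = M.cellCode L c' z := by
  obtain ⟨A, hA, rfl⟩ := Option.map_eq_some_iff.1 h
  have hi : z / (2 * L + 1) < M.k := (Nat.div_lt_iff_lt_mul (by omega)).2 hz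
  have hpos := abs_le.1 (hc.abs_pos_le ⟨z / (2 * L + 1), hi⟩)
  rw [NumMachine.newCell, hS.width_eq, headPos_toNumCfg hS hc (by omega),
    digit_tapes_toNumCfg hz, entry_toNumCfg hS hc (by omega), action, hA, posCode,
    joinHeads_right hi, cellCode, cellCode, dif_pos hi, dif_pos hi, actionEntry_write _ _ hi,
    min_eq_left (symbolCode_le_two _)]
  have hiff : z % (2 * L + 1) = (c.pos ⟨z / (2 * L + 1), hi⟩ + L).toNat ↔
      (z % (2 * L + 1) : ℕ) - (L : ℤ) = c.pos ⟨z / (2 * L + 1), hi⟩ := by omega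
  simp only [Function.update_apply, hiff]
  split_ifs <;> rfl

theorem succ_toNumCfg (hc : M.Within inp L c) (h : M.step inp c = some c')
    (hc' : M.Within inp L c') :
    S.succ t (M.toNumCfg L S.range c) = M.toNumCfg L S.range c' := by
  ext
  · obtain ⟨A, hA, rfl⟩ := Option.map_eq_some_iff.1 h
    simp only [NumMachine.succ]
    rw [entry_toNumCfg hS hc (by omega), action, hA]
    rfl
  · simp only [NumMachine.succ, hS.k_eq, hS.width_eq]
    exact ofDigits_congr fun z hz => newCell_toNumCfg hS hc h hz
  · simp only [NumMachine.succ, hS.k_eq]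
    exact ofDigits_congr fun a ha => newPos_toNumCfg hS hc h hc' ha

theorem start_eq_toNumCfg : S.start t = M.toNumCfg L S.range M.init := by
  ext
  · simp only [NumMachine.start]
    rw [hS.base_eq, hS.table_eq, M.digit_tableCode (Nat.succ_pos _)]
    rfl
  · simp [NumMachine.start, toNumCfg, ofDigits, cellCode, init, symbolCode]
  · simp only [NumMachine.start, hS.k_eq, hS.width_eq]
    refine ofDigits_congr fun a ha => ?_
    split_ifs with hat
    · rw [posCode, joinHeads_left hat]
      rfl
    · obtain ⟨i, rfl⟩ := Nat.exists_eq_add_of_le (not_lt.1 hat)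
      rw [posCode, joinHeads_right (by omega)]
      simp only [init]
      omega

end Step

section Run

variable {t : ℕ} {M : OfflineTM t} {inp : Fin t → List Bool} {L : ℕ} {c : M.Cfg}
  {S : NumMachine}

/-- The configuration after `n` steps, or the last one if the machine has halted before. -/
def cfgAt (M : OfflineTM t) (inp : Fin t → List Bool) : ℕ → M.Cfg
  | 0 => M.init
  | n + 1 => (M.step inp (M.cfgAt inp n)).getD (M.cfgAt inp n)

theorem reaches_cfgAt (n : ℕ) : StateTransition.Reaches (M.step inp) M.init (M.cfgAt inp n) := by
  induction n with
  | zero => exact .refl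
  | succ n ih =>
    rw [cfgAt]
    rcases h : M.step inp (M.cfgAt inp n) with _ | c
    · exact ih
    · exact ih.tail h

theorem exists_cfgAt (h : StateTransition.Reaches (M.step inp) M.init c) :
    ∃ n, M.cfgAt inp n = c := by
  induction h with
  | refl => exact ⟨0, rfl⟩
  | tail _ h ih =>
    obtain ⟨n, rfl⟩ := ih
    exact ⟨n + 1, by rw [cfgAt, Option.mem_def.1 h, Option.getD_some]⟩

theorem cfgAt_of_halted {n m : ℕ} (h : M.step inp (M.cfgAt inp n) = none) (hm : n ≤ m) :
    M.cfgAt inp m = M.cfgAt inp n := by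
  induction m, hm using Nat.le_induction with
  | base => rfl
  | succ m _ ih => rw [cfgAt, ih, h, Option.getD_none]

variable (hL : ∀ c, StateTransition.Reaches (M.step inp) M.init c → ∀ i, |c.pos i| ≤ (L : ℤ))

include hL

theorem within_cfgAt (n : ℕ) : M.Within inp L (M.cfgAt inp n) := by
  induction n with
  | zero => exact ⟨fun j => Nat.zero_le _, hL _ .refl⟩
  | succ n ih =>
    have hpos := hL _ (M.reaches_cfgAt (inp := inp) (n + 1))
    rw [cfgAt] at hpos ⊢
    rcases h : M.step inp (M.cfgAt inp n) with _ | c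
    · exact ih
    · rw [h] at hpos
      exact ih.step h hpos

variable (hS : M.RepresentedBy inp L S)

include hS

theorem run_eq (g : ℕ → ℕ → ℕ) (a₀ n : ℕ) :
    S.run t g a₀ n = (M.toNumCfg L S.range (M.cfgAt inp n),
      (M.cfgAt inp n).out.foldl (fun a b => g a b.toNat) a₀) := by
  induction n with
  | zero => rw [NumMachine.run, start_eq_toNumCfg hS]; rfl
  | succ n ih =>
    have hc := within_cfgAt hL n
    have hc' := within_cfgAt hL (n + 1)
    have hhalt := entry_zero_toNumCfg hS hc
    rw [cfgAt] at hc' ⊢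
    simp only [NumMachine.run, ih]
    rcases h : M.step inp (M.cfgAt inp n) with _ | c
    · rw [if_pos (hhalt.2 h), Option.getD_none]
    · rw [h, Option.getD_some] at hc'
      rw [if_neg (by simp [hhalt, h]), succ_toNumCfg hS hc h hc', Option.getD_some,
        entry_toNumCfg hS hc (by omega)]
      obtain ⟨A, hA, rfl⟩ := Option.map_eq_some_iff.1 h
      rw [action, hA]
      simp only [actionEntry, Prod.mk.injEq, true_and, List.foldl_append]
      exact ite_symbolCode_eq_foldl _ _ _

end Run

end OfflineTM

theorem exists_lt_card_of_determined {α : Type*} {u : ℕ → α} {s : Finset α} (hu : ∀ n, u n ∈ s)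
    (hstep : ∀ a b, u a = u b → u (a + 1) = u (b + 1)) {p : α → Prop} (h : ∃ n, p (u n)) :
    ∃ n < s.card, p (u n) := by
  classical
  have hshift : ∀ {a b}, u a = u b → ∀ j, u (a + j) = u (b + j) := fun hab j => by
    induction j with
    | zero => exact hab
    | succ j ih => exact hstep _ _ ih
  refine ⟨Nat.find h, not_le.1 fun hcard => ?_, Nat.find_spec h⟩
  obtain ⟨a, b, hab, hb, heq⟩ : ∃ a b, a < b ∧ b ≤ Nat.find h ∧ u a = u b := by
    obtain ⟨a, ha, b, hb, hne, heq⟩ := Finset.exists_ne_map_eq_of_card_lt_of_maps_to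
      (s := Finset.range (Nat.find h + 1)) (t := s) (f := u)
      (by rw [Finset.card_range]; exact Nat.lt_succ_of_le hcard) fun n _ => hu n
    rw [Finset.mem_range, Nat.lt_succ_iff] at ha hb
    rcases hne.lt_or_gt with hlt | hlt
    · exact ⟨a, b, hlt, hb, heq⟩
    · exact ⟨b, a, hlt, ha, heq.symm⟩
  have hfind := Nat.find_spec h
  rw [← Nat.add_sub_cancel' hb, ← hshift heq] at hfind
  exact Nat.find_min h (by omega) hfind

namespace OfflineTM

variable {t : ℕ} {M : OfflineTM t} {inp : Fin t → List Bool} {L : ℕ} {S : NumMachine}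

theorem toNumCfg_mem (hS : M.RepresentedBy inp L S) {c : M.Cfg} (hc : M.Within inp L c) :
    ((M.toNumCfg L S.range c).state, (M.toNumCfg L S.range c).tapes,
      (M.toNumCfg L S.range c).heads) ∈
      Finset.range S.base ×ˢ Finset.range (3 ^ (S.k * S.width)) ×ˢ
        Finset.range (S.range ^ (t + S.k)) := by
  simp only [Finset.mem_product, Finset.mem_range, hS.base_eq, hS.k_eq, hS.width_eq]
  exact ⟨(M.stateCode_lt _).trans_le (Nat.le_add_right _ _),
    ofDigits_lt fun z _ => cellCode_lt_three c z, ofDigits_lt fun h _ => posCode_lt hS hc h⟩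

theorem exists_halted_lt_steps (hS : M.RepresentedBy inp L S)
    (hL : ∀ c, StateTransition.Reaches (M.step inp) M.init c → ∀ i, |c.pos i| ≤ (L : ℤ))
    (hhalt : ∃ n, M.step inp (M.cfgAt inp n) = none) :
    ∃ n < S.steps t, M.step inp (M.cfgAt inp n) = none := by
  let x (n : ℕ) : NumCfg := M.toNumCfg L S.range (M.cfgAt inp n)
  have hx (n : ℕ) : x n = (S.run t (fun a _ => a) 0 n).1 := by rw [run_eq hL hS]
  have hsucc (n : ℕ) : x (n + 1) = if S.entry t (x n) 0 = 0 then x n else S.succ t (x n) := by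
    rw [hx (n + 1), NumMachine.run, hx n]
    split_ifs <;> rfl
  have hiff (n : ℕ) : S.entry t (x n) 0 = 0 ↔ M.step inp (M.cfgAt inp n) = none :=
    entry_zero_toNumCfg hS (within_cfgAt hL n)
  simp only [← hiff] at hhalt ⊢
  have hcard := exists_lt_card_of_determined
    (u := fun n => ((x n).state, (x n).tapes, (x n).heads))
    (p := fun y => S.entry t ⟨y.1, y.2.1, y.2.2⟩ 0 = 0)
    (fun n => toNumCfg_mem hS (within_cfgAt hL n)) (fun a b hab => ?_) hhalt
  · rwa [Finset.card_product, Finset.card_product, Finset.card_range, Finset.card_range,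
      Finset.card_range, ← mul_assoc] at hcard
  · simp only [Prod.mk.injEq] at hab
    have hab : x a = x b := NumCfg.ext hab.1 hab.2.1 hab.2.2
    simp only [hsucc, hab]

theorem OutputsInSpace.fold_eq {o : List Bool} (h : M.OutputsInSpace inp o L)
    (hS : M.RepresentedBy inp L S) (g : ℕ → ℕ → ℕ) (a₀ : ℕ) :
    S.fold t g a₀ = o.foldl (fun a b => g a b.toNat) a₀ := by
  obtain ⟨⟨c, hc, rfl⟩, hL⟩ := h
  obtain ⟨hreach, hhalt⟩ := StateTransition.mem_eval.1 hc
  obtain ⟨n, rfl⟩ := exists_cfgAt hreach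
  obtain ⟨m, hm, hhalt'⟩ := exists_halted_lt_steps hS hL ⟨n, hhalt⟩
  rw [NumMachine.fold, run_eq hL hS, cfgAt_of_halted hhalt' hm.le]
  rcases le_total n m with hnm | hmn
  · rw [cfgAt_of_halted hhalt hnm]
  · rw [cfgAt_of_halted hhalt' hmn]

theorem OutputsInSpace.mono {o : List Bool} {L' : ℕ} (h : M.OutputsInSpace inp o L)
    (hL : L ≤ L') : M.OutputsInSpace inp o L' :=
  ⟨h.1, fun c hc i => (h.2 c hc i).trans (by exact_mod_cast hL)⟩

end OfflineTM

section NumericalSimulation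

variable {t n : ℕ} {Γ Γ' : Type} {c : Ctx t Γ} {c' : Ctx t Γ'} {π : Γ' → Γ}

/-- `F γ k l` can be computed from `γ`, `k` and `l` in space `O(space)`: it can be computed in every
extension of `c` in which `k` and `l` can. -/
def ImplFam₂ (c : Ctx t Γ) (F : Γ → ℕ → ℕ → ℕ) : Prop :=
  ∀ ⦃Γ' : Type⦄ (c' : Ctx t Γ') (π : Γ' → Γ) (k l : Γ' → ℕ), c'.Extends c π → Impl c' k →
    Impl c' l → Impl c' fun x => F (π x) (k x) (l x)

theorem ImplFam₂.comp {F : Γ → ℕ → ℕ → ℕ} (h : ImplFam₂ c F) (e : c'.Extends c π) :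
    ImplFam₂ c' fun x => F (π x) :=
  fun _ c'' π' k l e' hk hl => h c'' (fun x => π (π' x)) k l (e'.trans e) hk hl

theorem ImplFam₂.apply {F : Γ → ℕ → ℕ → ℕ} (h : ImplFam₂ c F) {k l : Γ → ℕ} (hk : Impl c k)
    (hl : Impl c l) : Impl c fun γ => F γ (k γ) (l γ) :=
  h c id k l ⟨fun _ => rfl, fun _ => rfl, fun _ => id⟩ hk hl

/-- The numerical configurations `x γ` can be computed in space `O(space)`. -/
structure ImplCfg (c : Ctx t Γ) (x : Γ → NumCfg) : Prop where
  state : Impl c fun γ => (x γ).state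
  tapes : Impl c fun γ => (x γ).tapes
  heads : Impl c fun γ => (x γ).heads

theorem ImplCfg.comp {x : Γ → NumCfg} (h : ImplCfg c x) (e : c'.Extends c π) :
    ImplCfg c' fun y => x (π y) :=
  ⟨h.state.comp e, h.tapes.comp e, h.heads.comp e⟩

theorem ImplCfg.ite {p : Γ → Prop} [DecidablePred p] {x y : Γ → NumCfg} (hp : ImplPred c p)
    (hx : ImplCfg c x) (hy : ImplCfg c y) : ImplCfg c fun γ => if p γ then x γ else y γ where
  state := (Impl.ite hp hx.state hy.state).congr fun _ => apply_ite _ _ _ _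
  tapes := (Impl.ite hp hx.tapes hy.tapes).congr fun _ => apply_ite _ _ _ _
  heads := (Impl.ite hp hx.heads hy.heads).congr fun _ => apply_ite _ _ _ _

namespace NumMachine

/-- The data of the machines `S γ`, with `n` input tapes, can be computed in space `O(space)`, and
their configurations fit into this space. -/
structure Implementable (c : Ctx t Γ) (n : ℕ) (S : Γ → NumMachine) : Prop where
  k : Impl c fun γ => (S γ).k
  base : Impl c fun γ => (S γ).base
  table : Impl c fun γ => (S γ).table
  width : Impl c fun γ => (S γ).width
  range : Impl c fun γ => (S γ).range
  read : ImplFam₂ c fun γ => (S γ).read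
  read_le : ∀ γ j p, (S γ).read j p ≤ 2
  half_width_lt : ∀ γ, (S γ).width / 2 < (S γ).range
  bdd_scanned : Bdd c fun γ => 3 ^ (n + (S γ).k)
  bdd_tapes : Bdd c fun γ => 3 ^ ((S γ).k * (S γ).width)
  bdd_heads : Bdd c fun γ => (S γ).range ^ (n + (S γ).k)

section Run

variable (S : NumMachine) (t : ℕ) (g : ℕ → ℕ → ℕ) (a₀ : ℕ)

theorem run_succ_fst (m : ℕ) : (S.run t g a₀ (m + 1)).1 =
    if S.entry t (S.run t g a₀ m).1 0 = 0 then (S.run t g a₀ m).1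
    else S.succ t (S.run t g a₀ m).1 := by
  rw [run]
  split_ifs <;> rfl

theorem run_succ_snd (m : ℕ) : (S.run t g a₀ (m + 1)).2 =
    if S.entry t (S.run t g a₀ m).1 0 = 0 then (S.run t g a₀ m).2
    else if S.entry t (S.run t g a₀ m).1 1 = 0 then (S.run t g a₀ m).2
    else g (S.run t g a₀ m).2 (S.entry t (S.run t g a₀ m).1 1 - 1) := by
  rw [run]
  split_ifs <;> rfl

variable {S t g a₀}

theorem run_fst_induction {p : NumCfg → Prop} (h0 : p (S.start t))
    (hsucc : ∀ x, p (S.succ t x)) (m : ℕ) : p (S.run t g a₀ m).1 := by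
  induction m with
  | zero => exact h0
  | succ m ih =>
    rw [run_succ_fst]
    split_ifs
    exacts [ih, hsucc _]

theorem run_snd_le {Z : ℕ} (hg : ∀ a b, g a b ≤ Z) (m : ℕ) :
    (S.run t g a₀ m).2 ≤ a₀ + Z := by
  induction m with
  | zero => exact Nat.le_add_right _ _
  | succ m ih =>
    rw [run_succ_snd]
    split_ifs
    exacts [ih, ih, (hg _ _).trans (Nat.le_add_left _ _)]

theorem run_state_le (m : ℕ) : (S.run t g a₀ m).1.state ≤ S.table :=
  run_fst_induction (p := fun x => x.state ≤ S.table) (digit_le _ _ _)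
    (fun _ => (Nat.sub_le _ _).trans (digit_le _ _ _)) m

theorem newCell_lt (x : NumCfg) (z : ℕ) : S.newCell t x z < 3 := by
  rw [newCell]
  split_ifs
  · omega
  · exact Nat.mod_lt _ (by norm_num)

theorem run_tapes_le (m : ℕ) : (S.run t g a₀ m).1.tapes ≤ 3 ^ (S.k * S.width) :=
  run_fst_induction (p := fun x => x.tapes ≤ 3 ^ (S.k * S.width)) (Nat.zero_le _)
    (fun _ => (ofDigits_lt fun _ _ => newCell_lt _ _).le) m

theorem newPos_lt (hS : 0 < S.range) (x : NumCfg) (h : ℕ) : S.newPos t x h < S.range := by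
  rw [newPos]
  omega

theorem startPos_lt (hS : S.width / 2 < S.range) (h : ℕ) :
    (if h < t then 0 else S.width / 2) < S.range := by
  split_ifs <;> omega

theorem run_heads_le (hS : S.width / 2 < S.range) (m : ℕ) :
    (S.run t g a₀ m).1.heads ≤ S.range ^ (t + S.k) :=
  run_fst_induction (p := fun x => x.heads ≤ S.range ^ (t + S.k))
    (ofDigits_lt fun h _ => startPos_lt hS h).le
    (fun _ => (ofDigits_lt fun _ _ => newPos_lt (Nat.zero_lt_of_lt hS) _ _).le) m

end Run

namespace Implementable

variable {S : Γ → NumMachine} {x : Γ → NumCfg} {h : Γ → ℕ}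

theorem comp (hS : Implementable c n S) (e : c'.Extends c π) :
    Implementable c' n fun x => S (π x) where
  k := hS.k.comp e
  base := hS.base.comp e
  table := hS.table.comp e
  width := hS.width.comp e
  range := hS.range.comp e
  read := hS.read.comp e
  read_le := fun _ => hS.read_le _
  half_width_lt := fun _ => hS.half_width_lt _
  bdd_scanned := hS.bdd_scanned.comp e
  bdd_tapes := hS.bdd_tapes.comp e
  bdd_heads := hS.bdd_heads.comp e

theorem headPos (hS : Implementable c n S) (hx : ImplCfg c x) (hh : Impl c h) :
    Impl c fun γ => (S γ).headPos (x γ) (h γ) :=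
  hS.range.digit hx.heads hh

theorem scanned (hS : Implementable c n S) (hx : ImplCfg c x) (hh : Impl c h) :
    Impl c fun γ => (S γ).scanned n (x γ) (h γ) :=
  .ite (hh.lt (.const n)) (hS.read.apply hh (hS.headPos hx hh))
    ((Impl.const 3).digit hx.tapes
      (((hh.sub (.const n)).mul hS.width).add (hS.headPos hx hh)))

theorem scanned_lt (hS : Implementable c n S) (γ : Γ) (y : NumCfg) (a : ℕ) :
    (S γ).scanned n y a < 3 := by
  rw [NumMachine.scanned]
  split_ifs
  · exact Nat.lt_succ_of_le (hS.read_le _ _ _)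
  · exact Nat.mod_lt _ (by norm_num)

theorem row (hS : Implementable c n S) (hx : ImplCfg c x) :
    Impl c fun γ => (S γ).row n (x γ) :=
  (hx.state.mul ((Impl.const 3).pow ((Impl.const n).add hS.k) hS.bdd_scanned)).add
    (.ofDigits (.const 3) ((Impl.const n).add hS.k)
      (fun _ _ _ _ e hk _ => (hS.comp e).scanned (hx.comp e) hk)
      (fun γ _ _ => hS.scanned_lt γ _ _) hS.bdd_scanned)

theorem entry (hS : Implementable c n S) (hx : ImplCfg c x) (hh : Impl c h) :
    Impl c fun γ => (S γ).entry n (x γ) (h γ) :=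
  hS.base.digit hS.table (((hS.row hx).mul
    (((Impl.const 2).mul ((Impl.const n).add hS.k)).add (.const 2))).add hh).succ

theorem newPos (hS : Implementable c n S) (hx : ImplCfg c x) (hh : Impl c h) :
    Impl c fun γ => (S γ).newPos n (x γ) (h γ) := by
  have hp := hS.headPos hx hh
  have hmove := hS.entry hx (((Impl.const 2).mul hh).add (.const 2))
  have hstuck := (hh.lt (.const n)).and
    (((Impl.const 0).lt hp).and ((hS.read.apply hh hp).eq (.const 0)))
  exact .min (.ite (hmove.eq (.const 1)) hp.pred
    (.ite (hmove.eq (.const 2)) (.ite hstuck hp hp.succ) hp)) hS.range.pred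

theorem newCell (hS : Implementable c n S) (hx : ImplCfg c x) (hh : Impl c h) :
    Impl c fun γ => (S γ).newCell n (x γ) (h γ) := by
  have hhead := (Impl.const n).add (hh.div hS.width)
  exact .ite ((hh.mod hS.width).eq (hS.headPos hx hhead))
    (.min (hS.entry hx (((Impl.const 2).mul hhead).add (.const 3))) (.const 2))
    ((Impl.const 3).digit hx.tapes hh)

theorem succ (hS : Implementable c n S) (hx : ImplCfg c x) :
    ImplCfg c fun γ => (S γ).succ n (x γ) where
  state := (hS.entry hx (.const 0)).pred
  tapes := .ofDigits (.const 3) (hS.k.mul hS.width)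
    (fun _ _ _ _ e hk _ => (hS.comp e).newCell (hx.comp e) hk) (fun _ _ _ => newCell_lt _ _)
    hS.bdd_tapes
  heads := .ofDigits hS.range ((Impl.const n).add hS.k)
    (fun _ _ _ _ e hk _ => (hS.comp e).newPos (hx.comp e) hk)
    (fun γ _ _ => newPos_lt (Nat.zero_lt_of_lt (hS.half_width_lt γ)) _ _) hS.bdd_heads

theorem start (hS : Implementable c n S) : ImplCfg c fun γ => (S γ).start n where
  state := hS.base.digit hS.table (.const 0)
  tapes := .zero
  heads := .ofDigits hS.range ((Impl.const n).add hS.k)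
    (fun _ _ _ _ e hk _ => .ite (hk.lt (.const n)) .zero ((hS.width.comp e).div (.const 2)))
    (fun γ _ _ => startPos_lt (hS.half_width_lt γ) _) hS.bdd_heads

theorem steps (hS : Implementable c n S) : Impl c fun γ => (S γ).steps n :=
  (hS.base.mul ((Impl.const 3).pow (hS.k.mul hS.width) hS.bdd_tapes)).mul
    (hS.range.pow ((Impl.const n).add hS.k) hS.bdd_heads)

variable {g : Γ → ℕ → ℕ → ℕ} {a₀ Z : Γ → ℕ} {m : Γ → ℕ}

theorem run_succ_fst (hS : Implementable c n S)
    (hx : ImplCfg c fun γ => ((S γ).run n (g γ) (a₀ γ) (m γ)).1) :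
    ImplCfg c fun γ => ((S γ).run n (g γ) (a₀ γ) (m γ + 1)).1 := by
  simp only [NumMachine.run_succ_fst]
  exact .ite ((hS.entry hx (.const 0)).eq (.const 0)) hx (hS.succ hx)

theorem run_succ_snd (hS : Implementable c n S) (hg : ImplFam₂ c g)
    (hx : ImplCfg c fun γ => ((S γ).run n (g γ) (a₀ γ) (m γ)).1)
    (ha : Impl c fun γ => ((S γ).run n (g γ) (a₀ γ) (m γ)).2) :
    Impl c fun γ => ((S γ).run n (g γ) (a₀ γ) (m γ + 1)).2 := by
  have hemit := hS.entry hx (.const 1)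
  simp only [NumMachine.run_succ_snd]
  exact .ite ((hS.entry hx (.const 0)).eq (.const 0)) ha
    (.ite (hemit.eq (.const 0)) ha (hg.apply ha hemit.pred))

theorem fold (hS : Implementable c n S) (hg : ImplFam₂ c g) (ha : Impl c a₀) (hZ : Bdd c Z)
    (hgZ : ∀ γ a b, g γ a b ≤ Z γ) : Impl c fun γ => (S γ).fold n (g γ) (a₀ γ) := by
  let F : ℕ → Γ → ℕ → ℕ
    | 0, γ, m => ((S γ).run n (g γ) (a₀ γ) m).1.state
    | 1, γ, m => ((S γ).run n (g γ) (a₀ γ) m).1.tapes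
    | 2, γ, m => ((S γ).run n (g γ) (a₀ γ) m).1.heads
    | _, γ, m => ((S γ).run n (g γ) (a₀ γ) m).2
  refine Impl.for (F := F) (n := 4) hS.steps ?_ ?_ ?_ 3 (by omega)
  · have h := hS.start
    rintro (_ | _ | _ | _) -
    exacts [h.state, h.tapes, h.heads, ha]
  · intro Γ' c' π m e _ _ hF
    have hx : ImplCfg c' fun x => ((S (π x)).run n (g (π x)) (a₀ (π x)) (m x)).1 :=
      ⟨hF 0 (by omega), hF 1 (by omega), hF 2 (by omega)⟩
    have hx' := (hS.comp e).run_succ_fst hx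
    rintro (_ | _ | _ | _) -
    exacts [hx'.state, hx'.tapes, hx'.heads,
      (hS.comp e).run_succ_snd (hg.comp e) hx (hF 3 (by omega))]
  · rintro (_ | _ | _ | _) -
    · exact hS.table.bdd.upTo fun _ _ _ => run_state_le _
    · exact hS.bdd_tapes.upTo fun _ _ _ => run_tapes_le _
    · exact hS.bdd_heads.upTo fun γ _ _ => run_heads_le (hS.half_width_lt γ) _
    · exact (ha.bdd.add hZ).upTo fun γ _ _ => run_snd_le (hgZ γ) _

end Implementable

end NumMachine

end NumericalSimulation

/-! ### Automata and their encodings -/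

section Bits

/-- The bit of a string at a position, as a number; `0` beyond the end. -/
def bitAt (l : List Bool) (j : ℕ) : ℕ := (l.getD j false).toNat

theorem bitAt_le_one (l : List Bool) (j : ℕ) : bitAt l j ≤ 1 := Bool.toNat_le _

theorem bitAt_ofFn {n : ℕ} (x : Fin n → Bool) {j : ℕ} (hj : j < n) :
    bitAt (List.ofFn x) j = (x ⟨j, hj⟩).toNat := by
  rw [bitAt, List.getD_eq_getElem _ _ (by simpa using hj), List.getElem_ofFn]

theorem bitAt_append_left {l l' : List Bool} {j : ℕ} (h : j < l.length) :
    bitAt (l ++ l') j = bitAt l j := by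
  rw [bitAt, bitAt, List.getD_append _ _ _ _ h]

theorem bitAt_append_right {l l' : List Bool} (j : ℕ) :
    bitAt (l ++ l') (l.length + j) = bitAt l' j := by
  rw [bitAt, bitAt, List.getD_append_right _ _ _ _ (Nat.le_add_right _ _), Nat.add_sub_cancel_left]

theorem eq_map_range_bitAt (l : List Bool) :
    l = (List.range l.length).map fun k => decide (bitAt l k ≠ 0) := by
  refine List.ext_getElem (by simp) fun j h _ => ?_
  simp only [List.getElem_map, List.getElem_range, bitAt, List.getD_eq_getElem _ _ h]
  cases l[j] <;> simp

theorem toNat_testBit (n j : ℕ) : (n.testBit j).toNat = digit 2 n j := by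
  rw [Nat.testBit_eq_decide_div_mod_eq, digit]
  rcases Nat.mod_two_eq_zero_or_one (n / 2 ^ j) with h | h <;> simp [h]

theorem bitAt_bits (n j : ℕ) : bitAt n.bits j = digit 2 n j := by
  rw [← toNat_testBit, Nat.testBit_eq_inth, bitAt]
  rfl

theorem symbolCode_readInput_succ (l : List Bool) (j : ℕ) :
    symbolCode (OfflineTM.readInput l (j + 1)) = if j < l.length then bitAt l j + 1 else 0 := by
  simp only [OfflineTM.readInput, bitAt]
  split_ifs with h
  · rw [List.getElem?_eq_getElem h, List.getD_eq_getElem _ _ h]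
    cases l[j] <;> rfl
  · rw [List.getElem?_eq_none (not_lt.1 h)]
    rfl

theorem symbolCode_readInput_succ_sub_one (l : List Bool) (j : ℕ) :
    symbolCode (OfflineTM.readInput l (j + 1)) - 1 = bitAt l j := by
  rw [symbolCode_readInput_succ]
  split_ifs with h
  · rfl
  · rw [bitAt, List.getD_eq_default _ _ (not_lt.1 h)]
    rfl

/-- The codes of the symbols on an input tape that holds `n` bits given as numbers. -/
def virtualTape (n : ℕ) (bit : ℕ → ℕ) (p : ℕ) : ℕ := if 0 < p ∧ p ≤ n then bit (p - 1) + 1 else 0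

theorem virtualTape_eq {l : List Bool} {n : ℕ} {bit : ℕ → ℕ} (hl : l.length = n)
    (h : ∀ j < n, bit j = bitAt l j) (p : ℕ) :
    virtualTape n bit p = symbolCode (OfflineTM.readInput l p) := by
  rcases p with _ | p
  · simp [virtualTape, OfflineTM.readInput, symbolCode]
  · rw [symbolCode_readInput_succ, virtualTape, hl]
    by_cases hp : p < n
    · rw [if_pos ⟨p.succ_pos, hp⟩, if_pos hp, Nat.add_sub_cancel, h p hp]
    · rw [if_neg (by omega), if_neg hp]

/-- The number written in the `n` bits from position `off` on, the least significant bit first. -/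
def numAt (bit : ℕ → ℕ) (off n : ℕ) : ℕ := ofDigits 2 n fun j => bit (off + j)

theorem numAt_lt {bit : ℕ → ℕ} (h : ∀ j, bit j ≤ 1) (off n : ℕ) : numAt bit off n < 2 ^ n :=
  ofDigits_lt fun _ _ => Nat.lt_succ_of_le (h _)

theorem ofDigits_digit_two (n s : ℕ) : ofDigits 2 s (digit 2 n) = n % 2 ^ s := by
  induction s with
  | zero => simp [ofDigits, Nat.mod_one]
  | succ s ih =>
    rw [ofDigits, Finset.sum_range_succ, ← ofDigits, ih, Nat.mod_pow_succ, digit, mul_comm]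

theorem numAt_eq {bit : ℕ → ℕ} {off s n : ℕ} (hn : n < 2 ^ s)
    (h : ∀ j < s, bit (off + j) = digit 2 n j) : numAt bit off s = n := by
  rw [numAt, ofDigits_congr h, ofDigits_digit_two, Nat.mod_eq_of_lt hn]

end Bits

section Encodings

variable {w : ℕ}

@[simp] theorem length_encState (q : Fin w) : (encState q).length = w.size := by simp [encState]

theorem bitAt_encState (q : Fin w) {j : ℕ} (hj : j < w.size) :
    bitAt (encState q) j = digit 2 q j := by
  rw [encState, bitAt_ofFn _ hj, toNat_testBit]

theorem val_lt_two_pow_size (q : Fin w) : q.val < 2 ^ w.size := q.2.trans (Nat.lt_size_self w)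

theorem getElem?_flatMap_of_length_eq {α β : Type*} {f : α → List β} {n : ℕ}
    (hf : ∀ a, (f a).length = n) (l : List α) (i : ℕ) {j : ℕ} (hj : j < n) :
    (l.flatMap f)[i * n + j]? = l[i]?.bind fun a => (f a)[j]? := by
  induction l generalizing i with
  | nil => simp
  | cons a l ih =>
    rw [List.flatMap_cons]
    rcases i with _ | i
    · rw [zero_mul, zero_add, List.getElem?_append_left (by rwa [hf])]
      rfl
    · have hsub : (i + 1) * n + j - n = i * n + j := by
        rw [add_mul]
        omega
      rw [List.getElem?_append_right (by rw [hf, add_mul]; omega), hf, hsub, ih]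
      rfl

theorem length_encAutomaton (Q : Automaton w) : (encAutomaton Q).length = 2 * w * w.size := by
  simp only [encAutomaton, List.length_flatMap, List.length_append, length_encState,
    List.map_const', List.length_finRange, List.sum_replicate, smul_eq_mul]
  ring

theorem bitAt_encAutomaton (Q : Automaton w) (i : Fin w) (b : Bool) {j : ℕ} (hj : j < w.size) :
    bitAt (encAutomaton Q) ((2 * i + b.toNat) * w.size + j) = digit 2 (Q i b) j := by
  have hpos : (2 * i.val + b.toNat) * w.size + j =
      i * (w.size + w.size) + (b.toNat * w.size + j) := by ring
  rw [bitAt, List.getD_eq_getElem?_getD, hpos, encAutomaton,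
    getElem?_flatMap_of_length_eq (n := w.size + w.size) (by simp)]
  · rw [List.getElem?_eq_getElem (by simp), List.getElem_finRange]
    simp only [Option.bind_some, Fin.cast_mk, Fin.eta]
    rw [← bitAt_encState _ hj, bitAt, List.getD_eq_getElem?_getD]
    cases b
    · simp only [Bool.toNat_false, zero_mul, zero_add]
      rw [List.getElem?_append_left (by rwa [length_encState])]
    · simp only [Bool.toNat_true, one_mul]
      rw [List.getElem?_append_right (by simp), length_encState, Nat.add_sub_cancel_left]
  · cases b <;> simp <;> omega

/-- The next state from state `q` on bit `b` according to an encoded transition table whose bits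
are given as numbers, where `n` is the length of the encoding of a state. -/
def nextAt (bit : ℕ → ℕ) (n q b : ℕ) : ℕ := numAt bit ((2 * q + b) * n) n

theorem nextAt_eq {bit : ℕ → ℕ} {Q : Automaton w}
    (h : ∀ j < 2 * w * w.size, bit j = bitAt (encAutomaton Q) j) (q : Fin w) (b : Bool) :
    nextAt bit w.size q b.toNat = Q q b := by
  refine numAt_eq (val_lt_two_pow_size _) fun j hj => ?_
  have hentry : 2 * q.val + b.toNat < 2 * w := by
    have := Bool.toNat_le b
    omega
  rw [h _ (mul_add_lt_mul hentry hj), bitAt_encAutomaton _ _ _ hj]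

theorem foldl_nextAt {bit : ℕ → ℕ} {Q : Automaton w}
    (h : ∀ j < 2 * w * w.size, bit j = bitAt (encAutomaton Q) j) (q : Fin w) (l : List Bool) :
    l.foldl (fun a b => nextAt bit w.size a b.toNat) q = l.foldl Q q := by
  induction l generalizing q with
  | nil => rfl
  | cons b l ih => rw [List.foldl_cons, List.foldl_cons, nextAt_eq h, ih]

/-- The encoding of an automaton with a state. -/
def encPointed (p : Pointed w) : List Bool := encAutomaton p.1 ++ encState p.2

theorem length_encPointed (p : Pointed w) : (encPointed p).length = (2 * w + 1) * w.size := by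
  rw [encPointed, List.length_append, length_encAutomaton, length_encState]
  ring

theorem bitAt_encPointed_left (p : Pointed w) {j : ℕ} (hj : j < 2 * w * w.size) :
    bitAt (encPointed p) j = bitAt (encAutomaton p.1) j :=
  bitAt_append_left (by rwa [length_encAutomaton])

theorem bitAt_encPointed_right (p : Pointed w) (j : ℕ) :
    bitAt (encPointed p) (2 * w * w.size + j) = bitAt (encState p.2) j := by
  rw [encPointed, ← length_encAutomaton p.1]
  exact bitAt_append_right j

end Encodings

section OutputBit

/-- A fold step that counts bits up to `j` and then records the next bit `b` as `j + 1 + b`. -/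
def pickStep (j a b : ℕ) : ℕ :=
  if a < j then a + 1 else if a = j then j + 1 + min b 1 else min a (j + 2)

theorem pickStep_le (j a b : ℕ) : pickStep j a b ≤ j + 2 := by
  rw [pickStep]
  split_ifs <;> omega

theorem foldl_pickStep_of_lt (j : ℕ) (l : List Bool) {a : ℕ} (ha : j < a) (ha' : a ≤ j + 2) :
    l.foldl (fun a b => pickStep j a b.toNat) a = a := by
  induction l with
  | nil => rfl
  | cons b l ih =>
    rw [List.foldl_cons, pickStep, if_neg (by omega), if_neg (by omega), min_eq_left ha', ih]

theorem foldl_pickStep {j : ℕ} {l : List Bool} {a : ℕ} (ha : a ≤ j) (hl : j - a < l.length) :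
    l.foldl (fun a b => pickStep j a b.toNat) a = j + 1 + bitAt l (j - a) := by
  induction l generalizing a with
  | nil => simp at hl
  | cons b l ih =>
    rw [List.length_cons] at hl
    rw [List.foldl_cons, pickStep]
    rcases ha.lt_or_eq with h | rfl
    · rw [if_pos h, ih h (by omega)]
      obtain ⟨m, rfl⟩ := Nat.exists_eq_add_of_lt h
      rw [show a + m + 1 - (a + 1) = m by omega, show a + m + 1 - a = m + 1 by omega]
      rfl
    · have hb := Bool.toNat_le b
      rw [if_neg (lt_irrefl a), if_pos rfl, min_eq_left hb,
        foldl_pickStep_of_lt _ _ (by omega) (by omega), Nat.sub_self]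
      rfl

/-- The bit at position `j` of the output of a machine. -/
def NumMachine.outBit (S : NumMachine) (t j : ℕ) : ℕ :=
  min (S.fold t (pickStep j) 0 - (j + 1)) 1

theorem NumMachine.outBit_le_one (S : NumMachine) (t j : ℕ) : S.outBit t j ≤ 1 := min_le_right _ _

theorem OfflineTM.OutputsInSpace.outBit_eq {t : ℕ} {M : OfflineTM t} {inp : Fin t → List Bool}
    {L : ℕ} {S : NumMachine} {o : List Bool} (h : M.OutputsInSpace inp o L)
    (hS : M.RepresentedBy inp L S) {j : ℕ} (hj : j < o.length) : S.outBit t j = bitAt o j := by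
  rw [NumMachine.outBit, h.fold_eq hS, foldl_pickStep j.zero_le hj, Nat.sub_zero,
    Nat.add_sub_cancel_left, min_eq_left (bitAt_le_one o j)]

end OutputBit

section Impl

variable {t n : ℕ} {Γ : Type} {c : Ctx t Γ} {f g : Γ → ℕ} {bit : Γ → ℕ → ℕ}

theorem Impl.size (j : Fin t) {w : Γ → ℕ} (hin : ∀ γ, c.inp γ j = (w γ).bits)
    (hB : Bdd c fun γ => 2 ^ (w γ).size) : Impl c fun γ => (w γ).size := by
  have hlen (γ : Γ) : (w γ).size = (c.inp γ j).length := by rw [hin, Nat.size_eq_bits_len]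
  simp only [hlen] at hB ⊢
  exact .inputLength j (hB.mono fun γ => Nat.lt_two_pow_self.le)

theorem Impl.bitAt (j : Fin t) (hf : Impl c f) : Impl c fun γ => bitAt (c.inp γ j) (f γ) :=
  (hf.succ.read j).pred.congr fun _ => (symbolCode_readInput_succ_sub_one _ _).symm

theorem Impl.ofBits (j : Fin t) {w : Γ → ℕ} (hin : ∀ γ, c.inp γ j = (w γ).bits)
    (hB : Bdd c fun γ => 2 ^ (w γ).size) : Impl c w := by
  refine (Impl.ofDigits (.const 2) (.size j hin hB)
    (F := fun γ => SpaceDerand.bitAt (c.inp γ j)) (fun _ c' π k e hk _ => ?_)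
    (fun γ k _ => Nat.lt_succ_of_le (bitAt_le_one _ _)) hB).congr fun γ => ?_
  · exact (hk.bitAt j).congr fun x => by rw [e.inp]
  · have hbits : SpaceDerand.bitAt (w γ).bits = SpaceDerand.digit 2 (w γ) := funext (bitAt_bits _)
    rw [hin, hbits, ofDigits_digit_two, Nat.mod_eq_of_lt (Nat.lt_size_self _)]

theorem ImplFam.comp {P : Γ → ℕ → Prop} {F : Γ → ℕ → ℕ} (h : ImplFam c P F) {Γ' : Type}
    {c' : Ctx t Γ'} {π : Γ' → Γ} (e : c'.Extends c π) :
    ImplFam c' (fun x => P (π x)) fun x => F (π x) :=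
  fun _ c'' π' k e' hk hP => h c'' (fun x => π (π' x)) k (e'.trans e) hk hP

/-- `F γ k` can be computed from `γ` and `k` in space `O(space)`, for all `k`. -/
abbrev ImplFam₁ (c : Ctx t Γ) (F : Γ → ℕ → ℕ) : Prop := ImplFam c (fun _ _ => True) F

theorem ImplFam₁.apply {F : Γ → ℕ → ℕ} (h : ImplFam₁ c F) (hf : Impl c f) :
    Impl c fun γ => F γ (f γ) :=
  h c id f ⟨fun _ => rfl, fun _ => rfl, fun _ => id⟩ hf fun _ => trivial

theorem Impl.virtualTape (hn : Impl c f) (hbit : ImplFam₁ c bit) (hp : Impl c g) :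
    Impl c fun γ => virtualTape (f γ) (bit γ) (g γ) :=
  .ite (((Impl.const 0).lt hp).and (hp.le hn)) (ImplFam₁.apply hbit hp.pred).succ .zero

theorem Impl.numAt (hbit : ImplFam₁ c bit) (hle : ∀ γ j, bit γ j ≤ 1) (hf : Impl c f)
    (hg : Impl c g) (hB : Bdd c fun γ => 2 ^ g γ) :
    Impl c fun γ => numAt (bit γ) (f γ) (g γ) :=
  .ofDigits (.const 2) hg
    (fun _ _ _ _ e hk _ => ImplFam₁.apply (hbit.comp e) ((hf.comp e).add hk))
    (fun γ _ _ => Nat.lt_succ_of_le (hle γ _)) hB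

theorem ImplFam₂.nextAt (hbit : ImplFam₁ c bit) (hle : ∀ γ j, bit γ j ≤ 1)
    (hg : Impl c g) (hB : Bdd c fun γ => 2 ^ g γ) :
    ImplFam₂ c fun γ => nextAt (bit γ) (g γ) :=
  fun _ _ _ _ _ e hk hl => .numAt (hbit.comp e) (fun _ => hle _)
    ((((Impl.const 2).mul hk).add hl).mul (hg.comp e)) (hg.comp e) (hB.comp e)

theorem ImplFam₂.pickStep (hf : Impl c f) : ImplFam₂ c fun γ => pickStep (f γ) :=
  fun _ _ _ _ _ e hk hl => .ite (hk.lt (hf.comp e)) hk.succ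
    (.ite (hk.eq (hf.comp e)) ((hf.comp e).succ.add (hl.min (.const 1)))
      (hk.min ((hf.comp e).add (.const 2))))

theorem NumMachine.Implementable.outBit {S : Γ → NumMachine}
    (hS : NumMachine.Implementable c n S) (hf : Impl c f) :
    Impl c fun γ => (S γ).outBit n (f γ) :=
  ((hS.fold (.pickStep hf) .zero (hf.bdd.add (.const 2)) fun _ => pickStep_le _).sub hf.succ).min
    (.const 1)

end Impl

section OnesAutomaton

/-- The automaton that counts the ones at the end of its input, up to `w - 1`. -/
def onesAutomaton (w : ℕ+) : Pointed w :=
  (fun q b => if b then ⟨min (q.val + 1) ((w : ℕ) - 1), by have := w.pos; omega⟩ else ⟨0, w.pos⟩,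
    ⟨0, w.pos⟩)

/-- The bit at position `j` of the encoding of `onesAutomaton w`, where `n` is the length of the
encoding of a state. -/
def onesBit (w n j : ℕ) : ℕ :=
  if j < 2 * w * n ∧ j / n % 2 = 1 then digit 2 (min (j / n / 2 + 1) (w - 1)) (j % n) else 0

theorem onesBit_le_one (w n j : ℕ) : onesBit w n j ≤ 1 := by
  rw [onesBit]
  split_ifs
  · exact Nat.le_of_lt_succ (Nat.mod_lt _ (by norm_num))
  · exact zero_le_one

theorem digit_zero (B j : ℕ) : digit B 0 j = 0 := by simp [digit]

theorem onesBit_eq_encAutomaton (w : ℕ+) {j : ℕ} (hj : j < 2 * (w : ℕ) * (w : ℕ).size) :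
    onesBit w (w : ℕ).size j = bitAt (encAutomaton (onesAutomaton w).1) j := by
  have hsize : 0 < (w : ℕ).size := Nat.size_pos.2 w.pos
  have hdiv : j / (w : ℕ).size < 2 * w := (Nat.div_lt_iff_lt_mul hsize).2 hj
  have hentry (b : Bool) (hb : j / (w : ℕ).size % 2 = b.toNat) :
      bitAt (encAutomaton (onesAutomaton w).1) j =
        digit 2 ((onesAutomaton w).1 ⟨j / (w : ℕ).size / 2, by omega⟩ b) (j % (w : ℕ).size) := by
    rw [← bitAt_encAutomaton _ _ _ (Nat.mod_lt j hsize), ← hb, Nat.div_add_mod, mul_comm,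
      Nat.div_add_mod]
  rw [onesBit]
  rcases Nat.mod_two_eq_zero_or_one (j / (w : ℕ).size) with hb | hb
  · rw [if_neg (by omega), hentry false hb]
    simp [onesAutomaton, digit_zero]
  · rw [if_pos ⟨hj, hb⟩, hentry true hb]
    simp [onesAutomaton]

theorem onesBit_eq (w : ℕ+) {j : ℕ} (hj : j < (2 * (w : ℕ) + 1) * (w : ℕ).size) :
    onesBit w (w : ℕ).size j = bitAt (encPointed (onesAutomaton w)) j := by
  rcases lt_or_ge j (2 * (w : ℕ) * (w : ℕ).size) with h | h
  · rw [bitAt_encPointed_left _ h, onesBit_eq_encAutomaton w h]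
  · obtain ⟨k, rfl⟩ := Nat.exists_eq_add_of_le h
    rw [add_mul, one_mul, Nat.add_lt_add_iff_left] at hj
    rw [onesBit, if_neg (by omega), bitAt_encPointed_right, bitAt_encState _ hj]
    simp [onesAutomaton, digit_zero]

theorem Impl.onesBit {t : ℕ} {Γ : Type} {c : Ctx t Γ} {w n j : Γ → ℕ} (hw : Impl c w)
    (hn : Impl c n) (hj : Impl c j) : Impl c fun γ => onesBit (w γ) (n γ) (j γ) :=
  .ite ((hj.lt (((Impl.const 2).mul hw).mul hn)).and (((hj.div hn).mod (.const 2)).eq (.const 1)))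
    ((Impl.const 2).digit (((hj.div hn).div (.const 2)).succ.min hw.pred) (hj.mod hn)) .zero

theorem isUniformSequence_onesAutomaton : IsUniformSequence onesAutomaton := by
  let c : Ctx 1 ℕ+ := ⟨fun w => ![Nat.bits w], fun w => Nat.log 2 w, ∅⟩
  have hB : Bdd c fun w => 2 ^ (w : ℕ).size := ⟨1, fun w => by
    rw [one_mul]
    exact Nat.pow_le_pow_right two_pos
      (Nat.size_le.2 (Nat.lt_pow_succ_log_self one_lt_two _))⟩
  have hsize := Impl.size (c := c) 0 (fun _ => rfl) hB
  have hw := Impl.ofBits (c := c) 0 (fun _ => rfl) hB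
  refine Impl.computable (len := fun w : ℕ+ => (2 * (w : ℕ) + 1) * (w : ℕ).size)
    (bit := fun w j => onesBit w (w : ℕ).size j) ((((Impl.const 2).mul hw).succ).mul hsize)
    (fun _ c' π k e hk _ => .onesBit (hw.comp e) (hsize.comp e) hk) fun w => ?_
  rw [← encPointed, eq_map_range_bitAt (encPointed (onesAutomaton w)), length_encPointed]
  refine List.map_congr_left fun k hk => ?_
  rw [onesBit_eq w (List.mem_range.1 hk)]

end OnesAutomaton

/-! ### Distributions -/

section Counting

theorem card_filter_append {α : Type*} [Fintype α] {m n : ℕ} (P : (Fin m → α) → Prop)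
    (Q : (Fin n → α) → Prop) [DecidablePred P] [DecidablePred Q] :
    (Finset.univ.filter fun x : Fin (m + n) → α =>
      P (fun i => x (Fin.castAdd n i)) ∧ Q fun i => x (Fin.natAdd m i)).card =
      (Finset.univ.filter P).card * (Finset.univ.filter Q).card := by
  rw [← Finset.card_product, ← Finset.filter_product, Finset.univ_product_univ]
  exact (Finset.card_equiv (Fin.appendEquiv m n) fun y => by simp [Fin.appendEquiv]).symm

theorem foldl_ofFn_succ {α β : Type*} (f : β → α → β) (b : β) {n : ℕ} (x : Fin (n + 1) → α) :
    (List.ofFn x).foldl f b =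
      f ((List.ofFn fun i : Fin n => x i.castSucc).foldl f b) (x (Fin.last n)) := by
  rw [List.ofFn_succ', List.concat_eq_append, List.foldl_append]
  rfl

theorem succ_le_onesAutomaton_fn (w : ℕ+) {m r : ℕ} (hr : r + 1 < w) (x : Bits (m + 1)) :
    r + 1 ≤ ((onesAutomaton w).fn (m + 1) x).val ↔
      r ≤ ((onesAutomaton w).fn m fun i => x i.castSucc).val ∧ x (Fin.last m) = true := by
  rw [Pointed.fn, foldl_ofFn_succ, ← Pointed.fn]
  cases x (Fin.last m) with
  | false => simp [onesAutomaton]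
  | true =>
    simp only [onesAutomaton, if_true, and_true]
    rw [← onesAutomaton]
    omega

theorem card_le_onesAutomaton_fn (w : ℕ+) {m r : ℕ} (hr : r < w) (hm : r ≤ m) :
    (Finset.univ.filter fun x : Bits m => r ≤ ((onesAutomaton w).fn m x).val).card =
      2 ^ (m - r) := by
  induction m generalizing r with
  | zero =>
    obtain rfl := Nat.le_zero.1 hm
    simp
  | succ m ih =>
    rcases r with _ | r
    · simp
    · simp only [succ_le_onesAutomaton_fn w hr]
      have hlast : (Finset.univ.filter fun z : Bits 1 => z 0 = true).card = 1 := by decide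
      refine (card_filter_append (n := 1) (fun x => r ≤ ((onesAutomaton w).fn m x).val)
        fun z => z 0 = true).trans ?_
      rw [ih (by omega) (by omega), Nat.add_sub_add_right, hlast, mul_one]

end Counting

section Law

theorem law_apply {n : ℕ} {α : Type} (f : Bits n → α) (E : Set α) [DecidablePred fun x => f x ∈ E] :
    ((law f).toOuterMeasure E).toReal =
      (Finset.univ.filter fun x => f x ∈ E).card / (2 : ℝ) ^ n := by
  classical
  rw [law, PMF.toOuterMeasure_map_apply, PMF.toOuterMeasure_uniformOfFintype_apply,
    ENNReal.toReal_div, ENNReal.toReal_natCast, Fintype.card_subtype]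
  congr 1
  · congr! 3
  · simp

theorem law_comp_castLE {m n : ℕ} (h : m ≤ n) {α : Type} (f : Bits m → α) :
    law (fun x : Bits n => f fun i => x (Fin.castLE h i)) = law f := by
  classical
  obtain ⟨k, rfl⟩ := Nat.exists_eq_add_of_le h
  ext a
  have hcard := card_filter_append (n := k) (fun x : Bits m => f x ∈ ({a} : Set α)) fun _ => True
  simp only [and_true, Finset.filter_true, Finset.card_univ, Fintype.card_pi_const,
    Fintype.card_bool] at hcard
  rw [← ENNReal.toReal_eq_toReal_iff' (PMF.apply_ne_top _ _) (PMF.apply_ne_top _ _),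
    ← PMF.toOuterMeasure_apply_singleton, ← PMF.toOuterMeasure_apply_singleton, law_apply,
    law_apply]
  refine (congrArg (fun N : ℕ => (N : ℝ) / 2 ^ (m + k)) hcard).trans ?_
  rw [pow_add, Nat.cast_mul, Nat.cast_pow, Nat.cast_ofNat, mul_div_mul_right _ _ (by positivity)]

theorem TVClose.refl {α : Type} {ε : ℝ} (hε : 0 ≤ ε) (p : PMF α) : TVClose ε p p := fun E => by
  rwa [sub_self, abs_zero]

/-- The probability that the automaton reaches `s + 1` is `2 ^ (-(s + 1))`, which is no multiple of
`2 ^ (-s)`. -/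
theorem half_pow_le_of_tvClose {w : ℕ+} {s m : ℕ} {ε : ℝ} (f : Bits s → Fin w)
    (hw : s + 1 < w) (hm : s < m)
    (h : TVClose ε (law f) (law ((onesAutomaton w).fn m))) : ((2 : ℝ) ^ (s + 1))⁻¹ ≤ ε := by
  classical
  have hdist := h {q | s + 1 ≤ q.val}
  rw [law_apply, law_apply] at hdist
  simp only [Set.mem_ofPred_eq] at hdist
  rw [card_le_onesAutomaton_fn w hw hm] at hdist
  set a := (Finset.univ.filter fun x : Bits s => s + 1 ≤ (f x).val).card
  have hones : ((2 ^ (m - (s + 1)) : ℕ) : ℝ) / 2 ^ m = ((2 : ℝ) ^ (s + 1))⁻¹ := by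
    rw [Nat.cast_pow, Nat.cast_ofNat, ← Nat.sub_add_cancel (Nat.succ_le_of_lt hm), pow_add]
    rw [Nat.add_sub_cancel]
    field_simp
  have hsub : (a : ℝ) / 2 ^ s - ((2 : ℝ) ^ (s + 1))⁻¹ = (2 * a - 1) * ((2 : ℝ) ^ (s + 1))⁻¹ := by
    rw [pow_succ]
    field_simp
  have hodd : (1 : ℝ) ≤ |2 * (a : ℝ) - 1| := by
    exact_mod_cast Int.one_le_abs (z := 2 * a - 1) (by omega)
  refine le_trans ?_ hdist
  rw [hones, hsub, abs_mul, abs_of_pos (a := ((2 : ℝ) ^ (s + 1))⁻¹) (by positivity)]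
  exact le_mul_of_one_le_left (by positivity) hodd

end Law

/-! ### The simulator -/

section Generator

variable {w : ℕ} {p : Pointed w} {code : ℕ → ℕ}

/-- `code` lists the bits of the encoding of `p` as numbers. -/
def Encodes (code : ℕ → ℕ) (p : Pointed w) : Prop :=
  ∀ j < (2 * w + 1) * w.size, code j = bitAt (encPointed p) j

theorem Encodes.table_eq (h : Encodes code p) {j : ℕ} (hj : j < 2 * w * w.size) :
    code j = bitAt (encAutomaton p.1) j := by
  rw [h j (by rw [add_mul]; omega), bitAt_encPointed_left _ hj]

theorem Encodes.state_eq (h : Encodes code p) {j : ℕ} (hj : j < w.size) :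
    code (2 * w * w.size + j) = bitAt (encState p.2) j := by
  rw [h _ (by rw [add_mul, one_mul]; omega), bitAt_encPointed_right]

/-- The start state of the automaton with `w` states whose encoding has the bits `code`. -/
def startState (w : ℕ) (code : ℕ → ℕ) : ℕ := numAt code (2 * w * w.size) w.size

theorem Encodes.startState_eq (h : Encodes code p) : startState w code = p.2 :=
  numAt_eq (val_lt_two_pow_size _) fun _ hj => (h.state_eq hj).trans (bitAt_encState _ hj)

/-- The input tapes of the given generator: the number `w` of states, an automaton and a state with
encoding `code`, and the bits `seed` of a string of length `s`. -/
def genTape (w s : ℕ) (code seed : ℕ → ℕ) (j p : ℕ) : ℕ :=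
  if j = 0 then virtualTape w.size (digit 2 w) p
  else if j = 1 then virtualTape (2 * w * w.size) code p
  else if j = 2 then virtualTape w.size (fun i => code (2 * w * w.size + i)) p
  else virtualTape s seed p

/-- The machine `M` for the given generator, running in space `C * (s + 1)` on the tapes
`genTape w s code seed`. -/
noncomputable def genMachine (M : OfflineTM 4) (C w s : ℕ) (code seed : ℕ → ℕ) : NumMachine where
  k := M.k
  base := M.numStates + 3
  table := M.tableCode
  width := 2 * (C * (s + 1)) + 1
  range := (2 * w + 1) * w.size + s + 2 * (C * (s + 1)) + 2
  read := genTape w s code seed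

theorem representedBy_genMachine (M : OfflineTM 4) (C : ℕ) {s : ℕ} {x : List Bool} {seed : ℕ → ℕ}
    (hx : x.length = s) (hcode : Encodes code p) (hseed : ∀ j < s, seed j = bitAt x j) :
    M.RepresentedBy ![Nat.bits w, encAutomaton p.1, encState p.2, x] (C * (s + 1))
      (genMachine M C w s code seed) where
  k_eq := rfl
  base_eq := rfl
  table_eq := rfl
  width_eq := rfl
  input_lt j := by
    have hsplit : (2 * w + 1) * w.size = 2 * w * w.size + w.size := by ring
    fin_cases j <;> simp [genMachine, length_encAutomaton, hx, Nat.size_eq_bits_len] <;> omega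
  work_lt := by
    simp only [genMachine]
    omega
  read_eq j q := by
    fin_cases j
    · exact virtualTape_eq (Nat.size_eq_bits_len w) (fun j _ => (bitAt_bits w j).symm) q
    · exact virtualTape_eq (length_encAutomaton _) (fun j hj => hcode.table_eq hj) q
    · exact virtualTape_eq (bit := fun i => code (2 * w * w.size + i)) (length_encState p.2)
        (fun j hj => hcode.state_eq hj) q
    · exact virtualTape_eq hx hseed q

/-- The state reached by the automaton with encoding `code` on the output of the given generator,
computed by `M`, for this automaton and the given seed. -/
noncomputable def endState (M : OfflineTM 4) (C w s : ℕ) (code seed : ℕ → ℕ) : ℕ :=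
  (genMachine M C w s code seed).fold 4 (nextAt code w.size) (startState w code)

theorem endState_eq {M : OfflineTM 4} {C s m : ℕ} {x : List Bool} {y : Bits m} {seed : ℕ → ℕ}
    (hM : M.OutputsInSpace ![Nat.bits w, encAutomaton p.1, encState p.2, x] (List.ofFn y)
      (C * (s + 1)))
    (hx : x.length = s) (hcode : Encodes code p) (hseed : ∀ j < s, seed j = bitAt x j) :
    endState M C w s code seed = p.fn m y := by
  rw [endState, hM.fold_eq (representedBy_genMachine M C hx hcode hseed), hcode.startState_eq,
    Pointed.fn]
  exact foldl_nextAt (fun j hj => hcode.table_eq hj) _ _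

/-- The state reached from `q` on the first `n` of the bits `x` by the automaton with transition
table `code`, where states are encoded by `sz` bits. -/
def runState (code : ℕ → ℕ) (sz : ℕ) (x : ℕ → ℕ) (q : ℕ) : ℕ → ℕ
  | 0 => q
  | n + 1 => nextAt code sz (runState code sz x q n) (x n)

theorem runState_eq {m : ℕ} {x : ℕ → ℕ} (y : Bits m) (hcode : Encodes code p)
    (hx : ∀ j : Fin m, x j = (y j).toNat) :
    runState code w.size x (startState w code) m = p.fn m y := by
  rw [hcode.startState_eq]
  induction m with
  | zero => rfl
  | succ m ih =>
    have hlast : x m = (y (Fin.last m)).toNat := hx (Fin.last m)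
    rw [runState, ih (fun i => y i.castSucc) fun j => hx j.castSucc, hlast,
      nextAt_eq fun j hj => hcode.table_eq hj, Pointed.fn, Pointed.fn, foldl_ofFn_succ]

end Generator

section ImplGenerator

variable {t : ℕ} {Γ : Type} {c : Ctx t Γ} {w s q τ f : Γ → ℕ} {code seed : Γ → ℕ → ℕ}

theorem Bdd.pow_const (hf : Bdd c f) (n : ℕ) : Bdd c fun γ => f γ ^ n := by
  induction n with
  | zero => exact (Bdd.const 1).mono fun γ => (pow_zero _).le
  | succ n ih => exact (ih.mul hf).mono fun γ => (pow_succ _ _).le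

theorem virtualTape_le_two {n : ℕ} {bit : ℕ → ℕ} (h : ∀ j, bit j ≤ 1) (p : ℕ) :
    virtualTape n bit p ≤ 2 := by
  rw [virtualTape]
  have := h (p - 1)
  split_ifs <;> omega

theorem digit_two_le_one (n j : ℕ) : digit 2 n j ≤ 1 := Nat.le_of_lt_succ (Nat.mod_lt _ two_pos)

theorem two_pow_size_le (n : ℕ) : 2 ^ n.size ≤ 2 * n + 1 := by
  rcases h : n.size with _ | k
  · exact Nat.le_add_left _ _
  · have := Nat.lt_size.1 (show k < n.size by omega)
    rw [pow_succ]
    omega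

theorem Impl.bdd_two_pow_size (hw : Impl c w) : Bdd c fun γ => 2 ^ (w γ).size :=
  ((Impl.const 2).mul hw).succ.bdd.mono fun _ => two_pow_size_le _

theorem size_le_self (n : ℕ) : n.size ≤ n := Nat.size_le.2 n.lt_two_pow_self

theorem size_succ (n : ℕ) : (n + 1).size = if 2 ^ n.size ≤ n + 1 then n.size + 1 else n.size := by
  have hlt := Nat.lt_size_self n
  split_ifs with h
  · refine le_antisymm (Nat.size_le.2 ?_) (Nat.lt_size.2 h)
    rw [pow_succ]
    omega
  · exact le_antisymm (Nat.size_le.2 (not_le.1 h)) (Nat.size_le_size n.le_succ)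

theorem Impl.size_of_impl (hw : Impl c w) : Impl c fun γ => (w γ).size :=
  .rec (F := fun _ k => k.size) hw (.const 0)
    (fun _ _ _ _ _ hk _ h =>
      (Impl.ite (((Impl.const 2).pow h hk.bdd_two_pow_size).le hk.succ) h.succ h).congr
        fun _ => size_succ _)
    (hw.bdd.upTo fun _ _ hk => (size_le_self _).trans hk)

theorem ImplFam₂.genTape (hw : Impl c w) (hs : Impl c s) (hcode : ImplFam₁ c code)
    (hseed : ImplFam₁ c seed) : ImplFam₂ c fun γ => genTape (w γ) (s γ) (code γ) (seed γ) := by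
  intro Γ' c' π k l e hk hl
  have hw' := hw.comp e
  have hsize := hw'.size_of_impl
  have htable : Impl c' fun x => 2 * w (π x) * (w (π x)).size := ((Impl.const 2).mul hw').mul hsize
  exact .ite (hk.eq (.const 0)) (.virtualTape hsize (fun _ _ _ _ e' hk' _ =>
      (Impl.const 2).digit (hw'.comp e') hk') hl)
    (.ite (hk.eq (.const 1)) (.virtualTape htable (hcode.comp e) hl)
    (.ite (hk.eq (.const 2)) (.virtualTape hsize (fun _ _ _ _ e' hk' _ =>
      ImplFam₁.apply ((hcode.comp e).comp e') ((htable.comp e').add hk')) hl)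
    (.virtualTape (hs.comp e) (hseed.comp e) hl)))

theorem genTape_le_two {w s : ℕ} {code seed : ℕ → ℕ} (hcode : ∀ j, code j ≤ 1)
    (hseed : ∀ j, seed j ≤ 1) (j p : ℕ) : genTape w s code seed j p ≤ 2 := by
  rw [genTape]
  split_ifs
  · exact virtualTape_le_two (digit_two_le_one _) _
  · exact virtualTape_le_two hcode _
  · exact virtualTape_le_two (fun _ => hcode _) _
  · exact virtualTape_le_two hseed _

theorem Bdd.three_pow_tapes (k C : ℕ) (hB : Bdd c fun γ => 2 ^ s γ) :
    Bdd c fun γ => 3 ^ (k * (2 * (C * (s γ + 1)) + 1)) := by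
  refine ((hB.mul (.const 2)).pow_const (2 * (k * (2 * C + 1)))).mono fun γ => ?_
  calc 3 ^ (k * (2 * (C * (s γ + 1)) + 1)) ≤ (2 ^ 2) ^ (k * (2 * (C * (s γ + 1)) + 1)) :=
        Nat.pow_le_pow_left (by norm_num) _
    _ = 2 ^ (2 * (k * (2 * (C * (s γ + 1)) + 1))) := (pow_mul _ _ _).symm
    _ ≤ 2 ^ ((s γ + 1) * (2 * (k * (2 * C + 1)))) :=
        Nat.pow_le_pow_right two_pos (by nlinarith only [Nat.zero_le (k * s γ)])
    _ = (2 ^ s γ * 2) ^ (2 * (k * (2 * C + 1))) := by rw [pow_mul, pow_succ]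

theorem implementable_genMachine (M : OfflineTM 4) (C : ℕ) (hw : Impl c w) (hs : Impl c s)
    (hB : Bdd c fun γ => 2 ^ s γ) (hcode : ImplFam₁ c code) (hcode_le : ∀ γ j, code γ j ≤ 1)
    (hseed : ImplFam₁ c seed) (hseed_le : ∀ γ j, seed γ j ≤ 1) :
    NumMachine.Implementable c 4 fun γ => genMachine M C (w γ) (s γ) (code γ) (seed γ) := by
  have hwidth : Impl c fun γ => 2 * (C * (s γ + 1)) :=
    (Impl.const 2).mul ((Impl.const C).mul hs.succ)
  have hrange : Impl c fun γ => (2 * w γ + 1) * (w γ).size + s γ + 2 * (C * (s γ + 1)) + 2 :=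
    (((((Impl.const 2).mul hw).succ.mul hw.size_of_impl).add hs).add hwidth).succ.succ
  exact
    { k := .const M.k
      base := .const (M.numStates + 3)
      table := .const M.tableCode
      width := hwidth.succ
      range := hrange
      read := .genTape hw hs hcode hseed
      read_le := fun γ => genTape_le_two (hcode_le γ) (hseed_le γ)
      half_width_lt := fun γ => by
        simp only [genMachine]
        omega
      bdd_scanned := .const (3 ^ (4 + M.k))
      bdd_tapes := .three_pow_tapes M.k C hB
      bdd_heads := hrange.bdd.pow_const (4 + M.k) }

theorem Impl.startState (hw : Impl c w) (hcode : ImplFam₁ c code)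
    (hcode_le : ∀ γ j, code γ j ≤ 1) : Impl c fun γ => startState (w γ) (code γ) :=
  .numAt hcode hcode_le (((Impl.const 2).mul hw).mul hw.size_of_impl) hw.size_of_impl
    hw.bdd_two_pow_size

theorem Impl.endState (M : OfflineTM 4) (C : ℕ) (hw : Impl c w) (hs : Impl c s)
    (hB : Bdd c fun γ => 2 ^ s γ) (hcode : ImplFam₁ c code) (hcode_le : ∀ γ j, code γ j ≤ 1)
    (hseed : ImplFam₁ c seed) (hseed_le : ∀ γ j, seed γ j ≤ 1) :
    Impl c fun γ => endState M C (w γ) (s γ) (code γ) (seed γ) :=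
  (implementable_genMachine M C hw hs hB hcode hcode_le hseed hseed_le).fold
    (.nextAt hcode hcode_le hw.size_of_impl hw.bdd_two_pow_size) (.startState hw hcode hcode_le)
    hw.bdd_two_pow_size fun γ _ _ => (numAt_lt (hcode_le γ) _ _).le

theorem Impl.runState (hw : Impl c w) (hcode : ImplFam₁ c code) (hcode_le : ∀ γ j, code γ j ≤ 1)
    (hseed : ImplFam₁ c seed) (hq : Impl c q) (hτ : Impl c τ) :
    Impl c fun γ => runState (code γ) (w γ).size (seed γ) (q γ) (τ γ) := by
  refine .rec (F := fun γ => SpaceDerand.runState (code γ) (w γ).size (seed γ) (q γ)) hτ hq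
    (fun _ _ _ _ e hk _ h => ?_) (((hw.bdd_two_pow_size).add hq.bdd).upTo fun γ k _ => ?_)
  · have hw' := hw.comp e
    exact (ImplFam₂.nextAt (hcode.comp e) (fun _ => hcode_le _) hw'.size_of_impl
      hw'.bdd_two_pow_size).apply h (ImplFam₁.apply (hseed.comp e) hk)
  · rcases k with _ | k
    · exact Nat.le_add_left _ _
    · exact (numAt_lt (hcode_le γ) _ _).le.trans (Nat.le_add_right _ _)

end ImplGenerator

section Lookup

/-- The length of an entry of the table of answers, which consists of the encoding of an automaton
with a start state, followed by the encoding of the state that answers it. -/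
def entryLen (w : ℕ) : ℕ := (2 * w + 1) * w.size + w.size

/-- The entry `e` of the table of answers that is stored in `n` advice bits `advice`, after two bits
that give the format, is complete and is about the automaton with encoding `code`. -/
def EntryMatches (w n : ℕ) (code advice : ℕ → ℕ) (e : ℕ) : Prop :=
  2 + (e + 1) * entryLen w ≤ n ∧
    ∀ j < (2 * w + 1) * w.size, advice (2 + e * entryLen w + j) = code j

open Classical in
/-- The answer of the last matching entry among the first `e`. -/
noncomputable def lookup (w n : ℕ) (code advice : ℕ → ℕ) : ℕ → ℕ
  | 0 => 0
  | e + 1 => if EntryMatches w n code advice e then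
      numAt advice (2 + e * entryLen w + (2 * w + 1) * w.size) w.size
    else lookup w n code advice e

theorem lookup_eq {w n v E : ℕ} {code advice : ℕ → ℕ}
    (h : ∀ e < E, EntryMatches w n code advice e →
      numAt advice (2 + e * entryLen w + (2 * w + 1) * w.size) w.size = v)
    {e : ℕ} (he : e < E) (hm : EntryMatches w n code advice e) : lookup w n code advice E = v := by
  induction E with
  | zero => omega
  | succ E ih =>
    rw [lookup]
    split_ifs with hE
    · exact h E E.lt_succ_self hE
    · have hne : e ≠ E := fun h' => hE (h' ▸ hm)
      exact ih (fun e he => h e (by omega)) (by omega)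

theorem lookup_le_two_pow {advice : ℕ → ℕ} (h : ∀ j, advice j ≤ 1) (w n : ℕ) (code : ℕ → ℕ)
    (E : ℕ) : lookup w n code advice E ≤ 2 ^ w.size := by
  induction E with
  | zero => exact Nat.zero_le _
  | succ E ih =>
    rw [lookup]
    split_ifs
    · exact (numAt_lt h _ _).le
    · exact ih

variable {t : ℕ} {Γ : Type} {c : Ctx t Γ} {w n e τ : Γ → ℕ} {code advice : Γ → ℕ → ℕ}

theorem Impl.entryLen (hw : Impl c w) : Impl c fun γ => entryLen (w γ) :=
  (((Impl.const 2).mul hw).succ.mul hw.size_of_impl).add hw.size_of_impl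

theorem ImplPred.entryMatches (hw : Impl c w) (hn : Impl c n) (hcode : ImplFam₁ c code)
    (hadvice : ImplFam₁ c advice) (he : Impl c e) :
    ImplPred c fun γ => EntryMatches (w γ) (n γ) (code γ) (advice γ) (e γ) := by
  refine .and (((Impl.const 2).add (he.succ.mul hw.entryLen)).le hn)
    (.ball_lt (((Impl.const 2).mul hw).succ.mul hw.size_of_impl) ?_)
  intro Γ' c' π j ex hj _
  have hpos := ((Impl.const 2).add (he.mul hw.entryLen)).comp ex
  exact (ImplFam₁.apply (hadvice.comp ex) (hpos.add hj)).eq (ImplFam₁.apply (hcode.comp ex) hj)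

theorem Impl.lookup (hw : Impl c w) (hn : Impl c n) (hcode : ImplFam₁ c code)
    (hadvice : ImplFam₁ c advice) (hadvice_le : ∀ γ j, advice γ j ≤ 1) (hτ : Impl c τ) :
    Impl c fun γ => lookup (w γ) (n γ) (code γ) (advice γ) (τ γ) := by
  classical
  refine .rec (F := fun γ => SpaceDerand.lookup (w γ) (n γ) (code γ) (advice γ)) hτ .zero
    (fun Γ' c' π k e hk _ h => ?_)
    (hw.bdd_two_pow_size.upTo fun γ k _ => lookup_le_two_pow (hadvice_le γ) _ _ _ _)
  have hw' := hw.comp e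
  have hpos : Impl c' fun x => 2 + k x * SpaceDerand.entryLen (w (π x)) +
      (2 * w (π x) + 1) * (w (π x)).size :=
    ((Impl.const 2).add (hk.mul hw'.entryLen)).add
      (((Impl.const 2).mul hw').succ.mul hw'.size_of_impl)
  exact .ite (.entryMatches hw' (hn.comp e) (hcode.comp e) (hadvice.comp e) hk)
    (.numAt (hadvice.comp e) (fun _ => hadvice_le _) hpos hw'.size_of_impl hw'.bdd_two_pow_size) h

end Lookup

section Simulator

/-- The state that the simulator outputs given `n` bits `advice`. The first two bits give the format
of the rest: a seed for the given generator, computed by `M`, if the first bit is `0`; a string on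
which to run the automaton after `1, 0`; a table of answers after `1, 1`. A seed is only used if it
is so short that the generator runs in logarithmic space. -/
noncomputable def simulatedState (M : OfflineTM 4) (C w n : ℕ) (code advice : ℕ → ℕ) : ℕ :=
  if advice 0 = 0 then
    if n - 2 < w.size then endState M C w (n - 2) code fun j => advice (j + 2) else 0
  else if advice 1 = 0 then
    runState code w.size (fun j => advice (j + 2)) (startState w code) (n - 2)
  else lookup w n code advice n

/-- The simulator; the reduction modulo `w` only serves to make the result a state for all inputs.
-/
noncomputable def simulator (M : OfflineTM 4) (C : ℕ) (w : ℕ+) (p : Pointed w) (y : List Bool) :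
    Fin w :=
  ⟨simulatedState M C w y.length (bitAt (encPointed p)) (bitAt y) % w, Nat.mod_lt _ w.pos⟩

theorem Impl.simulatedState {t : ℕ} {Γ : Type} {c : Ctx t Γ} {w n : Γ → ℕ}
    {code advice : Γ → ℕ → ℕ} (M : OfflineTM 4) (C : ℕ) (hw : Impl c w) (hn : Impl c n)
    (hcode : ImplFam₁ c code) (hcode_le : ∀ γ j, code γ j ≤ 1) (hadvice : ImplFam₁ c advice)
    (hadvice_le : ∀ γ j, advice γ j ≤ 1) :
    Impl c fun γ => simulatedState M C (w γ) (n γ) (code γ) (advice γ) := by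
  have hlen : Impl c fun γ => n γ - 2 := hn.sub (.const 2)
  have hrest : ImplFam₁ c fun γ j => advice γ (j + 2) := fun _ _ _ _ e hk _ =>
    ImplFam₁.apply (hadvice.comp e) hk.succ.succ
  refine .ite ((ImplFam₁.apply hadvice (.const 0)).eq (.const 0))
    (.ite_of_restrict (hlen.lt hw.size_of_impl) ?_ .zero)
    (.ite ((ImplFam₁.apply hadvice (.const 1)).eq (.const 0))
      (.runState hw hcode hcode_le hrest (.startState hw hcode hcode_le) hlen)
      (.lookup hw hn hcode hadvice hadvice_le hn))
  have e := c.restrict_extends fun γ => n γ - 2 < (w γ).size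
  exact .endState M C (hw.comp e) (hlen.comp e)
    ((hw.comp e).bdd_two_pow_size.mono fun x => Nat.pow_le_pow_right two_pos x.2.le)
    (hcode.comp e) (fun _ => hcode_le _) (hrest.comp e) fun _ _ => hadvice_le _ _

/-- The inputs of the simulator, with logarithmic space. -/
def simulatorCtx : Ctx 4 ((w : ℕ+) × Pointed w × List Bool) where
  inp := fun ⟨w, p, y⟩ => ![Nat.bits w, encAutomaton p.1, encState p.2, y]
  space := fun ⟨w, p, y⟩ => Nat.log 2 ((Nat.bits w).length + (encAutomaton p.1).length
    + (encState p.2).length + y.length)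
  known := ∅

theorem bdd_simulatorCtx_length :
    Bdd simulatorCtx fun γ => γ.2.2.length + (2 * (γ.1 : ℕ) + 1) * (γ.1 : ℕ).size := by
  refine ⟨1, fun ⟨w, p, y⟩ => ?_⟩
  rw [one_mul]
  refine le_trans ?_ (Nat.lt_pow_succ_log_self one_lt_two _).le
  simp only [length_encAutomaton, length_encState, add_mul, one_mul]
  omega

theorem implFam₁_bitAt_encPointed (hw : Impl simulatorCtx fun γ => γ.1) :
    ImplFam₁ simulatorCtx fun γ => bitAt (encPointed γ.2.1) := by
  intro Γ' c' π k e hk _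
  have hw' := hw.comp e
  have hpos : Impl c' fun x => 2 * ((π x).1 : ℕ) * ((π x).1 : ℕ).size :=
    ((Impl.const 2).mul hw').mul hw'.size_of_impl
  refine (Impl.ite (hk.lt hpos) (hk.bitAt 1) ((hk.sub hpos).bitAt 2)).congr fun x => ?_
  rw [e.inp]
  split_ifs with h
  · exact bitAt_encPointed_left _ h
  · obtain ⟨r, hr⟩ := Nat.exists_eq_add_of_le (not_lt.1 h)
    rw [hr, Nat.add_sub_cancel_left]
    exact bitAt_encPointed_right _ r

theorem isLogspaceAlgorithm_simulator (M : OfflineTM 4) (C : ℕ) :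
    IsLogspaceAlgorithm (simulator M C) := by
  have hB : Bdd simulatorCtx fun γ => 2 ^ (γ.1 : ℕ).size :=
    bdd_simulatorCtx_length.mono fun γ => by
      have := Nat.size_pos.2 γ.1.pos
      nlinarith only [two_pow_size_le (γ.1 : ℕ), this]
  have hsize := Impl.size (c := simulatorCtx) 0 (fun _ => rfl) hB
  have hw := Impl.ofBits (c := simulatorCtx) 0 (fun _ => rfl) hB
  have hn : Impl simulatorCtx fun γ => γ.2.2.length :=
    .inputLength 3 (bdd_simulatorCtx_length.mono fun _ => Nat.le_add_right _ _)
  have hadvice : ImplFam₁ simulatorCtx fun γ => bitAt γ.2.2 := fun _ _ _ _ e hk _ =>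
    (hk.bitAt 3).congr fun x => by rw [e.inp]; rfl
  have hstate := (Impl.simulatedState M C hw hn (implFam₁_bitAt_encPointed hw)
    (fun _ => bitAt_le_one _) hadvice fun _ => bitAt_le_one _).mod hw
  refine Impl.computable (len := fun γ => (γ.1 : ℕ).size)
    (bit := fun γ j => digit 2 (simulator M C γ.1 γ.2.1 γ.2.2) j) hsize
    (fun _ _ _ _ e hk _ => (Impl.const 2).digit (hstate.comp e) hk) fun ⟨w, p, y⟩ => ?_
  refine (eq_map_range_bitAt (encState (simulator M C w p y))).trans ?_
  rw [length_encState]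
  exact List.map_congr_left fun k hk => by rw [bitAt_encState _ (List.mem_range.1 hk)]

end Simulator

/-! ### The advice generator -/

section Definitions

/-- The machine with one input tape whose transition table, base and number of work tapes are the
three digits of `e` in base `G`, where `G` is the size of the size of `w`, run on input `w` in space
`s / G`. As `G` tends to infinity, each machine is eventually among those with `e < G ^ 3`. -/
def decodedMachine (w s e : ℕ) : NumMachine where
  k := digit w.size.size e 2
  base := digit w.size.size e 1
  table := digit w.size.size e 0
  width := 2 * (s / w.size.size) + 1
  range := 2 * s + 3
  read := fun _ => virtualTape w.size (digit 2 w)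

/-- Bit `j` of the output of the machine with number `e`. -/
def decodedBit (w s e j : ℕ) : ℕ := (decodedMachine w s e).outBit 1 j

/-- The output length of the given generator, computed by `M`, or `s + 1` if it is larger. It is
measured on `onesAutomaton`, which the generator eventually accepts. -/
noncomputable def outCount (M : OfflineTM 4) (C w s : ℕ) : ℕ :=
  (genMachine M C w s (onesBit w w.size) fun _ => 0).fold 4 (fun a _ => min (a + 1) (s + 1)) 0

/-- The length of the advice, whose formats are those of `simulatedState`. -/
noncomputable def adviceLen (M : OfflineTM 4) (C w s : ℕ) : ℕ :=
  if s < w.size then s + 2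
  else if outCount M C w s ≤ s then outCount M C w s + 2
  else w.size.size ^ 3 * entryLen w + 2

/-- Bit `r` of entry `e` of the table of answers: the output of the machine with number `e`,
followed by the state to which the given generator takes the automaton with this encoding. -/
noncomputable def tableBit (M : OfflineTM 4) (C w s : ℕ) (seed : ℕ → ℕ) (e r : ℕ) : ℕ :=
  if r < (2 * w + 1) * w.size then decodedBit w s e r
  else digit 2 (endState M C w s (decodedBit w s e) seed) (r - (2 * w + 1) * w.size)

/-- Bit `j` of the advice. -/
noncomputable def adviceBit (M : OfflineTM 4) (C w s : ℕ) (seed : ℕ → ℕ) (j : ℕ) : ℕ :=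
  if s < w.size then if j < 2 then 0 else seed (j - 2)
  else if outCount M C w s ≤ s then
    if j = 0 then 1 else if j = 1 then 0 else seed (j - 2)
  else if j < 2 then 1
  else tableBit M C w s seed ((j - 2) / entryLen w) ((j - 2) % entryLen w)

/-- The simulation advice generator: the seed itself if it is so short that the simulator can run
the given generator, a prefix of the seed if the given generator does not stretch it, and a table of
the answers for all machines with small numbers otherwise. -/
noncomputable def advice (M : OfflineTM 4) (C : ℕ) (s : ℕ+ → ℕ) (w : ℕ+) (x : Bits (s w)) :
    Bits (adviceLen M C w (s w)) :=
  fun j => decide (adviceBit M C w (s w) (bitAt (List.ofFn x)) j ≠ 0)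

end Definitions

section Growth

theorem digit_le_base (b n : ℕ) {j : ℕ} (hj : j ≠ 0) : digit b n j ≤ b := by
  rcases b.eq_zero_or_pos with rfl | hb
  · simp [digit, hj]
  · exact (Nat.mod_lt _ hb).le

theorem succ_mul_succ_succ_le_two_pow (n : ℕ) : (n + 1) * (n + 2) ≤ 3 * 2 ^ n := by
  induction n with
  | zero => norm_num
  | succ n ih =>
    rw [pow_succ]
    rcases n.eq_zero_or_pos with rfl | hn
    · norm_num
    · nlinarith only [ih, hn]

theorem pow_size_succ_le (s : ℕ) : (2 * s + 3) ^ (s.size + 1) ≤ 2 ^ (6 * (s + 1)) := by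
  have hbase : 2 * s + 3 ≤ 2 ^ (s.size + 2) := by
    have := Nat.lt_size_self s
    rw [pow_add]
    omega
  refine (Nat.pow_le_pow_left hbase _).trans ?_
  rw [← pow_mul, mul_comm]
  refine Nat.pow_le_pow_right two_pos ((succ_mul_succ_succ_le_two_pow _).trans ?_)
  have := two_pow_size_le s
  omega

end Growth

section Impl

variable {t : ℕ} {Γ : Type} {c : Ctx t Γ} {w s e r : Γ → ℕ} {seed : Γ → ℕ → ℕ}

theorem Bdd.three_pow {f : Γ → ℕ} (h : ∀ γ, f γ ≤ 3 * (c.space γ + 1)) :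
    Bdd c fun γ => 3 ^ f γ :=
  ⟨6, fun γ => by
    calc 3 ^ f γ ≤ (2 ^ 2) ^ (3 * (c.space γ + 1)) :=
          (Nat.pow_le_pow_right (by norm_num) (h γ)).trans (Nat.pow_le_pow_left (by norm_num) _)
      _ = 2 ^ (6 * (c.space γ + 1)) := by rw [← pow_mul, ← mul_assoc]; rfl⟩

theorem implementable_decodedMachine (hw : Impl c w) (hs : Impl c s) (he : Impl c e)
    (hspace : ∀ γ, c.space γ = s γ) (hle : ∀ γ, (w γ).size ≤ s γ) :
    NumMachine.Implementable c 1 fun γ => decodedMachine (w γ) (s γ) (e γ) := by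
  have hG := hw.size_of_impl.size_of_impl
  have hk (γ : Γ) : digit (w γ).size.size (e γ) 2 ≤ (w γ).size.size :=
    digit_le_base _ _ two_ne_zero
  have hGs (γ : Γ) : (w γ).size.size ≤ s γ := (size_le_self _).trans (hle γ)
  exact
    { k := hG.digit he (.const 2)
      base := hG.digit he (.const 1)
      table := hG.digit he (.const 0)
      width := ((Impl.const 2).mul (hs.div hG)).succ
      range := ((Impl.const 2).mul hs).succ.succ.succ
      read := fun _ _ _ _ _ ex _ hl => .virtualTape (hw.size_of_impl.comp ex)
        (fun _ _ _ _ ex' hj _ => (Impl.const 2).digit ((hw.comp ex).comp ex') hj) hl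
      read_le := fun _ _ => virtualTape_le_two (digit_two_le_one _)
      half_width_lt := fun γ => by
        have := Nat.div_le_self (s γ) (w γ).size.size
        simp only [decodedMachine]
        omega
      bdd_scanned := .three_pow fun γ => by
        have := (hk γ).trans (hGs γ)
        simp only [hspace, decodedMachine]
        omega
      bdd_tapes := .three_pow fun γ => by
        simp only [hspace, decodedMachine]
        refine (Nat.mul_le_mul_right _ (hk γ)).trans ?_
        nlinarith only [hGs γ, Nat.div_mul_le_self (s γ) (w γ).size.size]
      bdd_heads := ⟨6, fun γ => by
        have hexp := (hk γ).trans (Nat.size_le_size (hle γ))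
        simp only [hspace, decodedMachine, add_comm 1]
        exact (Nat.pow_le_pow_right (Nat.succ_pos _) (Nat.succ_le_succ hexp)).trans
          (pow_size_succ_le (s γ))⟩ }

theorem decodedBit_le_one (w s e j : ℕ) : decodedBit w s e j ≤ 1 :=
  NumMachine.outBit_le_one _ _ _

theorem Impl.decodedBit (hw : Impl c w) (hs : Impl c s) (he : Impl c e) (hr : Impl c r)
    (hspace : ∀ γ, c.space γ = s γ) (hle : ∀ γ, (w γ).size ≤ s γ) :
    Impl c fun γ => decodedBit (w γ) (s γ) (e γ) (r γ) :=
  (implementable_decodedMachine hw hs he hspace hle).outBit hr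

theorem bdd_two_pow_of_space_eq (hspace : ∀ γ, c.space γ = s γ) : Bdd c fun γ => 2 ^ s γ :=
  ⟨1, fun γ => by
    rw [hspace, one_mul]
    exact Nat.pow_le_pow_right two_pos (Nat.le_succ _)⟩

theorem Impl.outCount (M : OfflineTM 4) (C : ℕ) (hw : Impl c w) (hs : Impl c s)
    (hspace : ∀ γ, c.space γ = s γ) : Impl c fun γ => outCount M C (w γ) (s γ) :=
  (implementable_genMachine M C hw hs (bdd_two_pow_of_space_eq hspace)
    (fun _ _ _ _ ex hj _ => .onesBit (hw.comp ex) (hw.size_of_impl.comp ex) hj)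
    (fun _ => onesBit_le_one _ _) (fun _ _ _ _ _ _ _ => .zero) fun _ _ => Nat.zero_le _).fold
    (fun _ _ _ _ _ ex ha _ => ha.succ.min (hs.succ.comp ex)) .zero hs.succ.bdd
    fun _ _ _ => min_le_right _ _

theorem Impl.tableBit (M : OfflineTM 4) (C : ℕ) (hw : Impl c w) (hs : Impl c s)
    (hspace : ∀ γ, c.space γ = s γ) (hle : ∀ γ, (w γ).size ≤ s γ) (hseed : ImplFam₁ c seed)
    (hseed_le : ∀ γ j, seed γ j ≤ 1) (he : Impl c e) (hr : Impl c r) :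
    Impl c fun γ => tableBit M C (w γ) (s γ) (seed γ) (e γ) (r γ) := by
  have hlen : Impl c fun γ => (2 * w γ + 1) * (w γ).size :=
    ((Impl.const 2).mul hw).succ.mul hw.size_of_impl
  have hcode : ImplFam₁ c fun γ => SpaceDerand.decodedBit (w γ) (s γ) (e γ) :=
    fun _ _ _ _ ex hj _ => .decodedBit (hw.comp ex) (hs.comp ex) (he.comp ex) hj
      (fun _ => (ex.space _).trans (hspace _)) fun _ => hle _
  exact .ite (hr.lt hlen) (.decodedBit hw hs he hr hspace hle) ((Impl.const 2).digit
    (.endState M C hw hs (bdd_two_pow_of_space_eq hspace) hcode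
      (fun _ => decodedBit_le_one _ _ _) hseed hseed_le) (hr.sub hlen))

end Impl

section AdviceGenerator

variable {Γ : Type} {c : Ctx 2 Γ} {w s : Γ → ℕ}

theorem Impl.seedLength (hx : ∀ γ, (c.inp γ 1).length = s γ) (hspace : ∀ γ, c.space γ = s γ) :
    Impl c s :=
  (Impl.inputLength 1 ((bdd_two_pow_of_space_eq hspace).mono fun γ => by
    rw [hx]
    exact Nat.lt_two_pow_self.le)).congr fun γ => (hx γ).symm

theorem ImplPred.lt_size (hin : ∀ γ, c.inp γ 0 = (w γ).bits) (hs : Impl c s) :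
    ImplPred c fun γ => s γ < (w γ).size :=
  ⟨_, hs.succ.read 0, fun γ => by rw [symbolCode_readInput_ne_zero, hin, Nat.size_eq_bits_len]⟩

/-- Only a number whose size is at most the available space can be held in a register; this is why
the case of a short seed is decided on the input tape. -/
theorem Impl.ofBits_of_size_le (hin : ∀ γ, c.inp γ 0 = (w γ).bits)
    (hspace : ∀ γ, c.space γ = s γ) (hle : ∀ γ, (w γ).size ≤ s γ) : Impl c w :=
  .ofBits 0 hin ((bdd_two_pow_of_space_eq hspace).mono fun γ =>
    Nat.pow_le_pow_right two_pos (hle γ))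

theorem Impl.adviceLen (M : OfflineTM 4) (C : ℕ) (hin : ∀ γ, c.inp γ 0 = (w γ).bits)
    (hx : ∀ γ, (c.inp γ 1).length = s γ) (hspace : ∀ γ, c.space γ = s γ) :
    Impl c fun γ => adviceLen M C (w γ) (s γ) := by
  have hs := Impl.seedLength hx hspace
  refine .ite_of_restrict (.lt_size hin hs) (hs.comp (c.restrict_extends _)).succ.succ ?_
  have e := c.restrict_extends fun γ => ¬ s γ < (w γ).size
  have hspace' := fun x => (e.space x).trans (hspace _)
  have hw := Impl.ofBits_of_size_le (fun x => (congrFun (e.inp x) 0).trans (hin _)) hspace'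
    fun x => Nat.le_of_not_lt x.2
  have hcount := Impl.outCount M C hw (hs.comp e) hspace'
  have hG := hw.size_of_impl.size_of_impl
  exact .ite (hcount.le (hs.comp e)) hcount.succ.succ
    ((hG.pow (.const 3) (hG.bdd.pow_const 3)).mul hw.entryLen).succ.succ

theorem Impl.adviceBit (M : OfflineTM 4) (C : ℕ) (hin : ∀ γ, c.inp γ 0 = (w γ).bits)
    (hx : ∀ γ, (c.inp γ 1).length = s γ) (hspace : ∀ γ, c.space γ = s γ) {j : Γ → ℕ}
    (hj : Impl c j) :
    Impl c fun γ => adviceBit M C (w γ) (s γ) (SpaceDerand.bitAt (c.inp γ 1)) (j γ) := by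
  have hs := Impl.seedLength hx hspace
  have hseed : ImplFam₁ c fun γ => SpaceDerand.bitAt (c.inp γ 1) := fun _ _ _ _ e hk _ =>
    (hk.bitAt 1).congr fun _ => by rw [e.inp]
  have hj₂ := hj.sub (.const 2)
  have hrest := ImplFam₁.apply hseed hj₂
  refine .ite_of_restrict (.lt_size hin hs)
    (.comp (.ite (hj.lt (.const 2)) .zero hrest) (c.restrict_extends _)) ?_
  have e := c.restrict_extends fun γ => ¬ s γ < (w γ).size
  have hspace' := fun x => (e.space x).trans (hspace _)
  have hle := fun x : {γ // ¬ s γ < (w γ).size} => Nat.le_of_not_lt x.2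
  have hw := Impl.ofBits_of_size_le (fun x => (congrFun (e.inp x) 0).trans (hin _)) hspace' hle
  have hs' := hs.comp e
  have hj' := hj.comp e
  exact .ite ((Impl.outCount M C hw hs' hspace').le hs')
    (.ite (hj'.eq (.const 0)) (.const 1) (.ite (hj'.eq (.const 1)) .zero (hrest.comp e)))
    (.ite (hj'.lt (.const 2)) (.const 1) (.tableBit M C hw hs' hspace' hle (hseed.comp e)
      (fun _ => bitAt_le_one _) ((hj₂.comp e).div hw.entryLen) ((hj₂.comp e).mod hw.entryLen)))

theorem computable_advice (M : OfflineTM 4) (C : ℕ) (s : ℕ+ → ℕ) :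
    ComputableInSpace (ι := (w : ℕ+) × Bits (s w))
      (fun ⟨w, x⟩ => ![Nat.bits w, List.ofFn x])
      (fun ⟨w, x⟩ => List.ofFn (advice M C s w x)) (fun ⟨w, _⟩ => s w) := by
  refine Impl.computable (len := fun γ : (w : ℕ+) × Bits (s w) => adviceLen M C γ.1 (s γ.1))
    (bit := fun γ j => adviceBit M C γ.1 (s γ.1) (bitAt (List.ofFn γ.2)) j)
    (.adviceLen M C (fun _ => rfl) (fun _ => List.length_ofFn) fun _ => rfl)
    (fun _ c' π k e hk _ => ?_) fun γ => List.ext_getElem (by simp) fun j _ _ => by simp [advice]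
  refine (Impl.adviceBit M C (w := fun x => ((π x).1 : ℕ)) (s := fun x => s (π x).1)
    (fun x => ?_) (fun x => ?_) (fun x => e.space x) hk).congr fun x => ?_
  all_goals rw [e.inp]
  exacts [rfl, List.length_ofFn, rfl]

end AdviceGenerator

section Correctness

variable {M : OfflineTM 4} {C : ℕ} {s : ℕ+ → ℕ} {w : ℕ+} {m : ℕ} {p : Pointed w}

theorem adviceBit_le_one (M : OfflineTM 4) (C w s : ℕ) {seed : ℕ → ℕ} (h : ∀ j, seed j ≤ 1)
    (j : ℕ) : adviceBit M C w s seed j ≤ 1 := by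
  rw [adviceBit, tableBit]
  split_ifs
  all_goals first
    | exact h _ | exact decodedBit_le_one _ _ _ _ | exact digit_two_le_one _ _ | omega

theorem bitAt_advice (x : Bits (s w)) {j : ℕ} (hj : j < adviceLen M C w (s w)) :
    bitAt (List.ofFn (advice M C s w x)) j = adviceBit M C w (s w) (bitAt (List.ofFn x)) j := by
  rw [bitAt_ofFn _ hj, advice]
  rcases Nat.le_one_iff_eq_zero_or_eq_one.1
    (adviceBit_le_one M C w (s w) (bitAt_le_one (List.ofFn x)) j) with h | h <;> simp [h]

theorem simulator_eq {y : List Bool} {n : ℕ} {q : Fin w} (hn : y.length = n)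
    (h : simulatedState M C w n (bitAt (encPointed p)) (bitAt y) = q) :
    simulator M C w p y = q := by
  subst hn
  exact Fin.ext ((congrArg (· % (w : ℕ)) h).trans (Nat.mod_eq_of_lt q.2))

theorem simulator_advice_of_lt_size (h : s w < (w : ℕ).size) (x : Bits (s w)) {y : Bits m}
    (hM : M.OutputsInSpace ![Nat.bits w, encAutomaton p.1, encState p.2, List.ofFn x]
      (List.ofFn y) (C * (s w + 1))) :
    simulator M C w p (List.ofFn (advice M C s w x)) = p.fn m y := by
  have hlen : adviceLen M C w (s w) = s w + 2 := if_pos h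
  have hformat : bitAt (List.ofFn (advice M C s w x)) 0 = 0 := by
    rw [bitAt_advice x (by omega), adviceBit, if_pos h, if_pos two_pos]
  refine simulator_eq (List.length_ofFn.trans hlen) ?_
  rw [simulatedState, if_pos hformat, Nat.add_sub_cancel, if_pos h]
  refine endState_eq hM List.length_ofFn (fun _ _ => rfl) fun j hj => ?_
  rw [bitAt_advice x (by omega), adviceBit, if_pos h, if_neg (by omega), Nat.add_sub_cancel]

theorem simulator_advice_of_outCount_eq (h : ¬ s w < (w : ℕ).size)
    (hcount : outCount M C w (s w) = m) (hm : m ≤ s w) (x : Bits (s w)) :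
    simulator M C w p (List.ofFn (advice M C s w x)) = p.fn m fun i => x (Fin.castLE hm i) := by
  have hle : outCount M C w (s w) ≤ s w := hcount.trans_le hm
  have hlen : adviceLen M C w (s w) = m + 2 := by rw [adviceLen, if_neg h, if_pos hle, hcount]
  have hbit {j : ℕ} (hj : j < m + 2) : bitAt (List.ofFn (advice M C s w x)) j =
      if j = 0 then 1 else if j = 1 then 0 else bitAt (List.ofFn x) (j - 2) := by
    rw [bitAt_advice x (hlen ▸ hj), adviceBit, if_neg h, if_pos hle]
  refine simulator_eq (List.length_ofFn.trans hlen) ?_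
  rw [simulatedState, hbit (by omega), if_pos rfl, if_neg one_ne_zero, hbit (by omega),
    if_neg one_ne_zero, if_pos rfl, if_pos rfl, Nat.add_sub_cancel]
  refine runState_eq _ (fun _ _ => rfl) fun j => ?_
  rw [hbit (by omega), if_neg (by omega), if_neg (by omega), Nat.add_sub_cancel,
    bitAt_ofFn x (by omega)]
  rfl

section Table

theorem entryLen_pos (w : ℕ+) : 0 < entryLen w :=
  Nat.add_pos_right _ (Nat.size_pos.2 w.pos)

variable (h : ¬ s w < (w : ℕ).size) (hcount : ¬ outCount M C w (s w) ≤ s w) (x : Bits (s w))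

include h hcount

theorem adviceLen_eq_table : adviceLen M C w (s w) = (w : ℕ).size.size ^ 3 * entryLen w + 2 := by
  rw [adviceLen, if_neg h, if_neg hcount]

theorem bitAt_advice_table {e r : ℕ} (he : e < (w : ℕ).size.size ^ 3) (hr : r < entryLen w) :
    bitAt (List.ofFn (advice M C s w x)) (2 + e * entryLen w + r) =
      tableBit M C w (s w) (bitAt (List.ofFn x)) e r := by
  have hlt : 2 + e * entryLen w + r < adviceLen M C w (s w) := by
    rw [adviceLen_eq_table h hcount]
    nlinarith only [Nat.mul_le_mul_right (entryLen w) (Nat.succ_le_of_lt he), hr]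
  have hsub : 2 + e * entryLen w + r - 2 = r + e * entryLen w := by omega
  rw [bitAt_advice x hlt, adviceBit, if_neg h, if_neg hcount, if_neg (by omega), hsub,
    Nat.add_mul_div_right _ _ (Nat.zero_lt_of_lt hr), Nat.add_mul_mod_self_right,
    Nat.div_eq_of_lt hr, Nat.mod_eq_of_lt hr, zero_add]

theorem entryMatches_advice_iff {e : ℕ} :
    EntryMatches w (adviceLen M C w (s w)) (bitAt (encPointed p))
      (bitAt (List.ofFn (advice M C s w x))) e ↔
        e < (w : ℕ).size.size ^ 3 ∧ Encodes (decodedBit w (s w) e) p := by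
  have hfit : 2 + (e + 1) * entryLen w ≤ adviceLen M C w (s w) ↔ e < (w : ℕ).size.size ^ 3 := by
    rw [adviceLen_eq_table h hcount, add_comm 2, Nat.add_le_add_iff_right,
      Nat.mul_le_mul_right_iff (entryLen_pos w), Nat.succ_le_iff]
  rw [EntryMatches, hfit]
  refine and_congr_right fun he => forall₂_congr fun j hj => ?_
  rw [bitAt_advice_table h hcount x he (hj.trans_le (Nat.le_add_right _ _)), tableBit, if_pos hj]

theorem simulator_advice_of_encodes {y : Bits m}
    (hM : M.OutputsInSpace ![Nat.bits w, encAutomaton p.1, encState p.2, List.ofFn x]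
      (List.ofFn y) (C * (s w + 1)))
    {e : ℕ} (he : e < (w : ℕ).size.size ^ 3) (hcode : Encodes (decodedBit w (s w) e) p) :
    simulator M C w p (List.ofFn (advice M C s w x)) = p.fn m y := by
  have hformat {j : ℕ} (hj : j < 2) : bitAt (List.ofFn (advice M C s w x)) j = 1 := by
    rw [bitAt_advice x (by rw [adviceLen_eq_table h hcount]; omega), adviceBit, if_neg h,
      if_neg hcount, if_pos hj]
  have hmatch := (entryMatches_advice_iff h hcount x).2 ⟨he, hcode⟩
  refine simulator_eq List.length_ofFn ?_
  rw [simulatedState, hformat two_pos, if_neg one_ne_zero, hformat one_lt_two, if_neg one_ne_zero]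
  refine lookup_eq (e := e) (fun e' _ hmatch' => ?_) ?_ hmatch
  · obtain ⟨he', hcode'⟩ := (entryMatches_advice_iff h hcount x).1 hmatch'
    have hstate := endState_eq hM List.length_ofFn hcode' fun _ _ => rfl
    refine numAt_eq (val_lt_two_pow_size _) fun j hj => ?_
    rw [add_assoc, bitAt_advice_table h hcount x he' (Nat.add_lt_add_left hj _), tableBit,
      if_neg (by omega), hstate, Nat.add_sub_cancel_left]
  · have := hmatch.1
    nlinarith only [this, entryLen_pos w]

end Table

theorem foldl_min_succ (b : ℕ) (l : List Bool) (a : ℕ) :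
    l.foldl (fun a _ => min (a + 1) b) (min a b) = min (a + l.length) b := by
  induction l generalizing a with
  | nil => rfl
  | cons x l ih =>
    rw [List.foldl_cons, show min (min a b + 1) b = min (a + 1) b by omega, ih, List.length_cons,
      add_right_comm, add_assoc]

theorem outCount_eq {y : Bits m}
    (hM : M.OutputsInSpace ![Nat.bits w, encAutomaton (onesAutomaton w).1,
      encState (onesAutomaton w).2, List.ofFn fun _ : Fin (s w) => false]
      (List.ofFn y) (C * (s w + 1))) : outCount M C w (s w) = min m (s w + 1) := by
  have hseed (j : ℕ) (hj : j < s w) : 0 = bitAt (List.ofFn fun _ : Fin (s w) => false) j := by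
    rw [bitAt_ofFn _ hj]
    rfl
  rw [outCount, hM.fold_eq (representedBy_genMachine M C List.length_ofFn
    (fun _ hj => onesBit_eq w hj) hseed)]
  simpa using foldl_min_succ (s w + 1) (List.ofFn y) 0

theorem representedBy_decodedMachine {N : OfflineTM 1} {s : ℕ} (hs : (w : ℕ).size ≤ s)
    {g : ℕ → ℕ} (hg : ∀ i < 3, g i < (w : ℕ).size.size) (hk : g 2 = N.k)
    (hbase : g 1 = N.numStates + 3) (htable : g 0 = N.tableCode) :
    N.RepresentedBy ![Nat.bits w] (s / (w : ℕ).size.size)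
      (decodedMachine w s (ofDigits (w : ℕ).size.size 3 g)) where
  k_eq := (digit_ofDigits hg (by norm_num)).trans hk
  base_eq := (digit_ofDigits hg (by norm_num)).trans hbase
  table_eq := (digit_ofDigits hg (by norm_num)).trans htable
  width_eq := rfl
  input_lt i := by
    fin_cases i
    simp [decodedMachine, Nat.size_eq_bits_len]
    omega
  work_lt := by
    have := Nat.div_le_self s (w : ℕ).size.size
    simp only [decodedMachine]
    omega
  read_eq i q := by
    fin_cases i
    exact virtualTape_eq (Nat.size_eq_bits_len _) (fun j _ => (bitAt_bits w j).symm) q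

theorem exists_encodes_decodedBit {N : OfflineTM 1} {L s : ℕ}
    (hN : N.OutputsInSpace ![Nat.bits w] (encAutomaton p.1 ++ encState p.2) L)
    (hs : (w : ℕ).size ≤ s) (hL : L ≤ s / (w : ℕ).size.size) (hk : N.k < (w : ℕ).size.size)
    (hbase : N.numStates + 3 < (w : ℕ).size.size) (htable : N.tableCode < (w : ℕ).size.size) :
    ∃ e < (w : ℕ).size.size ^ 3, Encodes (decodedBit w s e) p := by
  let g : ℕ → ℕ := fun i => if i = 0 then N.tableCode else if i = 1 then N.numStates + 3 else N.k
  have hg : ∀ i < 3, g i < (w : ℕ).size.size := fun i _ => by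
    simp only [g]
    split_ifs <;> assumption
  exact ⟨_, ofDigits_lt hg, fun j hj => (hN.mono hL).outBit_eq
    (representedBy_decodedMachine hs hg rfl rfl rfl) (hj.trans_eq (length_encPointed p).symm)⟩

end Correctness

/-! ### Growth of the parameters -/

section Growth

theorem isLittleO_mul_logb_rpow (C : ℝ) {η : ℝ} (hη : 0 < η) :
    (fun y : ℝ => C * (y + 1) * (Real.logb 2 (y + 1) + 1) + 1) =o[atTop] fun y => y ^ (1 + η) := by
  have hsucc : (fun y : ℝ => y + 1) =O[atTop] id :=
    (isBigO_refl _ _).add (isLittleO_const_id_atTop 1).isBigO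
  have hlog : (fun y : ℝ => Real.logb 2 (y + 1)) =o[atTop] fun y => y ^ η := by
    have hcomp := (isLittleO_log_rpow_atTop hη).comp_tendsto
      (tendsto_atTop_add_const_right atTop (1 : ℝ) tendsto_id)
    simp only [Real.logb, div_eq_inv_mul]
    exact (hcomp.trans_isBigO (hsucc.rpow hη.le (eventually_ge_atTop 0))).const_mul_left _
  have hone {r : ℝ} (hr : 0 < r) : (fun _ : ℝ => (1 : ℝ)) =o[atTop] fun y => y ^ r :=
    isLittleO_const_left.2 (.inr (tendsto_norm_atTop_atTop.comp (tendsto_rpow_atTop hr)))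
  have hprod := (hsucc.const_mul_left C).mul_isLittleO (hlog.add (hone hη))
  have hpow : (fun y : ℝ => id y * y ^ η) =ᶠ[atTop] fun y => y ^ (1 + η) := by
    filter_upwards [eventually_gt_atTop 0] with y hy
    rw [Real.rpow_add hy, Real.rpow_one, id]
  exact (hprod.trans_eventuallyEq hpow).add (hone (by positivity))

theorem tendsto_logb_pnat : Tendsto (fun w : ℕ+ => Real.logb 2 (w : ℕ)) atTop atTop :=
  (Real.tendsto_logb_atTop one_lt_two).comp
    (tendsto_natCast_atTop_atTop.comp tendsto_PNat_val_atTop_atTop)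

theorem size_le_logb_add_one {n : ℕ} : (n.size : ℝ) ≤ Real.logb 2 n + 1 := by
  have hlog : n.size ≤ Nat.log 2 n + 1 :=
    Nat.size_le.2 (Nat.lt_pow_succ_log_self one_lt_two n)
  calc (n.size : ℝ) ≤ Nat.log 2 n + 1 := by exact_mod_cast hlog
    _ ≤ Real.logb 2 n + 1 := by
      gcongr
      exact_mod_cast Real.natLog_le_logb n 2

theorem eventually_space_le (C : ℕ) {η : ℝ} (hη : 0 < η) :
    ∀ᶠ w : ℕ+ in atTop, ∀ s : ℕ, Real.logb 2 (w : ℕ) ^ (1 + η) ≤ s + 1 →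
      C * (Nat.log 2 w + 1) ≤ s / (w : ℕ).size.size := by
  filter_upwards [tendsto_logb_pnat.eventually ((isLittleO_mul_logb_rpow C hη).bound one_pos),
    tendsto_logb_pnat.eventually_ge_atTop 0] with w hw hlog s hs
  have hsize : 0 < (w : ℕ).size := Nat.size_pos.2 w.pos
  rw [Nat.le_div_iff_mul_le (Nat.size_pos.2 hsize)]
  rw [one_mul, Real.norm_of_nonneg (Real.rpow_nonneg hlog _)] at hw
  have hsizeSize : ((w : ℕ).size.size : ℝ) ≤ Real.logb 2 (Real.logb 2 (w : ℕ) + 1) + 1 :=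
    size_le_logb_add_one.trans (by
      gcongr
      exacts [one_lt_two, size_le_logb_add_one])
  have hmul : (C * (Nat.log 2 w + 1) * (w : ℕ).size.size : ℝ) ≤
      C * (Real.logb 2 (w : ℕ) + 1) * (Real.logb 2 (Real.logb 2 (w : ℕ) + 1) + 1) := by
    gcongr
    exact_mod_cast Real.natLog_le_logb w 2
  have hle := hmul.trans (le_sub_iff_add_le.2 (((le_abs_self _).trans hw).trans hs))
  rw [add_sub_cancel_right] at hle
  exact_mod_cast hle

theorem eventually_lt_size_size (n : ℕ) : ∀ᶠ w : ℕ+ in atTop, n < (w : ℕ).size.size := by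
  filter_upwards [tendsto_PNat_val_atTop_atTop.eventually_ge_atTop (2 ^ 2 ^ n)] with w hw
  exact Nat.lt_size.2 (Nat.lt_size.2 hw).le

theorem eventually_add_one_lt {s : ℕ+ → ℕ} {r : ℝ}
    (hs : (fun w : ℕ+ => (s w : ℝ)) =O[atTop] fun w : ℕ+ => Real.logb 2 (w : ℕ) ^ r) :
    ∀ᶠ w : ℕ+ in atTop, s w + 1 < w := by
  have hcast : Tendsto (fun w : ℕ+ => ((w : ℕ) : ℝ)) atTop atTop :=
    tendsto_natCast_atTop_atTop.comp tendsto_PNat_val_atTop_atTop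
  have hlog : (fun w : ℕ+ => Real.logb 2 (w : ℕ) ^ r) =O[atTop]
      fun w : ℕ+ => Real.log (w : ℕ) ^ r := by
    refine .of_bound ‖(Real.log 2 ^ r)⁻¹‖ (.of_forall fun w => le_of_eq ?_)
    rw [Real.logb, Real.div_rpow (Real.log_natCast_nonneg _) (Real.log_pos one_lt_two).le,
      div_eq_inv_mul, norm_mul]
  have hlittle := (hs.trans hlog).trans_isLittleO
    ((isLittleO_log_rpow_rpow_atTop r one_pos).comp_tendsto hcast)
  filter_upwards [hlittle.bound one_half_pos, hcast.eventually_gt_atTop 2] with w hw hw₂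
  simp only [Function.comp, Real.rpow_one, Real.norm_natCast] at hw
  have : (s w : ℝ) + 1 < (w : ℕ) := by linarith
  exact_mod_cast this

theorem exists_le_add {s : ℕ+ → ℕ} (hs : ∀ᶠ w : ℕ+ in atTop, s w + 1 < w) :
    ∃ K, ∀ w, s w ≤ K + w := by
  obtain ⟨N, hN⟩ := eventually_atTop.1 hs
  obtain ⟨K, hK⟩ := ((Set.finite_Iio N).image s).bddAbove
  refine ⟨K, fun w => ?_⟩
  rcases lt_or_ge w N with h | h
  · exact (hK ⟨w, h, rfl⟩).trans (Nat.le_add_right _ _)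
  · have := hN w h
    omega

theorem exists_adviceLen_le (M : OfflineTM 4) (C : ℕ) {s : ℕ+ → ℕ}
    (hs : ∀ᶠ w : ℕ+ in atTop, s w + 1 < w) :
    ∃ c : ℕ, ∀ w : ℕ+, adviceLen M C w (s w) ≤ c * (w : ℕ) ^ c := by
  obtain ⟨K, hK⟩ := exists_le_add hs
  refine ⟨K + 6, fun w => ?_⟩
  have hw : 1 ≤ (w : ℕ) := w.pos
  have hsize := size_le_self w
  have hsizeSize := (size_le_self (w : ℕ).size).trans hsize
  have hpow₁ : (w : ℕ) ≤ (w : ℕ) ^ (K + 6) := Nat.le_self_pow (by omega) _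
  have hpow₅ : (w : ℕ) ^ 5 ≤ (w : ℕ) ^ (K + 6) := Nat.pow_le_pow_right hw (by omega)
  have hseed : s w + 2 ≤ (K + 6) * (w : ℕ) ^ (K + 6) := by
    nlinarith only [hK w, hw, hpow₁, Nat.mul_le_mul_left K hpow₁, Nat.mul_le_mul_left K hw]
  rw [adviceLen, entryLen]
  split_ifs
  · exact hseed
  · omega
  · calc (w : ℕ).size.size ^ 3 * ((2 * w + 1) * (w : ℕ).size + (w : ℕ).size) + 2
        ≤ (w : ℕ) ^ 3 * ((2 * w + w) * w + w * w) + 2 * (w : ℕ) ^ 5 := by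
          gcongr
          · exact hsize.trans (Nat.le_mul_of_pos_left _ hw)
          · exact Nat.le_mul_of_pos_right _ (pow_pos hw 5)
      _ = 6 * (w : ℕ) ^ 5 := by ring
      _ ≤ _ := Nat.mul_le_mul (by omega) hpow₅

end Growth

theorem tvClose_simulator_advice {M : OfflineTM 4} {C : ℕ} {s : ℕ+ → ℕ} {w : ℕ+} {m : ℕ} {ε : ℝ}
    {p : Pointed w} {f g : Bits (s w) → Bits m} (hε : 0 ≤ ε) (hw : s w + 1 < w)
    (hMp : ∀ x, M.OutputsInSpace ![Nat.bits w, encAutomaton p.1, encState p.2, List.ofFn x]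
      (List.ofFn (f x)) (C * (s w + 1)))
    (hp : TVClose ε (law fun x => p.fn m (f x)) (law (p.fn m)))
    (hMones : M.OutputsInSpace ![Nat.bits w, encAutomaton (onesAutomaton w).1,
      encState (onesAutomaton w).2, List.ofFn fun _ : Fin (s w) => false]
      (List.ofFn (g fun _ => false)) (C * (s w + 1)))
    (hones : TVClose ε (law fun x => (onesAutomaton w).fn m (g x)) (law ((onesAutomaton w).fn m)))
    (hcode : (w : ℕ).size ≤ s w → ((2 : ℝ) ^ (s w + 1))⁻¹ ≤ ε →
      ∃ e < (w : ℕ).size.size ^ 3, Encodes (decodedBit w (s w) e) p) :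
    TVClose ε (law fun x => simulator M C w p (List.ofFn (advice M C s w x))) (law (p.fn m)) := by
  by_cases hsize : s w < (w : ℕ).size
  · simpa only [simulator_advice_of_lt_size hsize _ (hMp _)] using hp
  have houtCount := outCount_eq hMones
  by_cases hcount : outCount M C w (s w) ≤ s w
  · have hm : m ≤ s w := by omega
    simp only [simulator_advice_of_outCount_eq hsize (houtCount.trans (by omega)) hm]
    rw [law_comp_castLE hm]
    exact .refl hε _
  · obtain ⟨e, he, hencodes⟩ :=
      hcode (not_lt.1 hsize) (half_pow_le_of_tvClose _ hw (by omega) hones)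
    simpa only [simulator_advice_of_encodes hsize hcount _ (hMp _) he hencodes] using hp

theorem eventually_exists_encodes_decodedBit {p : (w : ℕ+) → Pointed w}
    (hp : IsUniformSequence p) {η : ℝ} (hη : 0 < η) :
    ∀ᶠ w : ℕ+ in atTop, ∀ s : ℕ, (w : ℕ).size ≤ s → Real.logb 2 (w : ℕ) ^ (1 + η) ≤ s + 1 →
      ∃ e < (w : ℕ).size.size ^ 3, Encodes (decodedBit w s e) (p w) := by
  obtain ⟨N, D, hN⟩ := hp
  filter_upwards [eventually_space_le D hη, eventually_lt_size_size N.k,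
    eventually_lt_size_size (N.numStates + 3), eventually_lt_size_size N.tableCode]
    with w hspace hk hbase htable s hs hlog
  exact exists_encodes_decodedBit (hN w) hs (hspace s hlog) hk hbase htable

theorem le_add_one_of_half_pow_le {ε y : ℝ} {s : ℕ} (hε : 0 < ε) (hy : y ≤ Real.logb 2 (1 / ε))
    (h : ((2 : ℝ) ^ (s + 1))⁻¹ ≤ ε) : y ≤ s + 1 := by
  refine hy.trans ?_
  rw [Real.logb_le_iff_le_rpow one_lt_two (one_div_pos.2 hε), one_div]
  exact_mod_cast inv_le_of_inv_le₀ (by positivity) h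

end SpaceDerand

open SpaceDerand Filter Asymptotics in
theorem mainTheorem4_general {η : ℝ} (hη : 0 < η) (s m : ℕ+ → ℕ) (ε : ℕ+ → ℝ)
    (hs : ∀ᶠ w : ℕ+ in atTop, s w + 1 < w)
    (hε : ∀ᶠ w : ℕ+ in atTop,
      0 < ε w ∧ Real.logb 2 (w : ℕ) ^ (1 + η) ≤ Real.logb 2 (1 / ε w))
    (A : (w : ℕ+) → Set (Pointed w)) (hA : CoversUniform A)
    (Gen : (w : ℕ+) → A w → Bits (s w) → Bits (m w))
    (hprg : ∀ w, IsTargetedPRG (ε w) (A w) (Gen w))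
    (heff : EfficientTargeted A Gen) :
    ∃ (a : ℕ+ → ℕ) (Gen' : (w : ℕ+) → Bits (s w) → Bits (a w))
      (A' : (w : ℕ+) → Set (Pointed w)),
      (∃ c : ℕ, ∀ w : ℕ+, a w ≤ c * (w : ℕ) ^ c) ∧
      EfficientAdvice Gen' ∧
      CoversUniform A' ∧
      IsSimulationAdviceGenerator ε m A' Gen' := by
  obtain ⟨M, C, hM⟩ := heff.2
  let A' : (w : ℕ+) → Set (Pointed w) := fun w =>
    {p | TVClose (ε w) (law fun x => simulator M C w p (List.ofFn (advice M C s w x)))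
      (law (p.fn (m w)))}
  refine ⟨_, advice M C s, A', exists_adviceLen_le M C hs, ⟨heff.1, computable_advice M C s⟩, ?_,
    simulator M C, isLogspaceAlgorithm_simulator M C, fun w p => p.2⟩
  intro p hp
  filter_upwards [hA p hp, hA onesAutomaton isUniformSequence_onesAutomaton, hs, hε,
    eventually_exists_encodes_decodedBit hp hη] with w hpA honesA hw ⟨hεpos, hεlog⟩ hcode
  exact tvClose_simulator_advice hεpos.le hw (fun x => hM ⟨w, ⟨p w, hpA⟩, x⟩) (hprg w ⟨p w, hpA⟩)
    (hM ⟨w, ⟨onesAutomaton w, honesA⟩, fun _ => false⟩) (hprg w ⟨onesAutomaton w, honesA⟩)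
    fun hsize hhalf => hcode _ hsize (le_add_one_of_half_pow_le hεpos hεlog hhalf)

open SpaceDerand Filter Asymptotics in
theorem mainTheorem4 (μ σ η : ℝ) (hμ₀ : 0 ≤ μ) (hμ₁ : μ ≤ 1) (hη : 0 < η) (hση : η < σ)
    (s m : ℕ+ → ℕ) (ε : ℕ+ → ℝ)
    (hs : (fun w : ℕ+ => (s w : ℝ)) =O[atTop] fun w : ℕ+ => Real.logb 2 (w : ℕ) ^ (1 + σ))
    (hε : ∀ w : ℕ+, 0 < ε w ∧ Real.logb 2 (1 / ε w) = Real.logb 2 (w : ℕ) ^ (1 + η))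
    (hm : ∀ w : ℕ+, 2 ≤ w → Real.logb 2 (w : ℕ) ^ μ ≤ Real.logb 2 (m w))
    (A : (w : ℕ+) → Set (Pointed w)) (hA : CoversUniform A)
    (Gen : (w : ℕ+) → A w → Bits (s w) → Bits (m w))
    (hprg : ∀ w, IsTargetedPRG (ε w) (A w) (Gen w))
    (heff : EfficientTargeted A Gen) :
    ∃ (a : ℕ+ → ℕ) (Gen' : (w : ℕ+) → Bits (s w) → Bits (a w))
      (A' : (w : ℕ+) → Set (Pointed w)),
      (∃ c : ℕ, ∀ w : ℕ+, a w ≤ c * (w : ℕ) ^ c) ∧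
      EfficientAdvice Gen' ∧
      CoversUniform A' ∧
      IsSimulationAdviceGenerator ε m A' Gen' :=
  mainTheorem4_general hη s m ε (eventually_add_one_lt hs)
    (.of_forall fun w => ⟨(hε w).1, (hε w).2.ge⟩) A hA Gen hprg heff
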